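/- **Theorem (existence of invariant Dirac structures of every real index).** Let $\mathfrak g$ be a complex semisimple Lie algebra with Cartan subalgebra $\mathfrak h$, a choice of positive roots, and a Weyl basis $(X_\alpha)$, i.e. root vectors $X_\alpha\in\mathfrak g_\alpha$ with $\langle X_\alpha,X_{-\alpha}\rangle=1$ for the Killing form and $[X_\alpha,X_\beta]=m_{\alpha,\beta}X_{\alpha+\beta}$ if $\alpha+\beta$ is a root, $[X_\alpha,X_\beta]=0$ if $\alpha+\beta$ is neither a root nor $0$, where $m_{\alpha,\beta}\in\mathbb R$ and $m_{-\alpha,-\beta}=-m_{\alpha,\beta}$. Let $l$ be the number of positive roots. Let $\mathfrak b=\mathfrak h\oplus\sum_{\alpha>0}\mathfrak g_\alpha$ be the Borel subalgebra and let $$\mathfrak u=\operatorname{span}_{\mathbb R}\{\, i\mathfrak h_{\mathbb R},\ X_\alpha-X_{-\alpha},\ i(X_\alpha+X_{-\alpha}) : \alpha>0\,\}$$ be the compact real form of $\mathfrak g$, where $\mathfrak h_{\mathbb R}$ is the real span of the elements $H_\alpha\in\mathfrak h$ with $\alpha(\cdot)=\langle H_\alpha,\cdot\rangle$. Let $U$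 be a connected Lie group with Lie algebra $\mathfrak u$, let $T\subseteq U$ be the connected subgroup with Lie algebra $\mathfrak t=\mathfrak b\cap\mathfrak u$ (a maximal torus), and let $\mathbb F=U/T$ be the maximal flag manifold, with the smooth structure for which $U\to U/T$ is a smooth submersion. Then for every integer $k$ with $0\le k\le l$ there is a $U$-invariant complex Dirac structure $L$ on $\mathbb F$ whose real index is constant and equal to $2k$, that is, $\dim_{\mathbb C}(L_x\cap\overline{L_x})=2k$ for every $x\in\mathbb F$. Here a complex Dirac structure on a manifold $M$ is a smooth complex subbundle $L\subseteq(TM\oplus T^*M)\otimes\mathbb C$ which is maximal isotropic for the $\mathbb C$-bilinear extension of $\langle X+\xi,Y+\eta\rangle=\tfrac12(\xi(Y)+\eta(X))$ and whose smooth sections are closed under the $\mathbb C$-bilinear extension of the Courant bracket $[X+\xi,Y+\eta]=[X,Y]+\mathcal L_X\eta-\mathcal L_Y\xi-\tfrac12 d(i_X\eta-i_Y\xi)$. It is $U$-invariant if for every $g\in U$ and $x\in\mathbb F$ the map $X+\xi\mapsto (\phi_g)_*X+(\phi_g^{-1})^*\xi$ induced by $\phi_g:x\mapsto g\cdot x$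 sends $L_x$ onto $L_{g\cdot x}$. -/

import Mathlib

open scoped Manifold ContDiff TensorProduct

noncomputable section

/-! ### The complexification of a real vector space -/

section Complexification

variable {W : Type*} [AddCommGroup W] [Module ℝ W]

/-- The real part `a` of an element `1 ⊗ a + i ⊗ b` of the complexification `ℂ ⊗ W`. -/
def complexificationRe : ℂ ⊗[ℝ] W →ₗ[ℝ] W :=
  (TensorProduct.lid ℝ W).toLinearMap ∘ₗ TensorProduct.map Complex.reLm LinearMap.id

/-- The imaginary part `b` of an element `1 ⊗ a + i ⊗ b` of the complexification `ℂ ⊗ W`. -/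
def complexificationIm : ℂ ⊗[ℝ] W →ₗ[ℝ] W :=
  (TensorProduct.lid ℝ W).toLinearMap ∘ₗ TensorProduct.map Complex.imLm LinearMap.id

/-- The element `a + i b = 1 ⊗ a + i ⊗ b` of the complexification. -/
def complexificationMk (a b : W) : ℂ ⊗[ℝ] W := (1 : ℂ) ⊗ₜ[ℝ] a + Complex.I ⊗ₜ[ℝ] b

/-- Complex conjugation `z ⊗ w ↦ z̄ ⊗ w` on the complexification. -/
def complexificationConj : ℂ ⊗[ℝ] W →ₗ[ℝ] ℂ ⊗[ℝ] W :=
  TensorProduct.map Complex.conjAe.toLinearMap LinearMap.id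

theorem complexificationConj_smul (c : ℂ) (z : ℂ ⊗[ℝ] W) :
    complexificationConj (c • z) = (starRingEnd ℂ) c • complexificationConj z := by
  induction z using TensorProduct.induction_on with
  | zero => simp
  | tmul a w => simp [complexificationConj, TensorProduct.smul_tmul']
  | add x y hx hy => simp [smul_add, map_add, hx, hy]

theorem complexificationMk_re_im (z : ℂ ⊗[ℝ] W) :
    complexificationMk (complexificationRe z) (complexificationIm z) = z := by
  induction z using TensorProduct.induction_on with
  | zero => simp [complexificationMk]
  | tmul a w =>
    simp only [complexificationMk, complexificationRe, complexificationIm, LinearMap.comp_apply,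
      TensorProduct.map_tmul, LinearEquiv.coe_coe, TensorProduct.lid_tmul, LinearMap.id_apply,
      ← TensorProduct.smul_tmul, ← TensorProduct.add_tmul]
    congr 1
    apply Complex.ext <;> simp
  | add x y hx hy =>
    rw [map_add, map_add]
    nth_rewrite 3 [← hx]
    nth_rewrite 3 [← hy]
    simp only [complexificationMk, TensorProduct.tmul_add]
    abel

/-- The complex conjugate `L̄` of a complex subspace `L` of the complexification
(as conjugation is an involution, `z ∈ L̄` if and only if `z̄ ∈ L`). -/
def conjSubmodule (L : Submodule ℂ (ℂ ⊗[ℝ] W)) : Submodule ℂ (ℂ ⊗[ℝ] W) where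
  carrier := {z | complexificationConj z ∈ L}
  add_mem' := by
    intro a b ha hb
    simpa only [Set.mem_ofPred_eq, map_add] using L.add_mem ha hb
  zero_mem' := by simp
  smul_mem' := by
    intro c z hz
    simpa only [Set.mem_ofPred_eq, complexificationConj_smul] using L.smul_mem _ hz

end Complexification

/-! ### Complex Dirac structures on a manifold -/

section Dirac

variable (E : Type*) [NormedAddCommGroup E] [NormedSpace ℝ E]
  {M : Type*} [TopologicalSpace M] [ChartedSpace E M]

/-- The fibre `T_x M ⊕ T_x^* M`. -/
abbrev GenTangentSpace (x : M) : Type _ :=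
  TangentSpace 𝓘(ℝ, E) x × (TangentSpace 𝓘(ℝ, E) x →L[ℝ] ℝ)

/-- The fibre `(T_x M ⊕ T_x^* M) ⊗ ℂ`. -/
abbrev ComplexGenTangentSpace (x : M) : Type _ := ℂ ⊗[ℝ] GenTangentSpace E x

/-- The natural symmetric pairing `⟨X + ξ, Y + η⟩ = (ξ(Y) + η(X)) / 2` on `T_x M ⊕ T_x^* M`. -/
def genPairing (x : M) : LinearMap.BilinForm ℝ (GenTangentSpace E x) :=
  LinearMap.mk₂ ℝ (fun a b => (1 / 2 : ℝ) * (a.2 b.1 + b.2 a.1))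
    (by intro a a' b; simp; ring)
    (by intro c a b; simp; ring)
    (by intro a b b'; simp; ring)
    (by intro c a b; simp; ring)

/-- The `ℂ`-bilinear extension of the natural pairing to `(T_x M ⊕ T_x^* M) ⊗ ℂ`. -/
def complexGenPairing (x : M) : LinearMap.BilinForm ℂ (ComplexGenTangentSpace E x) :=
  (genPairing E x).baseChange ℂ

/-- A complex subspace of `(T_x M ⊕ T_x^* M) ⊗ ℂ` is isotropic if the pairing vanishes on it. -/
def IsIsotropic (x : M) (L : Submodule ℂ (ComplexGenTangentSpace E x)) : Prop :=
  ∀ a ∈ L, ∀ b ∈ L, complexGenPairing E x a b = 0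

/-- The `1`-form `η` written in the preferred chart around `x`, i.e. pulled back by the inverse of this chart. -/
def chartOneForm (x : M) (η : (y : M) → (TangentSpace 𝓘(ℝ, E) y →L[ℝ] ℝ)) (z : E) : E →L[ℝ] ℝ :=
  (η ((extChartAt 𝓘(ℝ, E) x).symm z)).comp
    (mfderiv 𝓘(ℝ, E) 𝓘(ℝ, E) (extChartAt 𝓘(ℝ, E) x).symm z)

/-- The contraction `i_v (dη)` at `x` of the exterior derivative of the `1`-form `η` with the
tangent vector `v`. In the chart around `x` it is `w ↦ D_v η (w) - D_w η (v)`. -/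
def interiorExtDeriv (η : (y : M) → (TangentSpace 𝓘(ℝ, E) y →L[ℝ] ℝ)) (x : M)
    (v : TangentSpace 𝓘(ℝ, E) x) : TangentSpace 𝓘(ℝ, E) x →L[ℝ] ℝ :=
  let φ' : TangentSpace 𝓘(ℝ, E) x →L[ℝ] E := mfderiv 𝓘(ℝ, E) 𝓘(ℝ, E) (extChartAt 𝓘(ℝ, E) x) x
  let D : E →L[ℝ] E →L[ℝ] ℝ := fderiv ℝ (chartOneForm E x η) (extChartAt 𝓘(ℝ, E) x x)
  (D (φ' v) - D.flip (φ' v)).comp φ'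

/-- The differential at `x` of a real function on `M`. -/
def functionDifferential (f : M → ℝ) (x : M) : TangentSpace 𝓘(ℝ, E) x →L[ℝ] ℝ :=
  mfderiv 𝓘(ℝ, E) 𝓘(ℝ, ℝ) f x

/-- The Lie derivative `L_X η = i_X dη + d (i_X η)` of a `1`-form. -/
def lieDerivOneForm (X : (y : M) → TangentSpace 𝓘(ℝ, E) y)
    (η : (y : M) → (TangentSpace 𝓘(ℝ, E) y →L[ℝ] ℝ)) (x : M) : TangentSpace 𝓘(ℝ, E) x →L[ℝ] ℝ :=
  interiorExtDeriv E η x (X x) + functionDifferential E (fun y => η y (X y)) x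

/-- The Courant bracket
`[X + ξ, Y + η] = [X, Y] + L_X η - L_Y ξ - d (i_X η - i_Y ξ) / 2` of sections of `TM ⊕ T^*M`. -/
def courantBracket (a b : (y : M) → GenTangentSpace E y) (x : M) : GenTangentSpace E x :=
  (VectorField.mlieBracket 𝓘(ℝ, E) (fun y => (a y).1) (fun y => (b y).1) x,
    lieDerivOneForm E (fun y => (a y).1) (fun y => (b y).2) x
      - lieDerivOneForm E (fun y => (b y).1) (fun y => (a y).2) x
      - (1 / 2 : ℝ) • functionDifferential E (fun y => (b y).2 (a y).1 - (a y).2 (b y).1) x)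

/-- The `ℂ`-bilinear extension of the Courant bracket to sections of `(TM ⊕ T^*M) ⊗ ℂ`:
`[a + i b, c + i d] = ([a, c] - [b, d]) + i ([a, d] + [b, c])`. -/
def complexCourantBracket (s t : (y : M) → ComplexGenTangentSpace E y) (x : M) :
    ComplexGenTangentSpace E x :=
  complexificationMk
    (courantBracket E (fun y => complexificationRe (s y)) (fun y => complexificationRe (t y)) x
      - courantBracket E (fun y => complexificationIm (s y)) (fun y => complexificationIm (t y)) x)
    (courantBracket E (fun y => complexificationRe (s y)) (fun y => complexificationIm (t y)) x
      + courantBracket E (fun y => complexificationIm (s y)) (fun y => complexificationRe (t y)) x)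

/-- The section `X + ξ` of `TM ⊕ T^*M` is smooth on `V`: the vector field `X` and the `1`-form
`ξ` are smooth on `V`. -/
def IsSmoothSectionOn [IsManifold 𝓘(ℝ, E) ∞ M] (a : (y : M) → GenTangentSpace E y)
    (V : Set M) : Prop :=
  ContMDiffOn 𝓘(ℝ, E) (𝓘(ℝ, E).prod 𝓘(ℝ, E)) ∞
      (fun y => Bundle.TotalSpace.mk' E (E := fun y : M => TangentSpace 𝓘(ℝ, E) y) y (a y).1) V ∧
    ContMDiffOn 𝓘(ℝ, E) (𝓘(ℝ, E).prod 𝓘(ℝ, E →L[ℝ] ℝ)) ∞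
      (fun y => Bundle.TotalSpace.mk' (E →L[ℝ] ℝ)
        (E := fun y : M => TangentSpace 𝓘(ℝ, E) y →L[ℝ] Bundle.Trivial M ℝ y) y (a y).2) V

/-- A section of `(TM ⊕ T^*M) ⊗ ℂ` is smooth on `V` if its real and imaginary parts are. -/
def IsSmoothComplexSectionOn [IsManifold 𝓘(ℝ, E) ∞ M]
    (s : (y : M) → ComplexGenTangentSpace E y) (V : Set M) : Prop :=
  IsSmoothSectionOn E (fun y => complexificationRe (s y)) V ∧
    IsSmoothSectionOn E (fun y => complexificationIm (s y)) V

variable (M) in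
/-- A complex Dirac structure on `M`: a maximal isotropic (smooth, complex) subbundle of
`(TM ⊕ T^*M) ⊗ ℂ` whose sections are closed under the Courant bracket. -/
structure ComplexDiracStructure [IsManifold 𝓘(ℝ, E) ∞ M] where
  /-- The fibre of the subbundle. -/
  fiber : (x : M) → Submodule ℂ (ComplexGenTangentSpace E x)
  /-- The fibres form a smooth subbundle: there are smooth local frames. -/
  smooth : ∀ x₀ : M, ∃ V : Set M, IsOpen V ∧ x₀ ∈ V ∧ ∃ (r : ℕ)
    (s : Fin r → (y : M) → ComplexGenTangentSpace E y),
    (∀ j, IsSmoothComplexSectionOn E (s j) V) ∧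
    ∀ y ∈ V, LinearIndependent ℂ (fun j => s j y) ∧
      Submodule.span ℂ (Set.range fun j => s j y) = fiber y
  /-- The fibres are maximal isotropic. -/
  maximal_isotropic : ∀ x : M, Maximal (IsIsotropic E x) (fiber x)
  /-- The bracket of two smooth sections over an open set is again a section. -/
  involutive : ∀ V : Set M, IsOpen V → ∀ s t : (y : M) → ComplexGenTangentSpace E y,
    IsSmoothComplexSectionOn E s V → IsSmoothComplexSectionOn E t V →
    (∀ y ∈ V, s y ∈ fiber y) → (∀ y ∈ V, t y ∈ fiber y) →
    ∀ y ∈ V, complexCourantBracket E s t y ∈ fiber y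

variable {E}

/-- The real index `dim_ℂ (L_x ∩ L̄_x)` of a complex Dirac structure at `x`. -/
def ComplexDiracStructure.realIndex [IsManifold 𝓘(ℝ, E) ∞ M] (L : ComplexDiracStructure E M)
    (x : M) : ℕ :=
  Module.finrank ℂ ↥(L.fiber x ⊓ conjSubmodule (L.fiber x))

variable (E) in
/-- The lift `X + ξ ↦ f_* X + (f⁻¹)^* ξ`, from `T_x M ⊕ T_x^* M` to
`T_{f(x)} M ⊕ T_{f(x)}^* M`, of a diffeomorphism `f`. -/
def genTangentLift (f : M → M) (x : M) : GenTangentSpace E x →ₗ[ℝ] GenTangentSpace E (f x) where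
  toFun a := (mfderiv 𝓘(ℝ, E) 𝓘(ℝ, E) f x a.1,
    a.2.comp (mfderiv 𝓘(ℝ, E) 𝓘(ℝ, E) f x).inverse)
  map_add' := by intro a b; simp
  map_smul' := by intro c a; simp

/-- A complex Dirac structure is invariant under the action of `U` if the lifts of the
diffeomorphisms `x ↦ g • x` map `L_x` onto `L_{g • x}`. -/
def ComplexDiracStructure.IsInvariant [IsManifold 𝓘(ℝ, E) ∞ M] (L : ComplexDiracStructure E M)
    (U : Type*) [Group U] [MulAction U M] : Prop :=
  ∀ (g : U) (x : M),
    (L.fiber x).map ((genTangentLift E (fun y : M => g • y) x).baseChange ℂ) = L.fiber (g • x)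

end Dirac

/-! ### Lie-algebraic data of the flag manifold -/

section Flag

open LieAlgebra LieAlgebra.IsKilling

variable {𝔤 : Type*} [LieRing 𝔤] [LieAlgebra ℂ 𝔤] [FiniteDimensional ℂ 𝔤]
  [LieAlgebra.IsSemisimple ℂ 𝔤] (𝔥 : LieSubalgebra ℂ 𝔤) [𝔥.IsCartanSubalgebra]

variable {𝔥} in
/-- The root `-α`. -/
def negRoot (α : 𝔥.root) : 𝔥.root :=
  ⟨-α.1, by
    have h := α.2
    simp only [LieSubalgebra.root, Finset.mem_filter, Finset.mem_univ, true_and] at h ⊢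
    exact LieModule.Weight.IsNonZero.neg h⟩

/-- A Weyl basis: root vectors `X_α` with `⟨X_α, X_{-α}⟩ = 1` for the Killing form and
`[X_α, X_β] = m_{α,β} X_{α+β}` if `α + β` is a root, `[X_α, X_β] = 0` if `α + β` is neither a root
nor zero, where the `m_{α,β}` are real and `m_{-α,-β} = - m_{α,β}`. -/
structure WeylBasis where
  /-- The root vectors. -/
  X : 𝔥.root → 𝔤
  /-- The structure constants. -/
  m : 𝔥.root → 𝔥.root → ℝ
  mem_rootSpace : ∀ α : 𝔥.root, X α ∈ rootSpace 𝔥 (α : LieModule.Weight ℂ 𝔥 𝔤)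
  killing_eq_one : ∀ α : 𝔥.root, killingForm ℂ 𝔤 (X α) (X (negRoot α)) = 1
  lie_eq_smul : ∀ α β γ : 𝔥.root,
    (∀ H : 𝔥, γ.1 H = α.1 H + β.1 H) → ⁅X α, X β⁆ = (m α β : ℂ) • X γ
  lie_eq_zero : ∀ α β : 𝔥.root, β ≠ negRoot α →
    (¬ ∃ γ : 𝔥.root, ∀ H : 𝔥, γ.1 H = α.1 H + β.1 H) → ⁅X α, X β⁆ = 0
  m_neg : ∀ α β : 𝔥.root, m (negRoot α) (negRoot β) = - m α β

variable {𝔥}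

/-- The element `H_α ∈ 𝔥` with `α(·) = ⟨H_α, ·⟩` for the Killing form. -/
def rootDualVector (α : 𝔥.root) : 𝔤 :=
  ((cartanEquivDual 𝔥).symm (LieModule.Weight.toLinear ℂ 𝔥 𝔤 α.1) : 𝔥)

/-- The vector `A_α = X_α - X_{-α}`. -/
def WeylBasis.A (B : WeylBasis 𝔥) (α : 𝔥.root) : 𝔤 := B.X α - B.X (negRoot α)

/-- The vector `S_α = i (X_α + X_{-α})`. -/
def WeylBasis.S (B : WeylBasis 𝔥) (α : 𝔥.root) : 𝔤 := Complex.I • (B.X α + B.X (negRoot α))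

/-- The compact real form `𝔲 = span_ℝ {i 𝔥_ℝ, A_α, S_α : α positive}`, where `𝔥_ℝ` is the real
span of the `H_α`. -/
def WeylBasis.compactRealForm (B : WeylBasis 𝔥) (Δ : (rootSystem 𝔥).Base) : Submodule ℝ 𝔤 :=
  Submodule.span ℝ
    ({Z | ∃ α : 𝔥.root, Z = Complex.I • rootDualVector α} ∪
      {Z | ∃ α : 𝔥.root, Δ.IsPos α ∧ (Z = B.A α ∨ Z = B.S α)})

/-- The Borel subalgebra `𝔟 = 𝔥 ⊕ ∑_{α positive} 𝔤_α`. -/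
def borelSubalgebra (Δ : (rootSystem 𝔥).Base) : Submodule ℂ 𝔤 :=
  𝔥.toSubmodule ⊔ ⨆ α : {α : 𝔥.root // Δ.IsPos α},
    (rootSpace 𝔥 (α.1 : LieModule.Weight ℂ 𝔥 𝔤)).toSubmodule

/-- The Lie algebra `𝔱 = 𝔟 ∩ 𝔲` of the maximal torus. -/
def WeylBasis.torusAlgebra (B : WeylBasis 𝔥) (Δ : (rootSystem 𝔥).Base) : Submodule ℝ 𝔤 :=
  (borelSubalgebra Δ).restrictScalars ℝ ⊓ B.compactRealForm Δ

end Flag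

/-- The connected subgroup of a Lie group `U` with Lie algebra `𝔰`: it is generated by
`exp ξ = γ(1)`, `ξ ∈ 𝔰`, where `γ` is the integral curve of the left-invariant vector field
of `ξ` with `γ(0) = 1`. -/
def integralSubgroup {E : Type*} [NormedAddCommGroup E] [NormedSpace ℝ E]
    {U : Type*} [TopologicalSpace U] [ChartedSpace E U] [Group U]
    (𝔰 : Set (GroupLieAlgebra 𝓘(ℝ, E) U)) : Subgroup U :=
  Subgroup.closure {g | ∃ ξ ∈ 𝔰, ∃ γ : ℝ → U, γ 0 = 1 ∧
    IsMIntegralCurve (I := 𝓘(ℝ, E)) γ (mulInvariantVectorField ξ) ∧ γ 1 = g}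

end

/-! The Dirac structure is `L = E ⊕ Ann E` for an invariant involutive complex subbundle `E` of the
complexified tangent bundle. Choose a set `P` of `l - k` positive roots containing, with each root,
all positive roots of greater height. Heights are additive, so `P` is closed under sums that are
roots, and `𝔥 ⊕ ∑_{α ∈ P} 𝔤_α` is a complex subalgebra of `𝔤 = 𝔲 ⊗ ℂ`. Its image in the quotient by
`𝔱 ⊗ ℂ = 𝔥`, moved around by `U`, is `E`. No root of `P` has its negative in `P`, so `E ∩ Ē = 0` and
`L ∩ L̄ = Ann (E + Ē)`, which has dimension `2 l - 2 (l - k) = 2 k`.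

The algebra is reduced to the map `θ` sending `u ∈ 𝔲` to the numbers `⟨X_α, u⟩`, `α > 0`. It is onto
with kernel `𝔱`, and in these coordinates `x + i y` lies in `E` when `PairIn P` holds
(`WeylBasis.pairIn_rootCoordinates_iff`). The properties needed later are collected in
`IsRootCoordinates` and proved in `WeylBasis.exists_isRootCoordinates`.

Three geometric facts carry the rest. The differential of `U → U/T` has kernel exactly `ker θ`
(`mfderiv_mk_mulInvariantVectorField_eq_zero_iff`), because `𝔱` is its own centralizer. Changing the
representative of a coset multiplies the coordinates by an invertible diagonal matrix
(`exists_projectionDeriv_mul`), so `E` is well defined. Finally `dη` vanishes on `E` for every form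
`η` annihilating `E` (`interiorExtDeriv_eq_zero_of_pairIn`): pulled back to `U`, `η` kills the
left-invariant fields of the subalgebra, and Cartan's formula leaves only `-η [X, Y] = 0`. Cartan's
formula is needed along a map, `interiorExtDeriv_mfderiv_apply`, since left-invariant fields do not
descend to `U/T` in general.

Vanishing of `dη` gives involutivity of `E`, and it also makes `L_X η` annihilate `E`. Together
these are closure of `L` under the Courant bracket (`diracOfFrames`). The dimension count is
`finrank_regularFiber_inf_conj`. -/

open scoped Topology

section

open VectorField Set

/-! ### Derivatives of vector-valued functions on manifolds -/

section VectorValuedDerivative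

variable {E : Type*} [NormedAddCommGroup E] [NormedSpace ℝ E]
  {H : Type*} [TopologicalSpace H] {I : ModelWithCorners ℝ E H}
  {N : Type*} [TopologicalSpace N] [ChartedSpace H N]
  {E' : Type*} [NormedAddCommGroup E'] [NormedSpace ℝ E']
  {H' : Type*} [TopologicalSpace H'] {I' : ModelWithCorners ℝ E' H'}
  {M : Type*} [TopologicalSpace M] [ChartedSpace H' M]
  {G : Type*} [NormedAddCommGroup G] [NormedSpace ℝ G]
  {G' : Type*} [NormedAddCommGroup G'] [NormedSpace ℝ G']

theorem mvfderiv_apply_eq_mfderiv (F : N → G) (x : N) (v : TangentSpace I x) :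
    mvfderiv I F x v = mfderiv I 𝓘(ℝ, G) F x v := rfl

theorem Filter.EventuallyEq.mvfderiv_eq {F F' : N → G} {x : N} (h : F =ᶠ[𝓝 x] F') :
    mvfderiv I F x = mvfderiv I F' x :=
  h.mfderiv_eq

theorem mvfderiv_comp_mfderiv {F : M → G} {f : N → M} {x : N}
    (hF : MDifferentiableAt I' 𝓘(ℝ, G) F (f x)) (hf : MDifferentiableAt I I' f x)
    (v : TangentSpace I x) :
    mvfderiv I (fun z => F (f z)) x v = mvfderiv I' F (f x) (mfderiv I I' f x v) :=
  congrArg (fun L => L v) (mfderiv_comp (I' := I') x hF hf)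

/-- The base point of `F` is a separate variable because in the applications it equals `f x` only
propositionally, as with `g * 1` and `g`. -/
theorem mvfderiv_comp_mfderiv_of_eq {F : M → G} {f : N → M} {x : N} {y : M}
    (hF : MDifferentiableAt I' 𝓘(ℝ, G) F y) (hf : MDifferentiableAt I I' f x) (hy : f x = y)
    (v : TangentSpace I x) :
    mvfderiv I (fun z => F (f z)) x v =
      mvfderiv I' F y (show TangentSpace I' y from mfderiv I I' f x v) := by
  subst hy
  exact mvfderiv_comp_mfderiv hF hf v

theorem mvfderiv_fderiv_comp {F : G → G'} {f : N → G} {x : N}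
    (hF : DifferentiableAt ℝ F (f x)) (hf : MDifferentiableAt I 𝓘(ℝ, G) f x)
    (v : TangentSpace I x) :
    mvfderiv I (fun z => F (f z)) x v = fderiv ℝ F (f x) (mvfderiv I f x v) := by
  have := mvfderiv_comp_mfderiv hF.mdifferentiableAt hf v
  rw [this]
  exact congrArg (fun L : G →L[ℝ] G' => L (mvfderiv I f x v)) (mfderiv_eq_fderiv (f := F) (x := f x))

theorem mvfderiv_clm_apply {A : N → G →L[ℝ] G'} {f : N → G} {x : N}
    (hA : MDifferentiableAt I 𝓘(ℝ, G →L[ℝ] G') A x) (hf : MDifferentiableAt I 𝓘(ℝ, G) f x)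
    (v : TangentSpace I x) :
    mvfderiv I (fun z => A z (f z)) x v = mvfderiv I A x v (f x) + A x (mvfderiv I f x v) := by
  have h := mvfderiv_fderiv_comp (F := fun p : (G →L[ℝ] G') × G => p.1 p.2)
    (f := fun z => (A z, f z)) (x := x)
    (differentiableAt_fst.clm_apply differentiableAt_snd) (hA.prodMk_space hf) v
  rw [h, fderiv_clm_apply differentiableAt_fst differentiableAt_snd]
  have h1 := mvfderiv_fderiv_comp (F := (Prod.fst : (G →L[ℝ] G') × G → _)) (x := x)
    differentiableAt_fst (hA.prodMk_space hf) v
  have h2 := mvfderiv_fderiv_comp (F := (Prod.snd : (G →L[ℝ] G') × G → _)) (x := x)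
    differentiableAt_snd (hA.prodMk_space hf) v
  simp only [fderiv_fst, fderiv_snd, ContinuousLinearMap.coe_fst', ContinuousLinearMap.coe_snd']
    at h1 h2
  simp [fderiv_fst, fderiv_snd, add_comm, h1, h2]

end VectorValuedDerivative
-- The Lie bracket as a commutator of derivations
section LieBracketFunction

variable {E : Type*} [NormedAddCommGroup E] [NormedSpace ℝ E]
  {H : Type*} [TopologicalSpace H] {I : ModelWithCorners ℝ E H}
  {N : Type*} [TopologicalSpace N] [ChartedSpace H N]
  {G : Type*} [NormedAddCommGroup G] [NormedSpace ℝ G]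

/-- A vector field written in the preferred chart around `x`. -/
noncomputable def chartVectorField (I : ModelWithCorners ℝ E H) (x : N)
    (X : (y : N) → TangentSpace I y) : E → E :=
  mpullbackWithin 𝓘(ℝ, E) I (extChartAt I x).symm X (range I)

theorem differentiableAt_chartVectorField [CompleteSpace E] [I.Boundaryless] [IsManifold I 2 N]
    {x : N} {X : (y : N) → TangentSpace I y}
    (hX : MDifferentiableAt I I.tangent (fun y => (X y : TangentBundle I N)) x) :
    DifferentiableAt ℝ (chartVectorField I x X) (extChartAt I x x) := by
  have := MDifferentiableWithinAt.differentiableWithinAt_mpullbackWithin_vectorField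
    (mdifferentiableWithinAt_univ.2 hX)
  refine DifferentiableWithinAt.differentiableAt (𝕜 := ℝ) this ?_
  simp [I.range_eq_univ]

theorem chartVectorField_apply [IsManifold I 1 N] {x y : N} (hy : y ∈ (extChartAt I x).source)
    (X : (y : N) → TangentSpace I y) :
    chartVectorField I x X (extChartAt I x y) = mvfderiv I (extChartAt I x) y (X y) := by
  have hyy := (extChartAt I x).left_inv hy
  have h1 := mfderivWithin_extChartAt_symm_comp_mfderiv_extChartAt' (I := I) hy
  have h2 := mfderiv_extChartAt_comp_mfderivWithin_extChartAt_symm' (I := I) hy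
  rw [mvfderiv_apply_eq_mfderiv]
  simp only [chartVectorField, mpullbackWithin]
  rw [hyy, ContinuousLinearMap.inverse_eq h1 h2]

theorem mvfderiv_eq_fderiv_comp_chart [I.Boundaryless] [IsManifold I 1 N] {F : N → G} {x y : N}
    (hy : y ∈ (extChartAt I x).source)
    (hF : MDifferentiableAt I 𝓘(ℝ, G) F y) (v : TangentSpace I y) :
    mvfderiv I F y v =
      fderiv ℝ (F ∘ (extChartAt I x).symm) (extChartAt I x y)
        (mvfderiv I (extChartAt I x) y v) := by
  have hz := (extChartAt I x).map_source hy
  have hyy := (extChartAt I x).left_inv hy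
  have hs : MDifferentiableAt 𝓘(ℝ, E) I (extChartAt I x).symm (extChartAt I x y) := by
    have := mdifferentiableWithinAt_extChartAt_symm hz
    rwa [I.range_eq_univ, mdifferentiableWithinAt_univ] at this
  have hFs : MDifferentiableAt 𝓘(ℝ, E) 𝓘(ℝ, G) (F ∘ (extChartAt I x).symm) (extChartAt I x y) :=
    MDifferentiableAt.comp (I' := I) _ (by rwa [hyy]) hs
  have hφ : MDifferentiableAt I 𝓘(ℝ, E) (extChartAt I x) y :=
    mdifferentiableAt_extChartAt (by simpa using hy)
  have he : F =ᶠ[𝓝 y] fun z => (F ∘ (extChartAt I x).symm) (extChartAt I x z) := by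
    filter_upwards [(isOpen_extChartAt_source x).mem_nhds hy] with z hz
    simp only [Function.comp_apply, (extChartAt I x).left_inv hz]
  rw [he.mvfderiv_eq, mvfderiv_fderiv_comp hFs.differentiableAt hφ]

theorem contDiffAt_comp_chart_symm [I.Boundaryless] {m : WithTop ℕ∞} [IsManifold I m N]
    {F : N → G} {x : N} (hF : ContMDiffAt I 𝓘(ℝ, G) m F x) :
    ContDiffAt ℝ m (F ∘ (extChartAt I x).symm) (extChartAt I x x) := by
  rw [← contMDiffAt_iff_contDiffAt]
  refine ContMDiffAt.comp (I' := I) _ (by simpa using hF) ?_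
  have := contMDiffWithinAt_extChartAt_symm_range (I := I) (n := m) x (mem_extChartAt_target x)
  rwa [I.range_eq_univ, contMDiffWithinAt_univ] at this

variable [I.Boundaryless] [IsManifold I 2 N]

/-- The derivative `dF(X)` of a function along a vector field, near a point, in a chart. -/
theorem mvfderiv_apply_eventuallyEq_chart {F : N → G} {x : N}
    (hF : ContMDiffAt I 𝓘(ℝ, G) 2 F x) (X : (y : N) → TangentSpace I y) :
    (fun z => mvfderiv I F z (X z)) =ᶠ[𝓝 x] fun z =>
      (fun w => fderiv ℝ (F ∘ (extChartAt I x).symm) w (chartVectorField I x X w))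
        (extChartAt I x z) := by
  have : IsManifold I 1 N := .of_le (n := 2) one_le_two
  filter_upwards [(isOpen_extChartAt_source x).mem_nhds (mem_extChartAt_source (I := I) x),
    (contMDiffAt_iff_contMDiffAt_nhds (by simp)).1 hF] with z hz hFz
  rw [chartVectorField_apply hz]
  exact mvfderiv_eq_fderiv_comp_chart hz (hFz.mdifferentiableAt (by simp)) _

variable [CompleteSpace E]

theorem differentiableAt_fderiv_chartVectorField {F : N → G} {x : N}
    (hF : ContMDiffAt I 𝓘(ℝ, G) 2 F x) {X : (y : N) → TangentSpace I y}
    (hX : MDifferentiableAt I I.tangent (fun y => (X y : TangentBundle I N)) x) :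
    DifferentiableAt ℝ (fun w => fderiv ℝ (F ∘ (extChartAt I x).symm) w
      (chartVectorField I x X w)) (extChartAt I x x) :=
  (((contDiffAt_comp_chart_symm hF).fderiv_right (m := 1) (by norm_num)).differentiableAt
    (by simp)).clm_apply (differentiableAt_chartVectorField hX)

theorem mdifferentiableAt_mvfderiv_apply {F : N → G} {x : N}
    (hF : ContMDiffAt I 𝓘(ℝ, G) 2 F x) {X : (y : N) → TangentSpace I y}
    (hX : MDifferentiableAt I I.tangent (fun y => (X y : TangentBundle I N)) x) :
    MDifferentiableAt I 𝓘(ℝ, G) (fun z => mvfderiv I F z (X z)) x := by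
  have : IsManifold I 1 N := .of_le (n := 2) one_le_two
  refine MDifferentiableAt.congr_of_eventuallyEq ?_ (mvfderiv_apply_eventuallyEq_chart hF X)
  exact MDifferentiableAt.comp (I' := 𝓘(ℝ, E)) _
    (differentiableAt_fderiv_chartVectorField hF hX).mdifferentiableAt
    (mdifferentiableAt_extChartAt (mem_chart_source H x))

omit [IsManifold I 2 N] [CompleteSpace E] in
-- The bracket is defined by transport through the preferred chart, whose derivative at its own
-- centre is the identity of `E`, so no transport remains.
theorem mvfderiv_extChartAt_mlieBracket [IsManifold I 1 N] (x : N)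
    (X Y : (y : N) → TangentSpace I y) :
    mvfderiv I (extChartAt I x) x (mlieBracket I X Y x) =
      lieBracket ℝ (chartVectorField I x X) (chartVectorField I x Y) (extChartAt I x x) := by
  let Z : E := lieBracketWithin ℝ (chartVectorField I x X) (chartVectorField I x Y) (range I)
    (extChartAt I x x)
  have hid : (mfderiv I 𝓘(ℝ, E) (extChartAt I x) x : E →L[ℝ] E) = ContinuousLinearMap.id ℝ E :=
    mfderiv_extChartAt_self
  have h0 : mlieBracket I X Y x =
      (mfderiv I 𝓘(ℝ, E) (extChartAt I x) x : E →L[ℝ] E).inverse Z := by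
    simp only [mlieBracket, mlieBracketWithin_apply, preimage_univ, univ_inter]
    rfl
  rw [h0]
  refine (congrArg₂ (fun L L' : E →L[ℝ] E => L (L'.inverse Z)) hid hid).trans ?_
  rw [ContinuousLinearMap.inverse_id, ContinuousLinearMap.id_apply, ContinuousLinearMap.id_apply]
  change lieBracketWithin ℝ (chartVectorField I x X) (chartVectorField I x Y) (range I) _ = _
  rw [I.range_eq_univ, lieBracketWithin_univ]

/-- The Lie bracket of vector fields is the commutator of the derivations they define. -/
theorem mvfderiv_apply_mlieBracket {F : N → G} {x : N}
    (hF : ContMDiffAt I 𝓘(ℝ, G) 2 F x) {X Y : (y : N) → TangentSpace I y}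
    (hX : MDifferentiableAt I I.tangent (fun y => (X y : TangentBundle I N)) x)
    (hY : MDifferentiableAt I I.tangent (fun y => (Y y : TangentBundle I N)) x) :
    mvfderiv I F x (mlieBracket I X Y x) =
      mvfderiv I (fun z => mvfderiv I F z (Y z)) x (X x) -
      mvfderiv I (fun z => mvfderiv I F z (X z)) x (Y x) := by
  have : IsManifold I 1 N := .of_le (n := 2) one_le_two
  have hx := mem_extChartAt_source (I := I) x
  have hφ : MDifferentiableAt I 𝓘(ℝ, E) (extChartAt I x) x :=
    mdifferentiableAt_extChartAt (mem_chart_source H x)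
  have key : ∀ {X Y : (y : N) → TangentSpace I y},
      MDifferentiableAt I I.tangent (fun y => (Y y : TangentBundle I N)) x →
      mvfderiv I (fun z => mvfderiv I F z (Y z)) x (X x) =
        fderiv ℝ (fderiv ℝ (F ∘ (extChartAt I x).symm)) (extChartAt I x x)
          (chartVectorField I x X (extChartAt I x x)) (chartVectorField I x Y (extChartAt I x x)) +
        fderiv ℝ (F ∘ (extChartAt I x).symm) (extChartAt I x x)
          (fderiv ℝ (chartVectorField I x Y) (extChartAt I x x)
            (chartVectorField I x X (extChartAt I x x))) := by
    intro X Y hY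
    rw [(mvfderiv_apply_eventuallyEq_chart hF Y).mvfderiv_eq,
      mvfderiv_fderiv_comp (differentiableAt_fderiv_chartVectorField hF hY) hφ,
      fderiv_clm_apply (((contDiffAt_comp_chart_symm hF).fderiv_right (m := 1)
      (by norm_num)).differentiableAt (by simp)) (differentiableAt_chartVectorField hY),
      chartVectorField_apply hx X]
    simp [add_comm]
  rw [key hY, key hX, mvfderiv_eq_fderiv_comp_chart hx (hF.mdifferentiableAt (by simp)),
    mvfderiv_extChartAt_mlieBracket, lieBracket_eq]
  -- The second-derivative terms of the two iterated derivatives cancel by symmetry; what is left is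
  -- the bracket in the chart.
  have hsymm : IsSymmSndFDerivAt ℝ (F ∘ (extChartAt I x).symm) (extChartAt I x x) :=
    (contDiffAt_comp_chart_symm hF).isSymmSndFDerivAt (by simp)
  rw [hsymm.eq]
  simp only [map_sub]
  abel

end LieBracketFunction

/-! ### Exterior derivatives of one-forms along a map -/

section OneForms

variable {E : Type*} [NormedAddCommGroup E] [NormedSpace ℝ E]
  {H : Type*} [TopologicalSpace H] {I : ModelWithCorners ℝ E H} [I.Boundaryless]
  {N : Type*} [TopologicalSpace N] [ChartedSpace H N]
  {W : Type*} [NormedAddCommGroup W] [NormedSpace ℝ W]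
  {M : Type*} [TopologicalSpace M] [ChartedSpace W M]

theorem oneForm_apply_eq_chartOneForm [IsManifold 𝓘(ℝ, W) 1 M]
    (η : (y : M) → (TangentSpace 𝓘(ℝ, W) y →L[ℝ] ℝ))
    {x y : M} (hy : y ∈ (extChartAt 𝓘(ℝ, W) x).source) (v : TangentSpace 𝓘(ℝ, W) y) :
    η y v = chartOneForm W x η (extChartAt 𝓘(ℝ, W) x y)
      (mvfderiv 𝓘(ℝ, W) (extChartAt 𝓘(ℝ, W) x) y v) := by
  have h1 := mfderivWithin_extChartAt_symm_comp_mfderiv_extChartAt' (I := 𝓘(ℝ, W)) hy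
  rw [ModelWithCorners.range_eq_univ, mfderivWithin_univ] at h1
  have hyy := (extChartAt 𝓘(ℝ, W) x).left_inv hy
  have h2 := congrArg (fun L => L v) h1
  change (mfderiv 𝓘(ℝ, W) 𝓘(ℝ, W) (extChartAt 𝓘(ℝ, W) x).symm (extChartAt 𝓘(ℝ, W) x y))
    (mvfderiv 𝓘(ℝ, W) (extChartAt 𝓘(ℝ, W) x) y v) = v at h2
  change η y v = η ((extChartAt 𝓘(ℝ, W) x).symm (extChartAt 𝓘(ℝ, W) x y))
    (mfderiv 𝓘(ℝ, W) 𝓘(ℝ, W) (extChartAt 𝓘(ℝ, W) x).symm (extChartAt 𝓘(ℝ, W) x y)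
    (mvfderiv 𝓘(ℝ, W) (extChartAt 𝓘(ℝ, W) x) y v))
  rw [h2]
  congr 1
  rw [hyy]

theorem interiorExtDeriv_apply (η : (y : M) → (TangentSpace 𝓘(ℝ, W) y →L[ℝ] ℝ)) (x : M)
    (v w : TangentSpace 𝓘(ℝ, W) x) :
    interiorExtDeriv W η x v w =
      fderiv ℝ (chartOneForm W x η) (extChartAt 𝓘(ℝ, W) x x)
        (mvfderiv 𝓘(ℝ, W) (extChartAt 𝓘(ℝ, W) x) x v)
        (mvfderiv 𝓘(ℝ, W) (extChartAt 𝓘(ℝ, W) x) x w) -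
      fderiv ℝ (chartOneForm W x η) (extChartAt 𝓘(ℝ, W) x x)
        (mvfderiv 𝓘(ℝ, W) (extChartAt 𝓘(ℝ, W) x) x w)
        (mvfderiv 𝓘(ℝ, W) (extChartAt 𝓘(ℝ, W) x) x v) := rfl

variable [IsManifold I 2 N] [IsManifold 𝓘(ℝ, W) 2 M]

omit [I.Boundaryless] in
theorem oneForm_mfderiv_eventuallyEq (η : (y : M) → (TangentSpace 𝓘(ℝ, W) y →L[ℝ] ℝ))
    {f : N → M} {x : N} (hf : ContMDiffAt I 𝓘(ℝ, W) 2 f x) (Y : (y : N) → TangentSpace I y) :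
    (fun z => η (f z) (mfderiv I 𝓘(ℝ, W) f z (Y z))) =ᶠ[𝓝 x] fun z =>
      (fun z => chartOneForm W (f x) η (extChartAt 𝓘(ℝ, W) (f x) (f z))) z
        ((fun z => mvfderiv I (fun z => extChartAt 𝓘(ℝ, W) (f x) (f z)) z (Y z)) z) := by
  have : IsManifold 𝓘(ℝ, W) 1 M := .of_le (n := 2) one_le_two
  have : IsManifold I 1 N := .of_le (n := 2) one_le_two
  filter_upwards [hf.continuousAt.preimage_mem_nhds
    ((isOpen_extChartAt_source (f x)).mem_nhds (mem_extChartAt_source (I := 𝓘(ℝ, W)) (f x))),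
    (contMDiffAt_iff_contMDiffAt_nhds (by simp)).1 hf] with z hz hfz
  rw [oneForm_apply_eq_chartOneForm η hz]
  congr 1
  exact (mvfderiv_comp_mfderiv (mdifferentiableAt_extChartAt (by simpa using hz))
    (hfz.mdifferentiableAt (by simp)) _).symm

variable [CompleteSpace E]

/-- Cartan's formula for the exterior derivative of the pullback of a `1`-form by a map `f`. -/
theorem interiorExtDeriv_mfderiv_apply {η : (y : M) → (TangentSpace 𝓘(ℝ, W) y →L[ℝ] ℝ)}
    {f : N → M} {x : N} (hf : ContMDiffAt I 𝓘(ℝ, W) 2 f x)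
    (hη : DifferentiableAt ℝ (chartOneForm W (f x) η) (extChartAt 𝓘(ℝ, W) (f x) (f x)))
    {X Y : (y : N) → TangentSpace I y}
    (hX : MDifferentiableAt I I.tangent (fun y => (X y : TangentBundle I N)) x)
    (hY : MDifferentiableAt I I.tangent (fun y => (Y y : TangentBundle I N)) x) :
    interiorExtDeriv W η (f x) (mfderiv I 𝓘(ℝ, W) f x (X x)) (mfderiv I 𝓘(ℝ, W) f x (Y x)) =
      mvfderiv I (fun z => η (f z) (mfderiv I 𝓘(ℝ, W) f z (Y z))) x (X x) -
      mvfderiv I (fun z => η (f z) (mfderiv I 𝓘(ℝ, W) f z (X z))) x (Y x) -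
      η (f x) (mfderiv I 𝓘(ℝ, W) f x (mlieBracket I X Y x)) := by
  have : IsManifold 𝓘(ℝ, W) 1 M := .of_le (n := 2) one_le_two
  have hφf : ContMDiffAt I 𝓘(ℝ, W) 2 (fun z => extChartAt 𝓘(ℝ, W) (f x) (f z)) x :=
    (contMDiffAt_extChartAt (x := f x)).comp x hf
  have hφ : MDifferentiableAt 𝓘(ℝ, W) 𝓘(ℝ, W) (extChartAt 𝓘(ℝ, W) (f x)) (f x) :=
    mdifferentiableAt_extChartAt (mem_chart_source W _)
  have hc : ∀ v, mvfderiv 𝓘(ℝ, W) (extChartAt 𝓘(ℝ, W) (f x)) (f x) (mfderiv I 𝓘(ℝ, W) f x v) =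
      mvfderiv I (fun z => extChartAt 𝓘(ℝ, W) (f x) (f z)) x v := fun v =>
    (mvfderiv_comp_mfderiv hφ (hf.mdifferentiableAt (by simp)) v).symm
  have hη' : MDifferentiableAt I 𝓘(ℝ, W →L[ℝ] ℝ)
      (fun z => chartOneForm W (f x) η (extChartAt 𝓘(ℝ, W) (f x) (f z))) x :=
    MDifferentiableAt.comp (I' := 𝓘(ℝ, W)) x (g := chartOneForm W (f x) η)
      hη.mdifferentiableAt (hφf.mdifferentiableAt (by simp))
  -- By the product rule, differentiating `η (df Y)` along `X` gives a derivative of the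
  -- coefficients of `η`, which enters `dη`, and `η` of an iterated derivative of the chart; the
  -- latter terms combine into `η (df [X, Y])`.
  rw [(oneForm_mfderiv_eventuallyEq η hf X).mvfderiv_eq,
    (oneForm_mfderiv_eventuallyEq η hf Y).mvfderiv_eq,
    mvfderiv_clm_apply hη' (mdifferentiableAt_mvfderiv_apply hφf hX),
    mvfderiv_clm_apply hη' (mdifferentiableAt_mvfderiv_apply hφf hY),
    oneForm_apply_eq_chartOneForm η (mem_extChartAt_source (f x)), interiorExtDeriv_apply,
    hc, hc, hc, mvfderiv_apply_mlieBracket hφf hX hY,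
    mvfderiv_fderiv_comp (f := fun z => extChartAt 𝓘(ℝ, W) (f x) (f z)) hη
      (hφf.mdifferentiableAt (by simp)),
    mvfderiv_fderiv_comp (f := fun z => extChartAt 𝓘(ℝ, W) (f x) (f z)) hη
      (hφf.mdifferentiableAt (by simp)), map_sub]
  ring

end OneForms

end

section

open VectorField Set

/-- Lets a Lie group of class `∞` serve as one of class `minSmoothness ℝ 3`, the regularity behind
its Lie algebra structure. -/
instance leInfty_minSmoothness_three : ENat.LEInfty (minSmoothness ℝ 3) :=
  ⟨by simpa using (inferInstance : ENat.LEInfty 3).out⟩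

/-! ### Related vector fields and integral curves -/

section RelatedFields

variable {E : Type*} [NormedAddCommGroup E] [NormedSpace ℝ E]
  {H : Type*} [TopologicalSpace H] {I : ModelWithCorners ℝ E H} [I.Boundaryless]
  {N : Type*} [TopologicalSpace N] [ChartedSpace H N]
  {E' : Type*} [NormedAddCommGroup E'] [NormedSpace ℝ E']
  {H' : Type*} [TopologicalSpace H'] {I' : ModelWithCorners ℝ E' H'} [I'.Boundaryless]
  {M : Type*} [TopologicalSpace M] [ChartedSpace H' M]
  {G : Type*} [NormedAddCommGroup G] [NormedSpace ℝ G]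

omit [I.Boundaryless] in
theorem mvfderiv_extChartAt_self [IsManifold I 1 N] (x : N) (v : TangentSpace I x) :
    mvfderiv I (extChartAt I x) x v = v :=
  congrArg (fun L => L v) (mfderiv_extChartAt_self (I := I) (x := x))

/-- The bracket of vector fields is compatible with related vector fields. -/
theorem mfderiv_mlieBracket_of_related [CompleteSpace E] [CompleteSpace E']
    [IsManifold I 2 N] [IsManifold I' 2 M] {f : N → M} {x : N} (hf : ContMDiffAt I I' 2 f x)
    {X Y : (y : N) → TangentSpace I y} {X' Y' : (y : M) → TangentSpace I' y}
    (hX : MDifferentiableAt I I.tangent (fun y => (X y : TangentBundle I N)) x)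
    (hY : MDifferentiableAt I I.tangent (fun y => (Y y : TangentBundle I N)) x)
    (hX' : MDifferentiableAt I' I'.tangent (fun y => (X' y : TangentBundle I' M)) (f x))
    (hY' : MDifferentiableAt I' I'.tangent (fun y => (Y' y : TangentBundle I' M)) (f x))
    (hXX' : ∀ z, mfderiv I I' f z (X z) = X' (f z))
    (hYY' : ∀ z, mfderiv I I' f z (Y z) = Y' (f z)) :
    mfderiv I I' f x (mlieBracket I X Y x) = mlieBracket I' X' Y' (f x) := by
  have : IsManifold I 1 N := .of_le (n := 2) one_le_two
  have : IsManifold I' 1 M := .of_le (n := 2) one_le_two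
  have hφ : ContMDiffAt I' 𝓘(ℝ, E') 2 (extChartAt I' (f x)) (f x) := contMDiffAt_extChartAt
  have hφf : ContMDiffAt I 𝓘(ℝ, E') 2 (fun z => extChartAt I' (f x) (f z)) x := hφ.comp x hf
  have key : ∀ {Z : (y : N) → TangentSpace I y} {Z' : (y : M) → TangentSpace I' y},
      (∀ z, mfderiv I I' f z (Z z) = Z' (f z)) →
      (fun z => mvfderiv I (fun z => extChartAt I' (f x) (f z)) z (Z z)) =ᶠ[𝓝 x]
        fun z => (fun y => mvfderiv I' (extChartAt I' (f x)) y (Z' y)) (f z) := by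
    intro Z Z' hZ
    filter_upwards [hf.continuousAt.preimage_mem_nhds
      ((isOpen_extChartAt_source (f x)).mem_nhds (mem_extChartAt_source (I := I') (f x))),
      (contMDiffAt_iff_contMDiffAt_nhds (by simp)).1 hf] with z hz hfz
    rw [mvfderiv_comp_mfderiv (mdifferentiableAt_extChartAt (by simpa using hz))
      (hfz.mdifferentiableAt (by simp)), hZ]
  have hfx := hf.mdifferentiableAt (by simp)
  -- Both vectors are tested on the chart at `f x`, where each bracket acts as a commutator;
  -- relatedness moves the derivations from `N` to `M`.
  rw [← mvfderiv_extChartAt_self (f x) (mfderiv I I' f x _),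
    ← mvfderiv_extChartAt_self (f x) (mlieBracket I' X' Y' (f x)),
    ← mvfderiv_comp_mfderiv (hφ.mdifferentiableAt (by simp)) hfx,
    mvfderiv_apply_mlieBracket hφf hX hY, mvfderiv_apply_mlieBracket hφ hX' hY',
    (key hXX').mvfderiv_eq, (key hYY').mvfderiv_eq,
    mvfderiv_comp_mfderiv (mdifferentiableAt_mvfderiv_apply hφ hX') hfx,
    mvfderiv_comp_mfderiv (mdifferentiableAt_mvfderiv_apply hφ hY') hfx, hXX', hYY']

omit [I.Boundaryless] in
theorem IsMIntegralCurve.hasDerivAt_comp {X : (y : N) → TangentSpace I y} {γ : ℝ → N}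
    (hγ : IsMIntegralCurve γ X) {h : N → G} {s : ℝ} (hh : MDifferentiableAt I 𝓘(ℝ, G) h (γ s)) :
    HasDerivAt (fun r => h (γ r)) (mvfderiv I h (γ s) (X (γ s))) s := by
  have h1 : HasMFDerivAt 𝓘(ℝ, ℝ) 𝓘(ℝ, G) (fun r => h (γ r)) s _ :=
    hh.hasMFDerivAt.comp s (hγ s)
  have h2 : HasFDerivAt (fun r => h (γ r))
    ((1 : ℝ →L[ℝ] ℝ).smulRight (mvfderiv I h (γ s) (X (γ s)))) s := by
    refine h1.hasFDerivAt.congr_fderiv ?_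
    ext
    change mvfderiv I h (γ s) ((1 : ℝ) • (X (γ s))) = (1 : ℝ) • mvfderiv I h (γ s) (X (γ s))
    rw [map_smul]
  simpa using h2.hasDerivAt

end RelatedFields

/-! ### Left-invariant vector fields and their flows -/

section LieGroup

variable {E : Type*} [NormedAddCommGroup E] [NormedSpace ℝ E]
  {H : Type*} [TopologicalSpace H] {I : ModelWithCorners ℝ E H}
  {U : Type*} [TopologicalSpace U] [ChartedSpace H U] [Group U] [LieGroup I ∞ U]
  {G : Type*} [NormedAddCommGroup G] [NormedSpace ℝ G]

/-- The field is the tangent map of multiplication applied to the zero vector at `g` and to `v` at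
`1`. -/
theorem contMDiff_infty_mulInvariantVectorField (v : GroupLieAlgebra I U) :
    ContMDiff I I.tangent ∞ (fun g : U => (mulInvariantVectorField v g : TangentBundle I U)) := by
  let fg : U → TangentBundle I U := fun g ↦ Bundle.TotalSpace.mk' E g 0
  have sfg : ContMDiff I I.tangent ∞ fg := Bundle.contMDiff_zeroSection _ _
  let fv : U → TangentBundle I U := fun _ ↦ Bundle.TotalSpace.mk' E 1 v
  have sfv : ContMDiff I I.tangent ∞ fv := contMDiff_const
  let F₁ : U → (TangentBundle I U × TangentBundle I U) := fun g ↦ (fg g, fv g)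
  have S₁ : ContMDiff I (I.tangent.prod I.tangent) ∞ F₁ := sfg.prodMk sfv
  let F₂ : (TangentBundle I U × TangentBundle I U) → TangentBundle (I.prod I) (U × U) :=
    (equivTangentBundleProd I U I U).symm
  have S₂ : ContMDiff (I.tangent.prod I.tangent) (I.prod I).tangent ∞ F₂ :=
    contMDiff_equivTangentBundleProd_symm
  let F₃ : TangentBundle (I.prod I) (U × U) → TangentBundle I U :=
    tangentMap (I.prod I) I (fun (p : U × U) ↦ p.1 * p.2)
  have S₃ : ContMDiff (I.prod I).tangent I.tangent ∞ F₃ :=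
    ContMDiff.contMDiff_tangentMap (contMDiff_mul I ∞) (by simp)
  refine ((S₃.comp S₂).comp S₁).congr fun g => ?_
  have h1 : MDifferentiableAt I I (fun _ : U => g) 1 := mdifferentiableAt_const
  have h2 : MDifferentiableAt I I (id : U → U) 1 := mdifferentiableAt_id
  have h3 := mfderiv_comp_apply (I := I) (I' := I.prod I) (I'' := I) (1 : U)
    (g := fun p : U × U => p.1 * p.2)
    ((contMDiff_mul I ∞).mdifferentiableAt (by simp)) (h1.prodMk h2) v
  rw [mfderiv_prodMk h1 h2, mfderiv_const, mfderiv_id] at h3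
  have h4 : ∀ (z' : U) (w : E), z' = g →
      (Bundle.TotalSpace.mk' E g w : TangentBundle I U) = Bundle.TotalSpace.mk' E z' w := by
    rintro _ w rfl
    rfl
  exact (congrArg (fun w : E => (Bundle.TotalSpace.mk' E g w : TangentBundle I U)) h3).trans
    (h4 (g * 1) _ (mul_one g))

theorem mdifferentiableAt_mul_left' (g h : U) : MDifferentiableAt I I (g * ·) h :=
  (contMDiff_mul_left (n := ∞)).mdifferentiableAt (by simp)

theorem mfderiv_mul_left_mulInvariantVectorField (g h : U) (v : GroupLieAlgebra I U) :
    mfderiv I I (g * ·) h (mulInvariantVectorField v h) = mulInvariantVectorField v (g * h) := by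
  have h1 : (fun x : U => g * h * x) = (g * ·) ∘ (h * ·) := by ext x; simp [mul_assoc]
  have h2 := mfderiv_comp_apply_of_eq (I := I) (I' := I) (I'' := I) (x := (1 : U)) (y := h)
    (mdifferentiableAt_mul_left' g h) (mdifferentiableAt_mul_left' h 1) (mul_one h) v
  exact h2.symm.trans (congrArg (fun f : U → U => (mfderiv I I f 1 v : E)) h1.symm)

theorem IsMIntegralCurveOn.mul_left {v : GroupLieAlgebra I U} {γ : ℝ → U} {t : Set ℝ}
    (hγ : IsMIntegralCurveOn γ (mulInvariantVectorField v) t) (g : U) :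
    IsMIntegralCurveOn (fun s => g * γ s) (mulInvariantVectorField v) t := by
  intro s hs
  have h := (mdifferentiableAt_mul_left' (I := I) g (γ s)).hasMFDerivAt.comp_hasMFDerivWithinAt s
    (hγ s hs)
  refine h.congr_mfderiv (ContinuousLinearMap.ext fun (r : ℝ) => Eq.symm ?_)
  change r • mulInvariantVectorField v (g * γ s) =
    mfderiv I I (g * ·) (γ s) (r • mulInvariantVectorField v (γ s))
  rw [map_smul, mfderiv_mul_left_mulInvariantVectorField]

theorem IsMIntegralCurve.mul_left {v : GroupLieAlgebra I U} {γ : ℝ → U}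
    (hγ : IsMIntegralCurve γ (mulInvariantVectorField v)) (g : U) :
    IsMIntegralCurve (fun s => g * γ s) (mulInvariantVectorField v) :=
  isMIntegralCurve_iff_isMIntegralCurveOn.2 ((hγ.isMIntegralCurveOn univ).mul_left g)

/-- A local integral curve through `1` is carried to every other point by left translation, with the
same time of existence; a uniform time of existence makes the field complete. -/
theorem exists_isMIntegralCurve_mulInvariantVectorField [I.Boundaryless] [CompleteSpace E]
    [T2Space U] (v : GroupLieAlgebra I U) :
    ∃ γ : ℝ → U, γ 0 = 1 ∧ IsMIntegralCurve γ (mulInvariantVectorField v) := by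
  have hv := contMDiff_infty_mulInvariantVectorField v
  have hv1 : ContMDiff I I.tangent 1
    (fun g : U => (mulInvariantVectorField v g : TangentBundle I U)) := hv.of_le (by simp)
  obtain ⟨γ, h0, hγ⟩ := exists_isMIntegralCurveAt_of_contMDiffAt_boundaryless (t₀ := 0)
    (hv1.contMDiffAt (x := 1))
  obtain ⟨ε, hε, hγ⟩ := isMIntegralCurveAt_iff'.1 hγ
  refine exists_isMIntegralCurve_of_isMIntegralCurveOn hv1 hε (fun g => ⟨fun s => g * γ s, ?_, ?_⟩) 1
  · simp [h0]
  · rw [Real.ball_eq_Ioo, zero_sub, zero_add] at hγ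
    exact hγ.mul_left g

section Derivative

variable [I.Boundaryless] [CompleteSpace E]

omit [I.Boundaryless] in
theorem mlieBracket_mulInvariantVectorField (v w : GroupLieAlgebra I U) (g : U) :
    mlieBracket I (mulInvariantVectorField v) (mulInvariantVectorField w) g =
      mulInvariantVectorField ⁅v, w⁆ g :=
  (congrFun (mulInvariantVector_mlieBracket v w) g).symm

/-- If `F` is invariant under the flow of the left-invariant field of `ξ`, the derivatives of `F`
along left-invariant fields are transported along an integral curve by the adjoint action. -/
theorem hasDerivAt_mvfderiv_mulInvariantVectorField {F : U → G} {ξ v : GroupLieAlgebra I U}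
    {γ : ℝ → U} (hγ : IsMIntegralCurve γ (mulInvariantVectorField ξ)) {s : ℝ}
    (hF : ContMDiffAt I 𝓘(ℝ, G) 2 F (γ s))
    (hξ : ∀ᶠ z in 𝓝 (γ s), mvfderiv I F z (mulInvariantVectorField ξ z) = 0) :
    HasDerivAt (fun r => mvfderiv I F (γ r) (mulInvariantVectorField v (γ r)))
      (mvfderiv I F (γ s) (mulInvariantVectorField ⁅ξ, v⁆ (γ s))) s := by
  have hv := mdifferentiableAt_mulInvariantVectorField v (g := γ s)
  have h := hγ.hasDerivAt_comp (mdifferentiableAt_mvfderiv_apply hF hv)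
  convert h using 1
  have h0 : (fun z => mvfderiv I F z (mulInvariantVectorField ξ z)) =ᶠ[𝓝 (γ s)] fun _ => 0 := hξ
  -- In `[ξ, v] F = ξ (v F) - v (ξ F)` the last term drops out, since `ξ F` vanishes near the point.
  rw [← mlieBracket_mulInvariantVectorField, mvfderiv_apply_mlieBracket hF
    (mdifferentiableAt_mulInvariantVectorField ξ) hv, h0.mvfderiv_eq, mvfderiv_const]
  simp

end Derivative

end LieGroup

/-! ### The adjoint action and its derivative along one-parameter subgroups -/

section Adjoint

variable {E : Type*} [NormedAddCommGroup E] [NormedSpace ℝ E]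
  {H : Type*} [TopologicalSpace H] {I : ModelWithCorners ℝ E H}
  {U : Type*} [TopologicalSpace U] [ChartedSpace H U] [Group U] [LieGroup I ∞ U]

/-- The adjoint action of a Lie group, read in the preferred chart at the identity. -/
noncomputable def chartAd (I : ModelWithCorners ℝ E H) (g : U) : E →L[ℝ] E :=
  mvfderiv I (fun x : U => extChartAt I (1 : U) (g * x * g⁻¹)) 1

theorem contMDiff_conj (g : U) : ContMDiff I I ∞ (fun x : U => g * x * g⁻¹) :=
  (contMDiff_mul_right (a := g⁻¹)).comp (contMDiff_mul_left (a := g))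

theorem chartAd_one (v : E) : chartAd I (1 : U) v = v := by
  have h : (fun x : U => extChartAt I (1 : U) (1 * x * 1⁻¹)) = extChartAt I (1 : U) := by
    ext x; simp
  refine (congrArg (fun F : U → E => (mvfderiv I F 1 : E →L[ℝ] E) v) h).trans ?_
  exact mvfderiv_extChartAt_self (1 : U) v

theorem chartAd_mul [I.Boundaryless] (g h : U) (v : E) :
    chartAd I (g * h) v = chartAd I g (chartAd I h v) := by
  have hφ : MDifferentiableAt I 𝓘(ℝ, E) (extChartAt I (1 : U)) 1 :=
    mdifferentiableAt_extChartAt (mem_chart_source H 1)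
  have hc : ∀ g : U, MDifferentiableAt I 𝓘(ℝ, E)
      (fun x : U => extChartAt I (1 : U) (g * x * g⁻¹)) 1 := fun g =>
    MDifferentiableAt.comp (I' := I) 1 (by simpa using hφ)
      ((contMDiff_conj (I := I) g).mdifferentiableAt (by simp))
  have hs := mem_extChartAt_source (I := I) (1 : U)
  have key : (fun x : U => extChartAt I (1 : U) (g * h * x * (g * h)⁻¹)) =ᶠ[𝓝 1]
      fun x => ((fun x : U => extChartAt I (1 : U) (g * x * g⁻¹)) ∘ (extChartAt I (1 : U)).symm)
        (extChartAt I (1 : U) (h * x * h⁻¹)) := by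
    have hcont : ContinuousAt (fun x : U => h * x * h⁻¹) 1 :=
      (contMDiff_conj (I := I) h).continuous.continuousAt
    filter_upwards [hcont.preimage_mem_nhds
      ((isOpen_extChartAt_source (I := I) (1 : U)).mem_nhds (by simp))] with x hx
    simp only [Function.comp_apply, (extChartAt I (1 : U)).left_inv hx]
    group
  have hd : ∀ w : E, fderiv ℝ ((fun x : U => extChartAt I (1 : U) (g * x * g⁻¹)) ∘
      (extChartAt I (1 : U)).symm) (extChartAt I (1 : U) (h * 1 * h⁻¹)) w = chartAd I g w := by
    intro w
    have h1 := (mvfderiv_eq_fderiv_comp_chart hs (hc g) w).trans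
      (congrArg _ (mvfderiv_extChartAt_self (I := I) (1 : U) w))
    rw [show h * 1 * h⁻¹ = 1 by simp]
    exact h1.symm
  rw [← hd]
  refine (congrArg (fun L : E →L[ℝ] E => L v) key.mvfderiv_eq).trans
    (mvfderiv_fderiv_comp ?_ (hc h) v)
  · have : extChartAt I (1 : U) (h * 1 * h⁻¹) = extChartAt I (1 : U) 1 := by simp
    rw [this]
    refine (contDiffAt_comp_chart_symm (m := 1) (I := I) ?_).differentiableAt (by simp)
    refine ContMDiffAt.comp (I' := I) 1 ?_ ((contMDiff_conj (I := I) g).of_le (by simp)).contMDiffAt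
    simpa using contMDiffAt_extChartAt

/-- A pair of elements of the Lie algebra of `U`, as an element of the Lie algebra of `U × U`. -/
def groupLieAlgebraPair (v w : GroupLieAlgebra I U) : GroupLieAlgebra (I.prod I) (U × U) := (v, w)

theorem mulInvariantVectorField_pair (v w : GroupLieAlgebra I U) (g h : U) :
    mulInvariantVectorField (groupLieAlgebraPair v w) (g, h) =
      (mulInvariantVectorField v g, mulInvariantVectorField w h) := by
  have h1 := mfderiv_prodMap (I := I) (I' := I) (p := ((1 : U), (1 : U)))
    (mdifferentiableAt_mul_left' (I := I) g 1) (mdifferentiableAt_mul_left' (I := I) h 1)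
  exact congrArg (fun L => L (v, w)) h1

variable [I.Boundaryless] [CompleteSpace E]

/-- Each projection of `U × U` relates the invariant field of a pair to that of its component, and
brackets of related fields are related. -/
theorem bracket_groupLieAlgebraPair (v w v' w' : GroupLieAlgebra I U) :
    ⁅groupLieAlgebraPair v w, groupLieAlgebraPair v' w'⁆ =
      groupLieAlgebraPair ⁅v, v'⁆ ⁅w, w'⁆ := by
  have hl : ∀ a, MDifferentiableAt (I.prod I) (I.prod I).tangent
      (fun y => (mulInvariantVectorField (I := I.prod I) (G := U × U) a y :
        TangentBundle (I.prod I) (U × U))) 1 := fun a =>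
    mdifferentiableAt_mulInvariantVectorField a
  have hr : ∀ a, MDifferentiableAt I I.tangent
      (fun y => (mulInvariantVectorField (I := I) (G := U) a y : TangentBundle I U)) 1 :=
    fun a => mdifferentiableAt_mulInvariantVectorField a
  have h1 := mfderiv_mlieBracket_of_related (I := I.prod I) (I' := I) (f := (Prod.fst : U × U → U))
    (x := 1) contMDiffAt_fst (hl (groupLieAlgebraPair v w)) (hl (groupLieAlgebraPair v' w')) (hr v) (hr v')
    (fun z => by
      rw [mfderiv_fst]; exact congrArg Prod.fst (mulInvariantVectorField_pair v w z.1 z.2))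
    (fun z => by
      rw [mfderiv_fst]; exact congrArg Prod.fst (mulInvariantVectorField_pair v' w' z.1 z.2))
  have h2 := mfderiv_mlieBracket_of_related (I := I.prod I) (I' := I) (f := (Prod.snd : U × U → U))
    (x := 1) contMDiffAt_snd (hl (groupLieAlgebraPair v w)) (hl (groupLieAlgebraPair v' w')) (hr w) (hr w')
    (fun z => by
      rw [mfderiv_snd]; exact congrArg Prod.snd (mulInvariantVectorField_pair v w z.1 z.2))
    (fun z => by
      rw [mfderiv_snd]; exact congrArg Prod.snd (mulInvariantVectorField_pair v' w' z.1 z.2))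
  rw [mfderiv_fst] at h1
  rw [mfderiv_snd] at h2
  exact Prod.ext h1 h2

/-- The function `g h⁻¹` on `U × U`, read in the chart at `1`, is invariant under right translation
by the diagonal, so the left-invariant field of `(ξ, ξ)` kills it. Its derivative at `(γ r, γ r)`
along `(w, 0)` is `Ad (γ r) w`, and `[(ξ, ξ), (v, 0)] = ([ξ, v], 0)`. -/
theorem hasDerivAt_chartAd {ξ v : GroupLieAlgebra I U} {γ : ℝ → U}
    (hγ : IsMIntegralCurve γ (mulInvariantVectorField ξ)) (s : ℝ) :
    HasDerivAt (fun r => chartAd I (γ r) v) (chartAd I (γ s) (⁅ξ, v⁆ : GroupLieAlgebra I U)) s := by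
  let F : U × U → E := fun p => extChartAt I (1 : U) (p.1 * p.2⁻¹)
  have hm : ContMDiff (I.prod I) I ∞ (fun p : U × U => p.1 * p.2⁻¹) :=
    contMDiff_fst.mul contMDiff_snd.inv
  have hφ : ∀ g : U, ContMDiffAt I 𝓘(ℝ, E) 2 (extChartAt I (1 : U)) (g * g⁻¹) := fun g => by
    rw [mul_inv_cancel]
    exact contMDiffAt_extChartAt
  have hF : ∀ r, ContMDiffAt (I.prod I) 𝓘(ℝ, E) 2 F (γ r, γ r) := fun r =>
    ContMDiffAt.comp (I' := I) (γ r, γ r) (g := extChartAt I (1 : U))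
      (f := fun p : U × U => p.1 * p.2⁻¹) (hφ (γ r))
      (hm.of_le (ENat.LEInfty.out (m := 2))).contMDiffAt
  have hΓ : IsMIntegralCurve (fun r => (γ r, γ r))
      (mulInvariantVectorField (groupLieAlgebraPair ξ ξ)) := by
    intro r
    refine ((hγ r).prodMk (hγ r)).congr_mfderiv (ContinuousLinearMap.ext fun (t : ℝ) => Eq.symm ?_)
    change t • mulInvariantVectorField (groupLieAlgebraPair ξ ξ) (γ r, γ r) =
      (t • mulInvariantVectorField ξ (γ r), t • mulInvariantVectorField ξ (γ r))
    rw [mulInvariantVectorField_pair]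
    rfl
  have hAd : ∀ r w, mvfderiv (I.prod I) F (γ r, γ r)
      (mulInvariantVectorField (groupLieAlgebraPair w 0) (γ r, γ r)) =
        chartAd I (γ r) w := by
    intro r w
    have h0 : mulInvariantVectorField (0 : GroupLieAlgebra I U) (γ r) = 0 := map_zero _
    have h1 := mdifferentiableAt_mul_left' (I := I) (γ r) 1
    have h2 : MDifferentiableAt I I (fun _ : U => γ r) 1 := mdifferentiableAt_const
    have h3 := mvfderiv_comp_mfderiv_of_eq ((hF r).mdifferentiableAt (by simp)) (h1.prodMk h2)
      (by simp : (γ r * 1, γ r) = (γ r, γ r)) w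
    rw [mfderiv_prodMk h1 h2, mfderiv_const] at h3
    rw [mulInvariantVectorField_pair, h0]
    exact h3.symm
  have hξ : ∀ᶠ z in 𝓝 (γ s, γ s), mvfderiv (I.prod I) F z
      (mulInvariantVectorField (groupLieAlgebraPair ξ ξ) z) = 0 := by
    filter_upwards [(contMDiffAt_iff_contMDiffAt_nhds (by simp)).1 (hF s)] with z hz
    have h1 := mdifferentiableAt_mul_left' (I := I) z.1 1
    have h2 := mdifferentiableAt_mul_left' (I := I) z.2 1
    have h3 := mvfderiv_comp_mfderiv_of_eq (hz.mdifferentiableAt (by simp)) (h1.prodMk h2)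
      (by simp : (z.1 * 1, z.2 * 1) = z) ξ
    rw [mfderiv_prodMk h1 h2] at h3
    have h4 : (fun x : U => F (z.1 * x, z.2 * x)) = fun _ => extChartAt I (1 : U) (z.1 * z.2⁻¹) := by
      ext x
      simp only [F]
      group
    rw [h4, mvfderiv_const] at h3
    exact (congrArg (mvfderiv (I.prod I) F z)
      (mulInvariantVectorField_pair ξ ξ z.1 z.2)).trans h3.symm
  have h := hasDerivAt_mvfderiv_mulInvariantVectorField (v := groupLieAlgebraPair v 0) hΓ (hF s) hξ
  rw [bracket_groupLieAlgebraPair, lie_zero] at h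
  simp only [hAd] at h
  exact h

end Adjoint

end

/-! ### Root components and the compact real form -/

section WeylBasisAlgebra

open LieAlgebra LieAlgebra.IsKilling LieModule

variable {𝔤 : Type*} [LieRing 𝔤] [LieAlgebra ℂ 𝔤] [FiniteDimensional ℂ 𝔤]
  [LieAlgebra.IsSemisimple ℂ 𝔤] {𝔥 : LieSubalgebra ℂ 𝔤} [𝔥.IsCartanSubalgebra]

theorem negRoot_negRoot (α : 𝔥.root) : negRoot (negRoot α) = α :=
  Subtype.ext (neg_neg α.1)

theorem negRoot_injective : Function.Injective (negRoot : 𝔥.root → 𝔥.root) :=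
  fun α β h => by rw [← negRoot_negRoot α, h, negRoot_negRoot]

theorem height_negRoot (Δ : (rootSystem 𝔥).Base) (α : 𝔥.root) :
    Δ.height (negRoot α) = -Δ.height α := by
  have h : negRoot α = (rootSystem 𝔥).reflectionPerm α α := by
    apply (rootSystem 𝔥).root.injective
    rw [RootPairing.root_reflectionPerm, RootPairing.reflection_apply_self]
    rfl
  rw [h]
  exact Δ.height_reflectionPerm_self α

theorem isPos_negRoot_iff (Δ : (rootSystem 𝔥).Base) (α : 𝔥.root) :
    Δ.IsPos (negRoot α) ↔ ¬ Δ.IsPos α := by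
  rw [RootPairing.Base.isPos_iff, RootPairing.Base.isPos_iff, height_negRoot]
  have := Δ.height_ne_zero α
  omega

theorem height_eq_add (Δ : (rootSystem 𝔥).Base) {α β γ : 𝔥.root}
    (h : ∀ H : 𝔥, γ.1 H = α.1 H + β.1 H) : Δ.height γ = Δ.height α + Δ.height β := by
  apply Δ.height_add
  ext H
  exact h H

theorem mem_rootSpace_zero {h : 𝔤} (hh : h ∈ 𝔥) : h ∈ rootSpace 𝔥 (0 : 𝔥 → ℂ) := by
  have := LieAlgebra.le_zeroRootSubalgebra ℂ 𝔤 𝔥 hh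
  exact this

namespace WeylBasis

variable (B : WeylBasis 𝔥)

theorem killing_X_cartan (α : 𝔥.root) {h : 𝔤} (hh : h ∈ 𝔥) : killingForm ℂ 𝔤 (B.X α) h = 0 := by
  refine killingForm_apply_eq_zero_of_mem_rootSpace_of_add_ne_zero ℂ 𝔤 𝔥 (B.mem_rootSpace α)
    (mem_rootSpace_zero hh) ?_
  rw [add_zero]
  exact LieSubalgebra.isNonZero_coe_root α

theorem killing_X_rootSpace {α β : 𝔥.root} (h : β ≠ negRoot α) {x : 𝔤}
    (hx : x ∈ rootSpace 𝔥 (β : Weight ℂ 𝔥 𝔤)) : killingForm ℂ 𝔤 (B.X α) x = 0 := by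
  refine killingForm_apply_eq_zero_of_mem_rootSpace_of_add_ne_zero ℂ 𝔤 𝔥 (B.mem_rootSpace α) hx ?_
  intro h0
  apply h
  apply Subtype.ext
  apply DFunLike.coe_injective
  exact (neg_eq_of_add_eq_zero_right h0).symm

open Classical in
theorem killing_X_X (α β : 𝔥.root) :
    killingForm ℂ 𝔤 (B.X α) (B.X β) = if β = negRoot α then 1 else 0 := by
  split_ifs with h
  · rw [h, B.killing_eq_one]
  · exact B.killing_X_rootSpace h (B.mem_rootSpace β)

theorem X_ne_zero (α : 𝔥.root) : B.X α ≠ 0 := by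
  intro h
  have := B.killing_eq_one α
  simp [h] at this

theorem lie_cartan_X {h : 𝔤} (hh : h ∈ 𝔥) (α : 𝔥.root) : ⁅h, B.X α⁆ = α.1 ⟨h, hh⟩ • B.X α :=
  lie_eq_smul_of_mem_rootSpace (B.mem_rootSpace α) ⟨h, hh⟩

theorem lie_cartan_cartan (_B : WeylBasis 𝔥) {h h' : 𝔤} (hh : h ∈ 𝔥) (hh' : h' ∈ 𝔥) :
    ⁅h, h'⁆ = 0 := by
  have := trivial_lie_zero 𝔥 𝔥 ⟨h, hh⟩ ⟨h', hh'⟩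
  exact congrArg Subtype.val this

/-- Every element is a sum of its component in the Cartan subalgebra and its root components. -/
theorem sub_sum_mem_cartan (z : 𝔤) :
    z - ∑ α : 𝔥.root, killingForm ℂ 𝔤 (B.X (negRoot α)) z • B.X α ∈ 𝔥 := by
  have htop := iSup_genWeightSpace_eq_top' ℂ 𝔥 𝔤
  have hz : z ∈ (⨆ χ : Weight ℂ 𝔥 𝔤, (genWeightSpace 𝔤 χ).toSubmodule) := by
    rw [← LieSubmodule.iSup_toSubmodule, htop]
    trivial
  induction hz using Submodule.iSup_induction' with
  | mem χ x hx =>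
    by_cases hχ : χ.IsZero
    · have hx' : x ∈ 𝔥 := by
        have : x ∈ rootSpace 𝔥 (0 : 𝔥 → ℂ) := by rw [← hχ.eq]; exact hx
        exact (zeroRootSubalgebra_eq_of_is_cartan ℂ 𝔤 𝔥).le this
      rw [Finset.sum_eq_zero]
      · simpa
      · intro α _
        rw [B.killing_X_cartan _ hx', zero_smul]
    · let β : 𝔥.root := ⟨χ, by simpa using hχ⟩
      obtain ⟨c, hc⟩ : ∃ c : ℂ, c • B.X β = x := by
        obtain ⟨c, hc⟩ := (finrank_eq_one_iff_of_nonzero'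
          (⟨B.X β, B.mem_rootSpace β⟩ : rootSpace 𝔥 (β : Weight ℂ 𝔥 𝔤))
          (fun h => B.X_ne_zero β (congrArg Subtype.val h))).1
          (finrank_rootSpace_eq_one β.1 (by simpa using hχ)) ⟨x, hx⟩
        exact ⟨c, congrArg Subtype.val hc⟩
      rw [Finset.sum_eq_single β]
      · rw [← hc]
        simp [B.killing_X_X, negRoot_negRoot]
      · intro α _ hα
        rw [B.killing_X_rootSpace (β := β) (by rw [negRoot_negRoot]; exact hα.symm) hx, zero_smul]
      · simp
  | zero => simp
  | add x y _ _ hx hy =>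
    simp only [map_add, add_smul, Finset.sum_add_distrib]
    rw [add_sub_add_comm]
    exact add_mem hx hy


theorem mem_cartan_of_killing_eq_zero {z : 𝔤} (h : ∀ α : 𝔥.root, killingForm ℂ 𝔤 (B.X α) z = 0) : z ∈ 𝔥 := by
  have := B.sub_sum_mem_cartan z
  rwa [Finset.sum_eq_zero (fun α _ => by rw [h, zero_smul]), sub_zero] at this

variable {Δ : (rootSystem 𝔥).Base}

theorem killing_X_negRoot_negRoot (α β : 𝔥.root) :
    killingForm ℂ 𝔤 (B.X (negRoot α)) (B.X (negRoot β)) =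
      killingForm ℂ 𝔤 (B.X α) (B.X β) := by
  by_cases h : β = negRoot α
  · rw [h, B.killing_eq_one, B.killing_eq_one]
  · rw [B.killing_X_rootSpace h (B.mem_rootSpace β),
      B.killing_X_rootSpace (fun hc => h (negRoot_injective hc)) (B.mem_rootSpace _)]

theorem conj_killing_X_X (α β : 𝔥.root) :
    (starRingEnd ℂ) (killingForm ℂ 𝔤 (B.X α) (B.X β)) = killingForm ℂ 𝔤 (B.X α) (B.X β) := by
  rw [killing_X_X]
  split_ifs <;> simp

/-- Reality condition of the compact form, checked on its real generators. It shows that the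
components at positive roots determine those at negative roots. -/
theorem killing_X_negRoot (α : 𝔥.root) {u : 𝔤} (hu : u ∈ B.compactRealForm Δ) :
    killingForm ℂ 𝔤 (B.X (negRoot α)) u = -(starRingEnd ℂ) (killingForm ℂ 𝔤 (B.X α) u) := by
  induction hu using Submodule.span_induction with
  | mem x hx =>
    rcases hx with ⟨β, rfl⟩ | ⟨β, -, rfl | rfl⟩
    · have h : Complex.I • rootDualVector β ∈ 𝔥 := 𝔥.smul_mem _ (SetLike.coe_mem _)
      rw [B.killing_X_cartan _ h, B.killing_X_cartan _ h]
      simp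
    · rw [A, map_sub, map_sub, killing_X_negRoot_negRoot, ← killing_X_negRoot_negRoot _ _ β,
        negRoot_negRoot, map_sub, conj_killing_X_X, conj_killing_X_X]
      ring
    · rw [S, map_smul, map_smul, map_add, map_add, killing_X_negRoot_negRoot,
        ← killing_X_negRoot_negRoot _ _ β, negRoot_negRoot, smul_eq_mul, smul_eq_mul, map_mul,
        map_add, conj_killing_X_X, conj_killing_X_X, Complex.conj_I]
      ring
  | zero => simp
  | add x y _ _ hx hy => rw [map_add, map_add, hx, hy, map_add]; ring
  | smul c x _ hx =>
    have h : ∀ y : 𝔤, killingForm ℂ 𝔤 y (c • x) = (c : ℂ) * killingForm ℂ 𝔤 y x := fun y => by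
      rw [← Complex.coe_smul, map_smul, smul_eq_mul]
    rw [h, h, hx, map_mul, Complex.conj_ofReal, mul_neg]

/-- The coordinates `⟨X_α, u⟩`, `α` positive, on the compact real form. -/
noncomputable def rootCoordinates (B : WeylBasis 𝔥) (Δ : (rootSystem 𝔥).Base) :
    B.compactRealForm Δ →ₗ[ℝ] ({α : 𝔥.root // Δ.IsPos α} → ℂ) :=
  LinearMap.pi fun α =>
    ((killingForm ℂ 𝔤 (B.X α.1)).restrictScalars ℝ) ∘ₗ (B.compactRealForm Δ).subtype

theorem rootCoordinates_apply (u : B.compactRealForm Δ) (α : {α : 𝔥.root // Δ.IsPos α}) :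
    B.rootCoordinates Δ u α = killingForm ℂ 𝔤 (B.X α.1) u := rfl

theorem killing_X_A {α β : 𝔥.root} (hα : Δ.IsPos α) (hβ : Δ.IsPos β) [Decidable (β = α)] :
    killingForm ℂ 𝔤 (B.X α) (B.A β) = if β = α then -1 else 0 := by
  have h : β ≠ negRoot α := by
    rintro rfl
    exact (isPos_negRoot_iff Δ α).1 hβ hα
  simp only [A, map_sub, killing_X_X, h, negRoot_injective.eq_iff, if_false]
  split_ifs <;> simp

theorem killing_X_S {α β : 𝔥.root} (hα : Δ.IsPos α) (hβ : Δ.IsPos β) [Decidable (β = α)] :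
    killingForm ℂ 𝔤 (B.X α) (B.S β) = if β = α then Complex.I else 0 := by
  have h : β ≠ negRoot α := by
    rintro rfl
    exact (isPos_negRoot_iff Δ α).1 hβ hα
  simp only [S, map_smul, map_add, killing_X_X, h, negRoot_injective.eq_iff, if_false]
  split_ifs <;> simp

theorem rootCoordinates_surjective : Function.Surjective (B.rootCoordinates Δ) := by
  classical
  intro w
  have hA : ∀ α : {α : 𝔥.root // Δ.IsPos α}, B.A α.1 ∈ B.compactRealForm Δ := fun α =>
    Submodule.subset_span (Or.inr ⟨α.1, α.2, Or.inl rfl⟩)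
  have hS : ∀ α : {α : 𝔥.root // Δ.IsPos α}, B.S α.1 ∈ B.compactRealForm Δ := fun α =>
    Submodule.subset_span (Or.inr ⟨α.1, α.2, Or.inr rfl⟩)
  -- The only nonzero coordinate of `A α` is `-1` and that of `S α` is `i`, both at `α`; hence the
  -- sign on the real part.
  refine ⟨∑ α, ((-(w α).re) • ⟨B.A α.1, hA α⟩ + (w α).im • ⟨B.S α.1, hS α⟩), ?_⟩
  ext β
  have h1 : ∀ α, B.rootCoordinates Δ ⟨B.A α.1, hA α⟩ β = if α = β then -1 else 0 := fun α => by
    rw [rootCoordinates_apply]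
    exact (B.killing_X_A β.2 α.2).trans (if_congr Subtype.ext_iff.symm rfl rfl)
  have h2 : ∀ α, B.rootCoordinates Δ ⟨B.S α.1, hS α⟩ β = if α = β then Complex.I else 0 :=
    fun α => by
    rw [rootCoordinates_apply]
    exact (B.killing_X_S β.2 α.2).trans (if_congr Subtype.ext_iff.symm rfl rfl)
  simp only [map_sum, map_add, map_smul, Finset.sum_apply, Pi.add_apply, Pi.smul_apply, h1, h2]
  rw [Finset.sum_eq_single β (fun b _ hb => by simp [hb]) (by simp)]
  apply Complex.ext <;> simp

theorem torusAlgebra_le_cartan {u : 𝔤} (hu : u ∈ B.compactRealForm Δ)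
    (h : ∀ α, Δ.IsPos α → killingForm ℂ 𝔤 (B.X α) u = 0) : u ∈ 𝔥 := by
  refine B.mem_cartan_of_killing_eq_zero fun α => ?_
  by_cases hα : Δ.IsPos α
  · exact h α hα
  · rw [← negRoot_negRoot α, B.killing_X_negRoot _ hu,
      h _ ((isPos_negRoot_iff Δ α).2 hα), map_zero, neg_zero]

theorem mem_torusAlgebra_of_mem_cartan {u : 𝔤} (hu : u ∈ B.compactRealForm Δ) (h : u ∈ 𝔥) :
    u ∈ B.torusAlgebra Δ :=
  ⟨Submodule.mem_sup_left h, hu⟩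

theorem killing_X_borel {α : 𝔥.root} (hα : Δ.IsPos α) {z : 𝔤} (hz : z ∈ borelSubalgebra Δ) :
    killingForm ℂ 𝔤 (B.X α) z = 0 := by
  have h : borelSubalgebra Δ ≤ LinearMap.ker (killingForm ℂ 𝔤 (B.X α)) := by
    refine sup_le (fun x hx => B.killing_X_cartan α hx) (iSup_le fun β x hx =>
      B.killing_X_rootSpace (β := β.1) ?_ hx)
    intro h
    have := β.2
    rw [h] at this
    exact (isPos_negRoot_iff Δ α).1 this hα
  exact h hz

/-- With surjectivity, this makes the coordinates a real isomorphism from `𝔲 / 𝔱`, the model tangent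
space of the flag manifold. -/
theorem rootCoordinates_eq_zero_iff (u : B.compactRealForm Δ) :
    B.rootCoordinates Δ u = 0 ↔ (u : 𝔤) ∈ B.torusAlgebra Δ := by
  constructor
  · intro h
    exact B.mem_torusAlgebra_of_mem_cartan u.2
      (B.torusAlgebra_le_cartan u.2 fun α hα => congrFun h ⟨α, hα⟩)
  · intro h
    ext α
    exact B.killing_X_borel α.2 h.1

theorem mem_cartan_of_mem_torusAlgebra {u : 𝔤} (hu : u ∈ B.torusAlgebra Δ) : u ∈ 𝔥 :=
  B.torusAlgebra_le_cartan hu.2 fun _ hα => B.killing_X_borel hα hu.1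

theorem lie_torusAlgebra {u v : 𝔤} (hu : u ∈ B.torusAlgebra Δ) (hv : v ∈ B.torusAlgebra Δ) :
    ⁅u, v⁆ = 0 :=
  B.lie_cartan_cartan (B.mem_cartan_of_mem_torusAlgebra hu) (B.mem_cartan_of_mem_torusAlgebra hv)

theorem killing_X_lie_cartan (α : 𝔥.root) {h : 𝔤} (hh : h ∈ 𝔥) (v : 𝔤) :
    killingForm ℂ 𝔤 (B.X α) ⁅h, v⁆ = -(α.1 ⟨h, hh⟩) * killingForm ℂ 𝔤 (B.X α) v := by
  have := LieModule.traceForm_apply_lie_apply ℂ 𝔤 𝔤 (B.X α) h v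
  rw [killingForm, ← this, ← lie_skew, B.lie_cartan_X hh]
  simp

/-- The torus algebra is its own centralizer in `𝔲`. Bracketing with `i H_α ∈ 𝔱` multiplies `⟨X_α,
v⟩` by `-i α(H_α)`, which is nonzero, so every root component of `v` vanishes. -/
theorem mem_torusAlgebra_of_lie_eq_zero {v : 𝔤} (hv : v ∈ B.compactRealForm Δ)
    (h : ∀ η ∈ B.torusAlgebra Δ, ⁅v, η⁆ = 0) : v ∈ B.torusAlgebra Δ := by
  refine B.mem_torusAlgebra_of_mem_cartan hv (B.mem_cartan_of_killing_eq_zero fun α => ?_)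
  have hmem : Complex.I • rootDualVector α ∈ 𝔥 := 𝔥.smul_mem _ (SetLike.coe_mem _)
  have h1 := h (Complex.I • rootDualVector α) (B.mem_torusAlgebra_of_mem_cartan
    (Submodule.subset_span (Or.inl ⟨α, rfl⟩)) hmem)
  have h2 := B.killing_X_lie_cartan α hmem v
  rw [← lie_skew, h1, neg_zero, map_zero, eq_comm, mul_eq_zero, neg_eq_zero] at h2
  refine h2.resolve_left ?_
  have h3 : (⟨Complex.I • rootDualVector α, hmem⟩ : 𝔥) = Complex.I •
    (cartanEquivDual 𝔥).symm (LieModule.Weight.toLinear ℂ 𝔥 𝔤 α.1) := rfl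
  rw [h3]
  have h4 := root_apply_cartanEquivDual_symm_ne_zero (α := α.1)
    (by have := α.2; simpa only [LieSubalgebra.root, Finset.mem_filter, Finset.mem_univ, true_and] using this)
  have h5 : α.1 (Complex.I • (cartanEquivDual 𝔥).symm (LieModule.Weight.toLinear ℂ 𝔥 𝔤 α.1)) =
    Complex.I * α.1 ((cartanEquivDual 𝔥).symm (LieModule.Weight.toLinear ℂ 𝔥 𝔤 α.1)) :=
    map_smul (LieModule.Weight.toLinear ℂ 𝔥 𝔤 α.1) _ _
  rw [h5]
  exact mul_ne_zero Complex.I_ne_zero h4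

end WeylBasis

/-- Every finite type has subsets of all cardinalities that are upward closed for a given rank. -/
theorem Finset.exists_card_eq_upward_closed {ι : Type*} [Fintype ι] (f : ι → ℤ) {m : ℕ}
    (hm : m ≤ Fintype.card ι) :
    ∃ P : Finset ι, P.card = m ∧ ∀ α ∈ P, ∀ β, f α < f β → β ∈ P := by
  classical
  induction m with
  | zero => exact ⟨∅, by simp⟩
  | succ m ih =>
    obtain ⟨P, hP, hup⟩ := ih (by omega)
    have hne : (Pᶜ).Nonempty := by
      rw [← Finset.card_pos, Finset.card_compl]
      omega
    -- An element of largest rank in the complement can be added without losing upward closure.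
    obtain ⟨β, hβ, hmax⟩ := Finset.exists_max_image Pᶜ f hne
    rw [Finset.mem_compl] at hβ
    refine ⟨insert β P, by rw [Finset.card_insert_of_notMem hβ, hP], ?_⟩
    intro α hα γ hγ
    by_contra hc
    rw [Finset.mem_insert, not_or] at hc
    rcases Finset.mem_insert.1 hα with rfl | h
    · exact absurd (hmax γ (Finset.mem_compl.2 hc.2)) (not_le.2 hγ)
    · exact hc.2 (hup α h γ hγ)

/-! ### The subalgebra attached to a closed set of positive roots -/

namespace WeylBasis

variable (B : WeylBasis 𝔥) {Δ : (rootSystem 𝔥).Base}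

/-- The span of the Cartan subalgebra and of the root vectors of a set of roots. -/
def regularSubspace (P : Set 𝔥.root) : Submodule ℂ 𝔤 :=
  Submodule.span ℂ ((𝔥 : Set 𝔤) ∪ B.X '' P)

/-- Pairing with `X (-α)` reads off the coefficient of `X α`. -/
theorem mem_regularSubspace_iff {P : Set 𝔥.root} {z : 𝔤} :
    z ∈ B.regularSubspace P ↔ ∀ α ∉ P, killingForm ℂ 𝔤 (B.X (negRoot α)) z = 0 := by
  constructor
  · intro hz α hα
    have h : B.regularSubspace P ≤ LinearMap.ker (killingForm ℂ 𝔤 (B.X (negRoot α))) := by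
      refine Submodule.span_le.2 ?_
      rintro _ (h | ⟨β, hβ, rfl⟩)
      · exact B.killing_X_cartan _ h
      · refine B.killing_X_rootSpace (β := β) ?_ (B.mem_rootSpace β)
        rw [negRoot_negRoot]
        rintro rfl
        exact hα hβ
    exact h hz
  · intro h
    rw [← sub_add_cancel z (∑ α : 𝔥.root, killingForm ℂ 𝔤 (B.X (negRoot α)) z • B.X α)]
    refine add_mem (Submodule.subset_span (Or.inl (B.sub_sum_mem_cartan z)))
      (sum_mem fun α _ => ?_)
    by_cases hα : α ∈ P
    · exact Submodule.smul_mem _ _ (Submodule.subset_span (Or.inr ⟨α, hα, rfl⟩))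
    · rw [h α hα, zero_smul]
      exact zero_mem _

/-- Positivity excludes `β = -α`, the one case in which the bracket of root vectors is not given by
the Weyl basis relations; closure of `P` under sums handles the others. -/
theorem lie_mem_regularSubspace {P : Set 𝔥.root} (hpos : ∀ α ∈ P, Δ.IsPos α)
    (hadd : ∀ α ∈ P, ∀ β ∈ P, ∀ γ : 𝔥.root, (∀ H : 𝔥, γ.1 H = α.1 H + β.1 H) → γ ∈ P)
    {z w : 𝔤} (hz : z ∈ B.regularSubspace P) (hw : w ∈ B.regularSubspace P) :
    ⁅z, w⁆ ∈ B.regularSubspace P := by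
  have hX : ∀ α ∈ P, B.X α ∈ B.regularSubspace P := fun α hα =>
    Submodule.subset_span (Or.inr ⟨α, hα, rfl⟩)
  induction hz, hw using Submodule.span_induction₂ with
  | mem_mem x y hx hy =>
    rcases hx with hx | ⟨α, hα, rfl⟩ <;> rcases hy with hy | ⟨β, hβ, rfl⟩
    · rw [B.lie_cartan_cartan hx hy]
      exact zero_mem _
    · rw [B.lie_cartan_X hx]
      exact Submodule.smul_mem _ _ (hX β hβ)
    · rw [← lie_skew, B.lie_cartan_X hy]
      exact neg_mem (Submodule.smul_mem _ _ (hX α hα))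
    · by_cases h : ∃ γ : 𝔥.root, ∀ H : 𝔥, γ.1 H = α.1 H + β.1 H
      · obtain ⟨γ, hγ⟩ := h
        rw [B.lie_eq_smul α β γ hγ]
        exact Submodule.smul_mem _ _ (hX γ (hadd α hα β hβ γ hγ))
      · rw [B.lie_eq_zero α β ?_ h]
        · exact zero_mem _
        · rintro rfl
          exact (isPos_negRoot_iff Δ α).1 (hpos _ hβ) (hpos _ hα)
  | zero_left => simp
  | zero_right => simp
  | add_left x y z _ _ _ h1 h2 => rw [add_lie]; exact add_mem h1 h2
  | add_right x y z _ _ _ h1 h2 => rw [lie_add]; exact add_mem h1 h2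
  | smul_left r x y _ _ h => rw [smul_lie]; exact Submodule.smul_mem _ _ h
  | smul_right r x y _ _ h => rw [lie_smul]; exact Submodule.smul_mem _ _ h

end WeylBasis

end WeylBasisAlgebra

/-- The pair `(u, v)` of complex coordinate vectors, thought of as `u + i v`, belongs to the part of
the complexified tangent space spanned by the root directions in `P`. -/
def PairIn {ι : Type*} (P : Set ι) (u v : ι → ℂ) : Prop :=
  ∀ α, v α = Complex.I * u α ∧ (α ∉ P → u α = 0)

/-! ### The subalgebra in root coordinates -/

section WeylBasisAlgebra

open LieAlgebra LieAlgebra.IsKilling LieModule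

variable {𝔤 : Type*} [LieRing 𝔤] [LieAlgebra ℂ 𝔤] [FiniteDimensional ℂ 𝔤]
  [LieAlgebra.IsSemisimple ℂ 𝔤] {𝔥 : LieSubalgebra ℂ 𝔤} [𝔥.IsCartanSubalgebra]
  (B : WeylBasis 𝔥) {Δ : (rootSystem 𝔥).Base}

/-- Write `u_α = ⟨X_α, u⟩`. The coefficient of `u + i v` at `-α` is `u_α + i v_α`, zero exactly when
`v_α = i u_α`. The reality condition then makes the coefficient at `α` equal to `-2` times the
conjugate of `u_α`, so it vanishes exactly when `u_α` does. -/
theorem WeylBasis.pairIn_rootCoordinates_iff (P : Set {α : 𝔥.root // Δ.IsPos α})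
    (u v : B.compactRealForm Δ) :
    PairIn P (B.rootCoordinates Δ u) (B.rootCoordinates Δ v) ↔
      (u : 𝔤) + Complex.I • (v : 𝔤) ∈ B.regularSubspace (Subtype.val '' P) := by
  rw [B.mem_regularSubspace_iff]
  have key : ∀ α : 𝔥.root, killingForm ℂ 𝔤 (B.X α) ((u : 𝔤) + Complex.I • (v : 𝔤)) =
      killingForm ℂ 𝔤 (B.X α) u + Complex.I * killingForm ℂ 𝔤 (B.X α) v := fun α => by
    rw [map_add, map_smul, smul_eq_mul]
  constructor
  · intro h α hα
    rw [key]
    by_cases hp : Δ.IsPos α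
    · obtain ⟨h1, h2⟩ := h ⟨α, hp⟩
      rw [rootCoordinates_apply, rootCoordinates_apply] at h1
      rw [rootCoordinates_apply] at h2
      have h3 := h2 (fun hc => hα ⟨_, hc, rfl⟩)
      rw [h3, mul_zero] at h1
      dsimp only at h1 h3
      rw [B.killing_X_negRoot α u.2, B.killing_X_negRoot α v.2, h1, h3]
      simp
    · obtain ⟨h1, h2⟩ := h ⟨negRoot α, (isPos_negRoot_iff Δ α).2 hp⟩
      rw [rootCoordinates_apply, rootCoordinates_apply] at h1
      dsimp only at h1
      rw [h1, ← mul_assoc, Complex.I_mul_I]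
      ring
  · intro h α
    have h1 : killingForm ℂ 𝔤 (B.X α.1) v = Complex.I * killingForm ℂ 𝔤 (B.X α.1) u := by
      have h0 := h (negRoot α.1) (by
        rintro ⟨β, -, hβ⟩
        have := β.2
        rw [hβ] at this
        exact (isPos_negRoot_iff Δ _).1 this α.2)
      rw [negRoot_negRoot, key] at h0
      linear_combination -Complex.I * h0 +
        killingForm ℂ 𝔤 (B.X α.1) v * Complex.I_mul_I
    refine ⟨h1, fun hα => ?_⟩
    have h0 := h α.1 (by
      rintro ⟨β, hβ, h⟩
      rw [Subtype.ext h] at hβ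
      exact hα hβ)
    rw [key, B.killing_X_negRoot _ u.2, B.killing_X_negRoot _ v.2, h1, map_mul,
      Complex.conj_I] at h0
    have h2 : (starRingEnd ℂ) (killingForm ℂ 𝔤 (B.X α.1) u) = 0 := by
      linear_combination (-1 / 2 : ℂ) * h0 +
        (1 / 2) * (starRingEnd ℂ) (killingForm ℂ 𝔤 (B.X α.1) u) * Complex.I_mul_I
    rw [rootCoordinates_apply]
    simpa using h2

/-- A linear map `θ` from a real Lie algebra to `ℂ^ι` that behaves like the coordinates along the
positive root directions on a compact Lie algebra, with a set `P` of root directions. -/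
structure IsRootCoordinates {ι 𝔨 : Type*} [LieRing 𝔨] [LieAlgebra ℝ 𝔨] (θ : 𝔨 →ₗ[ℝ] (ι → ℂ))
    (P : Set ι) : Prop where
  surjective : Function.Surjective θ
  -- The kernel of `θ` stands for `𝔱`; this field and the next say that it is abelian and contains
  -- its centralizer.
  lie_eq_zero : ∀ ξ η, θ ξ = 0 → θ η = 0 → ⁅ξ, η⁆ = 0
  eq_zero_of_lie : ∀ v, (∀ η, θ η = 0 → ⁅v, η⁆ = 0) → θ v = 0
  exists_weight : ∀ ξ, θ ξ = 0 → ∃ a : ι → ℂ, ∀ v α, θ ⁅ξ, v⁆ α = a α * θ v α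
  lie_pairIn : ∀ u₁ u₂ v₁ v₂, PairIn P (θ u₁) (θ u₂) → PairIn P (θ v₁) (θ v₂) →
    PairIn P (θ (⁅u₁, v₁⁆ - ⁅u₂, v₂⁆)) (θ (⁅u₁, v₂⁆ + ⁅u₂, v₁⁆))

/-- Taking `P` upward closed for the height makes it closed under sums: a root that is a sum of two
positive roots is higher than both. Such sets exist in every cardinality, which is why every index
is attained. -/
theorem WeylBasis.exists_isRootCoordinates {𝔨 : Type*} [LieRing 𝔨] [LieAlgebra ℝ 𝔨]
    (φ : 𝔨 ≃ₗ[ℝ] B.compactRealForm Δ) (hφ : ∀ ξ η : 𝔨, (φ ⁅ξ, η⁆ : 𝔤) = ⁅(φ ξ : 𝔤), (φ η : 𝔤)⁆)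
    {m : ℕ} (hm : m ≤ Nat.card {α : 𝔥.root // Δ.IsPos α}) :
    ∃ P : Finset {α : 𝔥.root // Δ.IsPos α}, P.card = m ∧
      IsRootCoordinates (B.rootCoordinates Δ ∘ₗ φ.toLinearMap) (P : Set _) := by
  classical
  rw [Nat.card_eq_fintype_card] at hm
  obtain ⟨P, hP, hup⟩ := Finset.exists_card_eq_upward_closed
    (fun α : {α : 𝔥.root // Δ.IsPos α} => Δ.height α.1) hm
  have hker : ∀ ξ, (B.rootCoordinates Δ ∘ₗ φ.toLinearMap) ξ = 0 ↔ (φ ξ : 𝔤) ∈ B.torusAlgebra Δ :=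
    fun ξ => B.rootCoordinates_eq_zero_iff (φ ξ)
  have hinj : ∀ ξ, (φ ξ : 𝔤) = 0 → ξ = 0 := fun ξ h =>
    φ.map_eq_zero_iff.1 (Subtype.ext h)
  refine ⟨P, hP, B.rootCoordinates_surjective.comp φ.surjective, ?_, ?_, ?_, ?_⟩
  · intro ξ η hξ hη
    exact hinj _ ((hφ ξ η).trans (B.lie_torusAlgebra ((hker ξ).1 hξ) ((hker η).1 hη)))
  · intro v hv
    rw [hker]
    refine B.mem_torusAlgebra_of_lie_eq_zero (φ v).2 fun η hη => ?_
    obtain ⟨η', hη'⟩ := φ.surjective ⟨η, hη.2⟩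
    have h1 : (φ η' : 𝔤) = η := congrArg Subtype.val hη'
    have := hv η' ((hker _).2 (by rwa [h1]))
    rw [← h1, ← hφ, this]
    simp
  · intro ξ hξ
    have hξ' := B.mem_cartan_of_mem_torusAlgebra ((hker ξ).1 hξ)
    refine ⟨fun α => -(α.1.1 ⟨_, hξ'⟩), fun v α => ?_⟩
    have := B.killing_X_lie_cartan α.1 hξ' (φ v)
    rw [← hφ] at this
    exact this
  · intro u₁ u₂ v₁ v₂ hu hv
    have hu' := (B.pairIn_rootCoordinates_iff _ (φ u₁) (φ u₂)).1 hu
    have hv' := (B.pairIn_rootCoordinates_iff _ (φ v₁) (φ v₂)).1 hv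
    refine (B.pairIn_rootCoordinates_iff _ (φ _) (φ _)).2 ?_
    have h := B.lie_mem_regularSubspace (Δ := Δ) ?_ ?_ hu' hv'
    · convert h using 1
      simp only [map_sub, map_add, Submodule.coe_sub, Submodule.coe_add, hφ, add_lie, lie_add,
        smul_lie, lie_smul, smul_smul, smul_add, Complex.I_mul_I, neg_smul, one_smul]
      abel
    · rintro _ ⟨α, -, rfl⟩
      exact α.2
    · rintro _ ⟨α, hα, rfl⟩ _ ⟨β, hβ, rfl⟩ γ hγ
      have hh := height_eq_add Δ hγ
      have ha := (RootPairing.Base.isPos_iff (b := Δ)).1 α.2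
      have hb := (RootPairing.Base.isPos_iff (b := Δ)).1 β.2
      have hγp : Δ.IsPos γ := (RootPairing.Base.isPos_iff (b := Δ)).2 (by omega)
      exact ⟨⟨γ, hγp⟩, hup α hα ⟨γ, hγp⟩ (by dsimp only; omega), rfl⟩

end WeylBasisAlgebra

/-! ### Local sections of submersions -/

section Submersion

open Set

variable {E : Type*} [NormedAddCommGroup E] [NormedSpace ℝ E]
  {W : Type*} [NormedAddCommGroup W] [NormedSpace ℝ W]
  {N : Type*} [TopologicalSpace N] [ChartedSpace E N] [IsManifold 𝓘(ℝ, E) ∞ N]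
  {M : Type*} [TopologicalSpace M] [ChartedSpace W M] [IsManifold 𝓘(ℝ, W) ∞ M]

/-- A submersion has smooth local sections through every point. -/
theorem Manifold.IsSubmersionAt.exists_section {f : N → M} {x : N}
    (h : Manifold.IsSubmersionAt 𝓘(ℝ, E) 𝓘(ℝ, W) ∞ f x) :
    ∃ (σ : M → N) (V : Set M), IsOpen V ∧ f x ∈ V ∧ σ (f x) = x ∧
      ContMDiffOn 𝓘(ℝ, W) 𝓘(ℝ, E) ∞ σ V ∧ ∀ y ∈ V, f (σ y) = y := by
  -- In adapted charts the map is a product projection; the section freezes the second coordinate at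
  -- its value at `x`.
  let c := (h.equiv (h.domChart x)).2
  let j : M → E := fun y => h.equiv.symm (h.codChart y, c)
  have hw := h.writtenInCharts
  have hsrc := h.source_subset_preimage_source
  have hxs := h.mem_domChart_source
  have hfx := h.mem_codChart_source
  have hfst : ∀ z ∈ h.domChart.target, h.codChart (f (h.domChart.symm z)) = (h.equiv z).1 := by
    intro z hz
    have := hw (x := z) (by simpa using hz)
    simpa using this
  have hjx : j (f x) = h.domChart x := by
    have h1 := hfst (h.domChart x) (h.domChart.map_source hxs)
    rw [h.domChart.left_inv hxs] at h1
    change h.equiv.symm (h.codChart (f x), c) = _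
    rw [h1]
    exact h.equiv.symm_apply_apply _
  have hcod : ContMDiffOn 𝓘(ℝ, W) 𝓘(ℝ, W) ∞ h.codChart h.codChart.source :=
    contMDiffOn_of_mem_maximalAtlas h.codChart_mem_maximalAtlas
  have hj : ContMDiffOn 𝓘(ℝ, W) 𝓘(ℝ, E) ∞ j h.codChart.source := by
    have h1 : ContDiff ℝ ∞ (fun w : W => h.equiv.symm (w, c)) :=
      h.equiv.symm.contDiff.comp (contDiff_id.prodMk contDiff_const)
    exact h1.contMDiff.comp_contMDiffOn hcod
  refine ⟨fun y => h.domChart.symm (j y), h.codChart.source ∩ j ⁻¹' h.domChart.target,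
    hj.continuousOn.isOpen_inter_preimage h.codChart.open_source h.domChart.open_target,
    ⟨hfx, ?_⟩, ?_, ?_, ?_⟩
  · rw [mem_preimage, hjx]
    exact h.domChart.map_source hxs
  · change h.domChart.symm (j (f x)) = x
    rw [hjx, h.domChart.left_inv hxs]
  · exact (contMDiffOn_symm_of_mem_maximalAtlas h.domChart_mem_maximalAtlas).comp
      (hj.mono inter_subset_left) fun y hy => hy.2
  · intro y hy
    have h1 := hfst (j y) hy.2
    have h2 : (h.equiv (j y)).1 = h.codChart y :=
      congrArg Prod.fst (h.equiv.apply_symm_apply (h.codChart y, c))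
    rw [h2] at h1
    exact h.codChart.injOn (hsrc (h.domChart.map_target hy.2)) hy.1 h1

theorem Manifold.IsSubmersionAt.mfderiv_surjective {f : N → M} {x : N}
    (h : Manifold.IsSubmersionAt 𝓘(ℝ, E) 𝓘(ℝ, W) ∞ f x) :
    Function.Surjective (mfderiv 𝓘(ℝ, E) 𝓘(ℝ, W) f x) := by
  obtain ⟨σ, V, hV, hx, hσx, hσ, hsec⟩ := h.exists_section
  intro w
  have h1 : (f ∘ σ) =ᶠ[𝓝 (f x)] id := by
    filter_upwards [hV.mem_nhds hx] with y hy using hsec y hy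
  have h2 := mfderiv_comp_apply_of_eq (I := 𝓘(ℝ, W)) (I' := 𝓘(ℝ, E)) (I'' := 𝓘(ℝ, W))
    (x := f x) (y := x) (h.contMDiffAt.mdifferentiableAt (by simp))
    ((hσ.contMDiffAt (hV.mem_nhds hx)).mdifferentiableAt (by simp)) hσx w
  refine ⟨mfderiv 𝓘(ℝ, W) 𝓘(ℝ, E) σ (f x) w, h2.symm.trans ?_⟩
  have h3 := h1.mfderiv_eq (I := 𝓘(ℝ, W)) (I' := 𝓘(ℝ, W))
  exact (congrArg (fun L : W →L[ℝ] W => L w) h3).trans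
    (congrArg (fun L : W →L[ℝ] W => L w) mfderiv_id)

end Submersion

/-! ### Subgroups generated by exponentials -/

section IntegralSubgroup

variable {E : Type*} [NormedAddCommGroup E] [NormedSpace ℝ E]
  {U : Type*} [TopologicalSpace U] [ChartedSpace E U] [Group U] [LieGroup 𝓘(ℝ, E) ∞ U]

theorem mulInvariantVectorField_one (v : GroupLieAlgebra 𝓘(ℝ, E) U) :
    mulInvariantVectorField v (1 : U) = v := by
  have h : ((1 : U) * ·) = (id : U → U) := by ext x; simp
  refine (congrArg (fun F : U → U => (mfderiv 𝓘(ℝ, E) 𝓘(ℝ, E) F 1 : E →L[ℝ] E) v) h).trans ?_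
  exact congrArg (fun L : E →L[ℝ] E => L v) mfderiv_id

/-- Only time-one values are generators, but `γ s` is the time-one value of the curve rescaled to
have velocity `s • ξ`. -/
theorem IsMIntegralCurve.mem_integralSubgroup {𝔰 : Set (GroupLieAlgebra 𝓘(ℝ, E) U)}
    (h𝔰 : ∀ ξ ∈ 𝔰, ∀ c : ℝ, c • ξ ∈ 𝔰) {ξ : GroupLieAlgebra 𝓘(ℝ, E) U} (hξ : ξ ∈ 𝔰)
    {γ : ℝ → U} (h0 : γ 0 = 1) (hγ : IsMIntegralCurve γ (mulInvariantVectorField ξ)) (s : ℝ) :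
    γ s ∈ integralSubgroup 𝔰 := by
  refine Subgroup.subset_closure ⟨s • ξ, h𝔰 ξ hξ s, γ ∘ (· * s), by simpa using h0, ?_, by simp⟩
  have h := hγ.comp_mul s
  have h1 : (s • mulInvariantVectorField ξ : (g : U) → TangentSpace 𝓘(ℝ, E) g) =
    mulInvariantVectorField (s • ξ) := by
    exact (mulInvariantVectorField_smul s ξ).symm
  rwa [h1] at h

/-- The elements fixed by the adjoint action of the generators of an integral subgroup are fixed by
the whole subgroup. -/
theorem chartAd_eq_self_of_mem_integralSubgroup [CompleteSpace E]
    {𝔰 : Set (GroupLieAlgebra 𝓘(ℝ, E) U)}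
    {η : GroupLieAlgebra 𝓘(ℝ, E) U} (hη : ∀ ξ ∈ 𝔰, ⁅ξ, η⁆ = 0) {t : U}
    (ht : t ∈ integralSubgroup 𝔰) : chartAd 𝓘(ℝ, E) t η = η := by
  induction ht using Subgroup.closure_induction with
  | mem t ht =>
    obtain ⟨ξ, hξ, γ, h0, hγ, rfl⟩ := ht
    have h : ∀ s, HasDerivAt (fun r => chartAd 𝓘(ℝ, E) (γ r) (η : E)) 0 s := fun s =>
      HasDerivAt.congr_deriv (F := E) (hasDerivAt_chartAd (v := η) hγ s) ((congrArg (fun w : E => chartAd 𝓘(ℝ, E) (γ s) w)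
        (hη ξ hξ)).trans (map_zero (chartAd 𝓘(ℝ, E) (γ s))))
    have h1 := is_const_of_deriv_eq_zero (fun s => (h s).differentiableAt)
      (fun s => (h s).deriv) 1 0
    refine h1.trans ?_
    rw [h0]
    exact chartAd_one (I := 𝓘(ℝ, E)) (U := U) (η : E)
  | one => exact chartAd_one (I := 𝓘(ℝ, E)) (U := U) (η : E)
  | mul x y _ _ hx hy =>
    exact (chartAd_mul (I := 𝓘(ℝ, E)) x y (η : E)).trans
      ((congrArg (fun w : E => chartAd 𝓘(ℝ, E) x w) hy).trans hx)
  | inv x _ hx =>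
    have h := chartAd_mul (I := 𝓘(ℝ, E)) x⁻¹ x (η : E)
    rw [inv_mul_cancel] at h
    exact (congrArg (fun w : E => chartAd 𝓘(ℝ, E) x⁻¹ w) hx).symm.trans
      (h.symm.trans (chartAd_one (I := 𝓘(ℝ, E)) (U := U) (η : E)))

end IntegralSubgroup

/-- The product rule for a family of linear maps that is differentiable pointwise. -/
theorem HasDerivAt.linearMap_apply {V W : Type*} [NormedAddCommGroup V] [NormedSpace ℝ V]
    [FiniteDimensional ℝ V] [NormedAddCommGroup W] [NormedSpace ℝ W] {A : ℝ → V →ₗ[ℝ] W}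
    {A' : V →ₗ[ℝ] W} {s : ℝ} (hA : ∀ x, HasDerivAt (fun r => A r x) (A' x) s)
    {x : ℝ → V} {x' : V} (hx : HasDerivAt x x' s) :
    HasDerivAt (fun r => A r (x r)) (A' (x s) + A s x') s := by
  let b := Module.finBasis ℝ V
  have hA' : ∀ (B : V →ₗ[ℝ] W) (y : V), B y = ∑ j, b.repr y j • B (b j) := fun B y => by
    conv_lhs => rw [← b.sum_repr y]
    rw [map_sum]
    simp only [map_smul]
  have h1 : HasDerivAt (fun r => ∑ j, b.repr (x r) j • A r (b j))
      (∑ j, (b.repr (x s) j • A' (b j) + b.repr x' j • A s (b j))) s := by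
    refine HasDerivAt.fun_sum fun j _ => ?_
    have h2 : HasDerivAt (fun r => b.repr (x r) j) (b.repr x' j) s :=
      (LinearMap.toContinuousLinearMap (b.coord j)).hasFDerivAt.comp_hasDerivAt s hx
    exact h2.smul (hA (b j))
  rw [Finset.sum_add_distrib, ← hA', ← hA'] at h1
  refine h1.congr_of_eventuallyEq (Filter.Eventually.of_forall fun r => ?_)
  exact hA' (A r) (x r)

/-! ### The projection to the homogeneous space -/

section Homogeneous

variable {E : Type*} [NormedAddCommGroup E] [NormedSpace ℝ E] [CompleteSpace E]
  {W : Type*} [NormedAddCommGroup W] [NormedSpace ℝ W]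
  {U : Type*} [TopologicalSpace U] [ChartedSpace E U] [Group U] [LieGroup 𝓘(ℝ, E) ∞ U]
  {T : Subgroup U} [ChartedSpace W (U ⧸ T)]

local notation "π" => (QuotientGroup.mk : U → U ⧸ T)

section Action

variable [IsManifold 𝓘(ℝ, W) ∞ (U ⧸ T)]
  (hπ : Manifold.IsSubmersion 𝓘(ℝ, E) 𝓘(ℝ, W) ∞ (QuotientGroup.mk : U → U ⧸ T))

include hπ

/-- Near any point, `y ↦ g • y` is `y ↦ π (g * σ y)` for a smooth local section `σ`. -/
theorem contMDiff_smul_quotient (g : U) :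
    ContMDiff 𝓘(ℝ, W) 𝓘(ℝ, W) ∞ (fun y : U ⧸ T => g • y) := by
  intro y
  obtain ⟨x, rfl⟩ := QuotientGroup.mk_surjective y
  obtain ⟨σ, V, hV, hx, hσx, hσ, hsec⟩ := (hπ.isSubmersionAt x).exists_section
  have h1 : ContMDiffAt 𝓘(ℝ, W) 𝓘(ℝ, W) ∞ (fun y : U ⧸ T => π (g * σ y)) (π x) :=
    hπ.contMDiff.contMDiffAt.comp (π x) ((contMDiff_mul_left (a := g)).contMDiffAt.comp (π x)
      (hσ.contMDiffAt (hV.mem_nhds hx)))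
  refine h1.congr_of_eventuallyEq ?_
  filter_upwards [hV.mem_nhds hx] with y hy
  change g • y = g • π (σ y)
  rw [hsec y hy]

theorem mfderiv_smul_mfderiv_mk (g h : U) (v : GroupLieAlgebra 𝓘(ℝ, E) U) :
    mfderiv 𝓘(ℝ, W) 𝓘(ℝ, W) (fun y : U ⧸ T => g • y) (π h)
      (mfderiv 𝓘(ℝ, E) 𝓘(ℝ, W) π h (mulInvariantVectorField v h)) =
    mfderiv 𝓘(ℝ, E) 𝓘(ℝ, W) π (g * h) (mulInvariantVectorField v (g * h)) := by
  have hd : ∀ x : U, MDifferentiableAt 𝓘(ℝ, E) 𝓘(ℝ, W) π x := fun x =>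
    hπ.contMDiff.mdifferentiableAt (by simp)
  have h1 := mfderiv_comp_apply (I := 𝓘(ℝ, E)) (I' := 𝓘(ℝ, W)) (I'' := 𝓘(ℝ, W)) h
    ((contMDiff_smul_quotient hπ g).mdifferentiableAt (x := π h) (by simp)) (hd h)
    (mulInvariantVectorField v h)
  have h2 := mfderiv_comp_apply (I := 𝓘(ℝ, E)) (I' := 𝓘(ℝ, E)) (I'' := 𝓘(ℝ, W)) h
    (hd (g * h)) (mdifferentiableAt_mul_left' g h) (mulInvariantVectorField v h)
  refine h1.symm.trans (h2.trans ?_)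
  rw [mfderiv_mul_left_mulInvariantVectorField]

theorem mfderiv_mk_eq_zero_of_mem {ξ : GroupLieAlgebra 𝓘(ℝ, E) U} {γ : ℝ → U} (h0 : γ 0 = 1)
    (hγ : IsMIntegralCurve γ (mulInvariantVectorField ξ)) (hT : ∀ s, γ s ∈ T) (g : U) :
    mfderiv 𝓘(ℝ, E) 𝓘(ℝ, W) π g (mulInvariantVectorField ξ g) = 0 := by
  have hd : ∀ x : U, MDifferentiableAt 𝓘(ℝ, E) 𝓘(ℝ, W) π x := fun x =>
    hπ.contMDiff.mdifferentiableAt (by simp)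
  have h1 := (hd (g * γ 0)).hasMFDerivAt.comp (0 : ℝ) (hγ.mul_left g 0)
  have h2 : (π ∘ fun s => g * γ s) = fun _ => π g := by
    ext s
    exact QuotientGroup.mk_mul_of_mem g (hT s)
  rw [h2] at h1
  have h3 := h1.mfderiv.symm.trans (mfderiv_const (I := 𝓘(ℝ, ℝ)) (I' := 𝓘(ℝ, W)) (c := π g)
    (x := (0 : ℝ)))
  have h4 := congrArg (fun L : ℝ →L[ℝ] W => L 1) h3
  have h5 : g = g * γ 0 := by rw [h0, mul_one]
  have h6 : mfderiv 𝓘(ℝ, E) 𝓘(ℝ, W) π (g * γ 0)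
      ((1 : ℝ) • mulInvariantVectorField ξ (g * γ 0)) = 0 := h4
  rw [one_smul] at h6
  rw [h0, mul_one] at h6
  exact h6

/-- By equivariance `dπ` kills the left-invariant field of `ξ` everywhere, so `π ∘ γ` has zero
derivative; it is locally constant in charts, hence constant on the line. -/
theorem mem_of_mfderiv_mk_eq_zero {ξ : GroupLieAlgebra 𝓘(ℝ, E) U} {γ : ℝ → U} (h0 : γ 0 = 1)
    (hγ : IsMIntegralCurve γ (mulInvariantVectorField ξ))
    (h : mfderiv 𝓘(ℝ, E) 𝓘(ℝ, W) π 1 ξ = 0) (s : ℝ) : γ s ∈ T := by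
  have hd : ∀ x : U, MDifferentiableAt 𝓘(ℝ, E) 𝓘(ℝ, W) π x := fun x =>
    hπ.contMDiff.mdifferentiableAt (by simp)
  have h1 : ∀ g : U, mfderiv 𝓘(ℝ, E) 𝓘(ℝ, W) π g (mulInvariantVectorField ξ g) = 0 := by
    intro g
    have h2 := mfderiv_smul_mfderiv_mk hπ g 1 ξ
    rw [mulInvariantVectorField_one, h, map_zero, mul_one] at h2
    exact h2.symm
  have h2 : ∀ s, HasMFDerivAt 𝓘(ℝ, ℝ) 𝓘(ℝ, W) (π ∘ γ) s 0 := by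
    intro s
    refine ((hd (γ s)).hasMFDerivAt.comp s (hγ s)).congr_mfderiv
      (ContinuousLinearMap.ext fun (r : ℝ) => ?_)
    change mfderiv 𝓘(ℝ, E) 𝓘(ℝ, W) π (γ s) (r • mulInvariantVectorField ξ (γ s)) = 0
    rw [map_smul, h1, smul_zero]
  have hloc : IsLocallyConstant (π ∘ γ) := by
    rw [IsLocallyConstant.iff_eventually_eq]
    intro s
    have hcont : Continuous (π ∘ γ) := continuous_iff_continuousAt.2 fun s => (h2 s).continuousAt
    have hopen : IsOpen ((π ∘ γ) ⁻¹' (chartAt W ((π ∘ γ) s)).source) :=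
      (chartAt W ((π ∘ γ) s)).open_source.preimage hcont
    obtain ⟨ε, hε, hball⟩ := Metric.isOpen_iff.1 hopen s (mem_chart_source W ((π ∘ γ) s))
    have hder : ∀ r ∈ Metric.ball s ε,
        HasFDerivAt (fun r => extChartAt 𝓘(ℝ, W) ((π ∘ γ) s) ((π ∘ γ) r)) (0 : ℝ →L[ℝ] W) r := by
      intro r hr
      have h3 := (mdifferentiableAt_extChartAt (I := 𝓘(ℝ, W)) (hball hr)).hasMFDerivAt.comp r (h2 r)
      exact h3.hasFDerivAt.congr_fderiv (ContinuousLinearMap.comp_zero _)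
    filter_upwards [Metric.ball_mem_nhds s hε] with r hr
    have h4 := (convex_ball s ε).is_const_of_fderivWithin_eq_zero (𝕜 := ℝ)
      (fun r hr => (hder r hr).differentiableAt.differentiableWithinAt)
      (fun r hr => (hder r hr).hasFDerivWithinAt.fderivWithin
        (Metric.isOpen_ball.uniqueDiffWithinAt hr)) hr (Metric.mem_ball_self hε)
    refine (extChartAt 𝓘(ℝ, W) ((π ∘ γ) s)).injOn ?_ ?_ h4
    · rw [extChartAt_source]
      exact hball hr
    · exact mem_extChartAt_source _
  have h5 := hloc.apply_eq_of_isPreconnected isPreconnected_univ (Set.mem_univ (0 : ℝ))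
    (Set.mem_univ s)
  have h6 : π 1 = π (γ s) := by rw [← h0]; exact h5
  have h7 := QuotientGroup.eq.1 h6
  simpa using h7

end Action


variable (T) in
/-- The derivative at `g` of the projection to the homogeneous space, in the left trivialization. -/
noncomputable def projectionDeriv (g : U) :
    GroupLieAlgebra 𝓘(ℝ, E) U →ₗ[ℝ] W where
  toFun v := mfderiv 𝓘(ℝ, E) 𝓘(ℝ, W) π g (mulInvariantVectorField v g)
  map_add' v w := by
    rw [mulInvariantVectorField_add]
    exact map_add (mfderiv 𝓘(ℝ, E) 𝓘(ℝ, W) π g) _ _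
  map_smul' c v := by
    rw [mulInvariantVectorField_smul]
    exact map_smul (mfderiv 𝓘(ℝ, E) 𝓘(ℝ, W) π g) _ _

/-- The curve `g * γ r` stays in one fibre of `π`, so a single chart at `π g` reads all these
derivatives. The projection in that chart is killed by `ξ`, and
`hasDerivAt_mvfderiv_mulInvariantVectorField` applies. -/
theorem hasDerivAt_projectionDeriv [IsManifold 𝓘(ℝ, W) ∞ (U ⧸ T)]
    (hπ : Manifold.IsSubmersion 𝓘(ℝ, E) 𝓘(ℝ, W) ∞ (QuotientGroup.mk : U → U ⧸ T))
    {ξ : GroupLieAlgebra 𝓘(ℝ, E) U} {γ : ℝ → U}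
    (hγ : IsMIntegralCurve γ (mulInvariantVectorField ξ)) (hT : ∀ s, γ s ∈ T)
    (hξ : ∀ g : U, mfderiv 𝓘(ℝ, E) 𝓘(ℝ, W) π g (mulInvariantVectorField ξ g) = 0)
    (g : U) (u : GroupLieAlgebra 𝓘(ℝ, E) U) (s : ℝ) :
    HasDerivAt (fun r => projectionDeriv (E := E) (W := W) T (g * γ r) u)
      (projectionDeriv (E := E) (W := W) T (g * γ s) ⁅ξ, u⁆) s := by
  have hd : ∀ x : U, MDifferentiableAt 𝓘(ℝ, E) 𝓘(ℝ, W) π x := fun x =>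
    hπ.contMDiff.mdifferentiableAt (by simp)
  have hpt : ∀ r, π (g * γ r) = π g := fun r => QuotientGroup.mk_mul_of_mem g (hT r)
  let F : U → W := fun z => extChartAt 𝓘(ℝ, W) (π g) (π z)
  have hφ : MDifferentiableAt 𝓘(ℝ, W) 𝓘(ℝ, W) (extChartAt 𝓘(ℝ, W) (π g)) (π g) :=
    mdifferentiableAt_extChartAt (mem_chart_source W _)
  have hF : ∀ r v, mvfderiv 𝓘(ℝ, E) F (g * γ r) (mulInvariantVectorField v (g * γ r)) =
      projectionDeriv (E := E) (W := W) T (g * γ r) v := by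
    intro r v
    refine (mvfderiv_comp_mfderiv_of_eq hφ (hd _) (hpt r) _).trans ?_
    exact mvfderiv_extChartAt_self (π g) _
  have hFs : ContMDiffAt 𝓘(ℝ, E) 𝓘(ℝ, W) 2 F (g * γ s) := by
    refine ContMDiffAt.comp (I' := 𝓘(ℝ, W)) (g * γ s) (g := extChartAt 𝓘(ℝ, W) (π g)) (f := π) ?_
      (hπ.contMDiff.contMDiffAt.of_le (ENat.LEInfty.out (m := 2)))
    rw [hpt]
    exact contMDiffAt_extChartAt
  have hev : ∀ᶠ z in 𝓝 (g * γ s),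
      mvfderiv 𝓘(ℝ, E) F z (mulInvariantVectorField ξ z) = 0 := by
    have h1 : ∀ᶠ z in 𝓝 (g * γ s), π z ∈ (chartAt W (π g)).source := by
      refine (hπ.contMDiff.continuous.continuousAt).eventually_mem ?_
      rw [hpt]
      exact (chartAt W (π g)).open_source.mem_nhds (mem_chart_source W _)
    filter_upwards [h1] with z hz
    refine (mvfderiv_comp_mfderiv (mdifferentiableAt_extChartAt hz) (hd z) _).trans ?_
    rw [hξ z, map_zero]
  have h := hasDerivAt_mvfderiv_mulInvariantVectorField (v := u) (hγ.mul_left g) hFs hev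
  rw [hF] at h
  exact h.congr_of_eventuallyEq (Filter.Eventually.of_forall fun r => (hF r u).symm)

/-! ### Coordinates on the tangent spaces of the homogeneous space -/

section Coordinates

variable [FiniteDimensional ℝ W] {ι : Type*} {θ : GroupLieAlgebra 𝓘(ℝ, E) U →ₗ[ℝ] (ι → ℂ)}
  {P : Set ι}

theorem IsMIntegralCurve.mem_of_eq_integralSubgroup
    (hT : T = integralSubgroup {ξ | θ ξ = 0}) {ξ : GroupLieAlgebra 𝓘(ℝ, E) U}
    (hξ : θ ξ = 0) {γ : ℝ → U} (h0 : γ 0 = 1)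
    (hγ : IsMIntegralCurve γ (mulInvariantVectorField ξ)) (s : ℝ) : γ s ∈ T := by
  rw [hT]
  exact hγ.mem_integralSubgroup (fun ξ (hξ : θ ξ = 0) c => by
    change θ (c • ξ) = 0
    rw [map_smul, hξ, smul_zero]) hξ h0 s

variable [T2Space U] [IsManifold 𝓘(ℝ, W) ∞ (U ⧸ T)]
  (hπ : Manifold.IsSubmersion 𝓘(ℝ, E) 𝓘(ℝ, W) ∞ (QuotientGroup.mk : U → U ⧸ T))
  (hθ : IsRootCoordinates θ P) (hT : T = integralSubgroup {ξ | θ ξ = 0})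

include hπ hθ hT

/-- If `dπ` kills `v`, the one-parameter subgroup of `v` lies in `T`. As `T` is generated by
exponentials of the abelian algebra `ker θ`, its adjoint action fixes `ker θ` pointwise;
differentiating at time `0` shows that `v` commutes with `ker θ`, hence lies in it. -/
theorem mfderiv_mk_mulInvariantVectorField_eq_zero_iff (v : GroupLieAlgebra 𝓘(ℝ, E) U) (g : U) :
    mfderiv 𝓘(ℝ, E) 𝓘(ℝ, W) π g (mulInvariantVectorField v g) = 0 ↔ θ v = 0 := by
  obtain ⟨γ, h0, hγ⟩ := exists_isMIntegralCurve_mulInvariantVectorField v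
  constructor
  · intro h
    have h1 : mfderiv 𝓘(ℝ, E) 𝓘(ℝ, W) π 1 v = 0 := by
      have h2 := mfderiv_smul_mfderiv_mk hπ g⁻¹ g v
      rw [h, map_zero, inv_mul_cancel, mulInvariantVectorField_one] at h2
      exact h2.symm
    have h2 := mem_of_mfderiv_mk_eq_zero hπ h0 hγ h1
    refine hθ.eq_zero_of_lie v fun η hη => ?_
    have h3 : ∀ s, chartAd 𝓘(ℝ, E) (γ s) (η : E) = η := fun s =>
      chartAd_eq_self_of_mem_integralSubgroup
        (fun ξ (hξ : θ ξ = 0) => hθ.lie_eq_zero ξ η hξ hη) (hT ▸ h2 s)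
    have h4 : HasDerivAt (F := E) (fun s => chartAd 𝓘(ℝ, E) (γ s) (η : E))
      (chartAd 𝓘(ℝ, E) (γ 0) (⁅v, η⁆ : GroupLieAlgebra 𝓘(ℝ, E) U)) 0 := hasDerivAt_chartAd hγ 0
    have h5 : HasDerivAt (F := E) (fun s => chartAd 𝓘(ℝ, E) (γ s) (η : E)) 0 0 := by
      have : (fun s => chartAd 𝓘(ℝ, E) (γ s) (η : E)) = fun _ => (η : E) := funext h3
      rw [this]
      exact hasDerivAt_const (F := E) (0 : ℝ) η
    have h6 := h4.unique h5
    rw [h0] at h6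
    exact (chartAd_one (I := 𝓘(ℝ, E)) (U := U) _).symm.trans h6
  · intro h
    exact mfderiv_mk_eq_zero_of_mem hπ h0 hγ (hγ.mem_of_eq_integralSubgroup hT h h0) g


theorem ker_projectionDeriv (g : U) :
    LinearMap.ker (projectionDeriv (E := E) (W := W) T g) = LinearMap.ker θ :=
  Submodule.ext fun v => mfderiv_mk_mulInvariantVectorField_eq_zero_iff hπ hθ hT v g

theorem projectionDeriv_eq_iff (g : U) (v w : GroupLieAlgebra 𝓘(ℝ, E) U) :
    projectionDeriv (E := E) (W := W) T g v = projectionDeriv T g w ↔ θ v = θ w := by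
  rw [← sub_eq_zero, ← map_sub, ← sub_eq_zero (a := θ v), ← map_sub, ← LinearMap.mem_ker,
    ker_projectionDeriv hπ hθ hT, LinearMap.mem_ker]

omit [CompleteSpace E] [FiniteDimensional ℝ W] [T2Space U] hθ hT in
theorem projectionDeriv_surjective (g : U) :
    Function.Surjective (projectionDeriv (E := E) (W := W) T g) := by
  intro w
  obtain ⟨v, hv⟩ := (hπ.isSubmersionAt g).mfderiv_surjective w
  refine ⟨mfderiv 𝓘(ℝ, E) 𝓘(ℝ, E) (g⁻¹ * ·) g v, ?_⟩
  refine Eq.trans ?_ hv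
  change mfderiv 𝓘(ℝ, E) 𝓘(ℝ, W) π g (mfderiv 𝓘(ℝ, E) 𝓘(ℝ, E) (g * ·) 1
    (mfderiv 𝓘(ℝ, E) 𝓘(ℝ, E) (g⁻¹ * ·) g v)) = _
  have h1 := mfderiv_comp_apply_of_eq (I := 𝓘(ℝ, E)) (I' := 𝓘(ℝ, E)) (I'' := 𝓘(ℝ, E)) (x := g)
    (y := (1 : U)) (mdifferentiableAt_mul_left' g (1 : U)) (mdifferentiableAt_mul_left' g⁻¹ g)
    (inv_mul_cancel g) v
  have h2 : (fun x : U => g * x) ∘ (fun x : U => g⁻¹ * x) = id := by ext x; simp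
  refine congrArg (mfderiv 𝓘(ℝ, E) 𝓘(ℝ, W) π g) (h1.symm.trans ?_)
  refine (congrArg (fun F : U → U => (mfderiv 𝓘(ℝ, E) 𝓘(ℝ, E) F g : E →L[ℝ] E) v) h2).trans ?_
  exact congrArg (fun L : E →L[ℝ] E => L v) mfderiv_id

/-- Along the elements of the isotropy group the coordinates change by a diagonal matrix. -/
theorem exists_projectionDeriv_mul [Fintype ι] {t : U} (ht : t ∈ T) :
    ∃ χ : ι → ℂ, (∀ α, χ α ≠ 0) ∧ ∀ (g : U) (v w : GroupLieAlgebra 𝓘(ℝ, E) U),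
      projectionDeriv (E := E) (W := W) T (g * t) v = projectionDeriv T g w → ∀ α, θ v α = χ α * θ w α := by
  have hker : ∀ g v w, projectionDeriv (E := E) (W := W) T g v = projectionDeriv T g w ↔ θ v = θ w :=
    projectionDeriv_eq_iff hπ hθ hT
  have ht' : t ∈ integralSubgroup {ξ | θ ξ = 0} := hT ▸ ht
  induction ht' using Subgroup.closure_induction with
  | mem t htm =>
    obtain ⟨ξ, hξ, γ, h0, hγ, rfl⟩ := htm
    have hξ : θ ξ = 0 := hξ
    obtain ⟨a, ha⟩ := hθ.exists_weight ξ hξ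
    obtain ⟨lift, hlift⟩ := θ.exists_rightInverse_of_surjective
      (LinearMap.range_eq_top.2 hθ.surjective)
    have hlift' : ∀ x, θ (lift x) = x := fun x => congrArg (fun L => L x) hlift
    refine ⟨fun α => Complex.exp (-a α), fun α => Complex.exp_ne_zero _, fun g v w h => ?_⟩
    have hγT : ∀ s, γ s ∈ T := hγ.mem_of_eq_integralSubgroup hT hξ h0
    have hder : ∀ (s : ℝ) (u : GroupLieAlgebra 𝓘(ℝ, E) U),
        HasDerivAt (fun r => projectionDeriv (E := E) (W := W) T (g * γ r) u)
        (projectionDeriv (E := E) (W := W) T (g * γ s) ⁅ξ, u⁆) s := by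
      intro s u
      exact hasDerivAt_projectionDeriv hπ hγ hγT
        (mfderiv_mk_mulInvariantVectorField_eq_zero_iff hπ hθ hT ξ · |>.2 hξ) g u s
    -- This solves `x' = -a x`, which offsets the factor `a` coming from `[ξ, ·]` in the derivative
    -- of the projection along `γ`; the projected vector in `hM` is therefore constant.
    let x : ℝ → ι → ℂ := fun r α => Complex.exp (r * -a α) * θ w α
    have hx : ∀ s, HasDerivAt x (fun α => -a α * x s α) s := by
      intro s
      rw [hasDerivAt_pi]
      intro α
      have h1 : HasDerivAt (fun r : ℝ => (r : ℂ) * -a α) (1 * -a α) s :=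
        (Complex.ofRealCLM.hasDerivAt (x := s)).mul_const _
      refine (h1.cexp.mul_const (θ w α)).congr_deriv ?_
      simp only [x]
      ring
    have hM : ∀ s, HasDerivAt (fun r => projectionDeriv (E := E) (W := W) T (g * γ r) (lift (x r))) 0 s := by
      intro s
      have h1 := HasDerivAt.linearMap_apply
        (A := fun r => projectionDeriv (E := E) (W := W) T (g * γ r) ∘ₗ lift)
        (A' := projectionDeriv (E := E) (W := W) T (g * γ s) ∘ₗ
          (LieAlgebra.ad ℝ (GroupLieAlgebra 𝓘(ℝ, E) U) ξ) ∘ₗ lift)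
        (fun y => hder s (lift y)) (hx s)
      refine h1.congr_deriv ?_
      have h2 : projectionDeriv (E := E) (W := W) T (g * γ s)
          ((⁅ξ, lift (x s)⁆ : GroupLieAlgebra 𝓘(ℝ, E) U) + lift (fun α => -a α * x s α)) = projectionDeriv (E := E) (W := W) T (g * γ s) 0 := by
        rw [hker, map_add, map_zero, hlift']
        ext α
        rw [Pi.add_apply, ha, hlift']
        simp
      rw [map_add, map_zero] at h2
      exact h2
    have h1 := is_const_of_deriv_eq_zero (fun s => (hM s).differentiableAt)
      (fun s => (hM s).deriv) 1 0
    have hx0 : x 0 = θ w := by ext α; simp [x]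
    rw [h0, mul_one, hx0, (hker g (lift (θ w)) w).2 (hlift' _), ← h, hker, hlift'] at h1
    intro α
    rw [← h1]
    simp [x]
  | one =>
    refine ⟨fun _ => 1, by simp, fun g v w h α => ?_⟩
    rw [mul_one, hker] at h
    rw [h, one_mul]
  | mul x y hx hy ihx ihy =>
    obtain ⟨χ, hχ, h1⟩ := ihx (hT ▸ hx)
    obtain ⟨χ', hχ', h2⟩ := ihy (hT ▸ hy)
    refine ⟨fun α => χ' α * χ α, fun α => mul_ne_zero (hχ' α) (hχ α), fun g v w h α => ?_⟩
    obtain ⟨u, hu⟩ := projectionDeriv_surjective (W := W) hπ (g * x)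
      (projectionDeriv (E := E) (W := W) T g w)
    rw [← mul_assoc] at h
    rw [h2 (g * x) v u (h.trans hu.symm), h1 g u w hu, mul_assoc]
  | inv x hx ihx =>
    obtain ⟨χ, hχ, h1⟩ := ihx (hT ▸ hx)
    refine ⟨fun α => (χ α)⁻¹, fun α => inv_ne_zero (hχ α), fun g v w h α => ?_⟩
    rw [h1 (g * x⁻¹) w v (by rw [inv_mul_cancel_right]; exact h.symm) α, ← mul_assoc,
      inv_mul_cancel₀ (hχ α), one_mul]

/-- The tangent spaces of the homogeneous space are identified with `ℂ^ι`, compatibly with `θ`. -/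
theorem exists_coordinates [Fintype ι] : ∃ C : U → W ≃L[ℝ] (ι → ℂ),
    ∀ g v, C g (projectionDeriv (E := E) (W := W) T g v) = θ v := by
  have h : ∀ g : U, ∃ C : W ≃L[ℝ] (ι → ℂ),
      ∀ v, C (projectionDeriv (E := E) (W := W) T g v) = θ v := by
    intro g
    let e₁ := (projectionDeriv (E := E) (W := W) T g).quotKerEquivOfSurjective
      (projectionDeriv_surjective hπ g)
    let e₂ := θ.quotKerEquivOfSurjective hθ.surjective
    let e := Submodule.quotEquivOfEq _ _ (ker_projectionDeriv (E := E) (W := W) hπ hθ hT g)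
    refine ⟨(e₁.symm.trans (e.trans e₂)).toContinuousLinearEquiv, fun v => ?_⟩
    have h1 : e₁.symm (projectionDeriv (E := E) (W := W) T g v) = Submodule.Quotient.mk v := by
      rw [LinearEquiv.symm_apply_eq]
      rfl
    change e₂ (e (e₁.symm _)) = _
    rw [h1]
    rfl
  choose C hC using h
  exact ⟨C, hC⟩

end Coordinates

end Homogeneous

/-! ### Real and imaginary parts in the complexification -/

section Complexification

variable {V V' : Type*} [AddCommGroup V] [Module ℝ V] [AddCommGroup V'] [Module ℝ V']

@[simp]
theorem complexificationRe_tmul (c : ℂ) (w : V) : complexificationRe (c ⊗ₜ[ℝ] w) = c.re • w := by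
  simp [complexificationRe]

@[simp]
theorem complexificationIm_tmul (c : ℂ) (w : V) : complexificationIm (c ⊗ₜ[ℝ] w) = c.im • w := by
  simp [complexificationIm]

@[simp]
theorem complexificationRe_mk (a b : V) : complexificationRe (complexificationMk a b) = a := by
  simp [complexificationMk]

@[simp]
theorem complexificationIm_mk (a b : V) : complexificationIm (complexificationMk a b) = b := by
  simp [complexificationMk]

theorem complexification_ext {z w : ℂ ⊗[ℝ] V} (h1 : complexificationRe z = complexificationRe w)
    (h2 : complexificationIm z = complexificationIm w) : z = w := by
  rw [← complexificationMk_re_im z, h1, h2, complexificationMk_re_im]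

theorem complexificationRe_smul (c : ℂ) (z : ℂ ⊗[ℝ] V) : complexificationRe (c • z) =
    c.re • complexificationRe z - c.im • complexificationIm z := by
  induction z using TensorProduct.induction_on with
  | zero => simp
  | tmul a w => simp [TensorProduct.smul_tmul', sub_smul, smul_smul]
  | add x y hx hy => rw [smul_add, map_add, hx, hy, map_add, map_add]; module

theorem complexificationIm_smul (c : ℂ) (z : ℂ ⊗[ℝ] V) : complexificationIm (c • z) =
    c.re • complexificationIm z + c.im • complexificationRe z := by
  induction z using TensorProduct.induction_on with
  | zero => simp
  | tmul a w => simp [TensorProduct.smul_tmul', add_smul, smul_smul]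
  | add x y hx hy => rw [smul_add, map_add, hx, hy, map_add, map_add]; module

theorem complexificationRe_baseChange (f : V →ₗ[ℝ] V') (z : ℂ ⊗[ℝ] V) :
    complexificationRe (f.baseChange ℂ z) = f (complexificationRe z) := by
  induction z using TensorProduct.induction_on with
  | zero => simp
  | tmul a w => simp
  | add x y hx hy => rw [map_add, map_add, hx, hy, map_add, map_add]

theorem complexificationIm_baseChange (f : V →ₗ[ℝ] V') (z : ℂ ⊗[ℝ] V) :
    complexificationIm (f.baseChange ℂ z) = f (complexificationIm z) := by
  induction z using TensorProduct.induction_on with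
  | zero => simp
  | tmul a w => simp
  | add x y hx hy => rw [map_add, map_add, hx, hy, map_add, map_add]

theorem complexificationRe_conj (z : ℂ ⊗[ℝ] V) :
    complexificationRe (complexificationConj z) = complexificationRe z := by
  induction z using TensorProduct.induction_on with
  | zero => simp
  | tmul a w => simp [complexificationConj]
  | add x y hx hy => rw [map_add, map_add, hx, hy, map_add]

theorem complexificationIm_conj (z : ℂ ⊗[ℝ] V) :
    complexificationIm (complexificationConj z) = -complexificationIm z := by
  induction z using TensorProduct.induction_on with
  | zero => simp
  | tmul a w => simp [complexificationConj]
  | add x y hx hy => rw [map_add, map_add, hx, hy, map_add, neg_add]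

end Complexification

/-! ### Linear algebra of the fibre `E ⊕ Ann E` -/

section RegularFiber

variable {ι : Type*} {P : Set ι}

theorem PairIn.add {u v u' v' : ι → ℂ} (h : PairIn P u v) (h' : PairIn P u' v') :
    PairIn P (u + u') (v + v') := fun α => by
  refine ⟨?_, fun hα => ?_⟩
  · rw [Pi.add_apply, Pi.add_apply, (h α).1, (h' α).1, mul_add]
  · rw [Pi.add_apply, (h α).2 hα, (h' α).2 hα, add_zero]

theorem PairIn.smul {u v : ι → ℂ} (h : PairIn P u v) (c : ℝ) : PairIn P (c • u) (c • v) :=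
  fun α => by
  refine ⟨?_, fun hα => ?_⟩
  · rw [Pi.smul_apply, Pi.smul_apply, (h α).1, mul_smul_comm]
  · rw [Pi.smul_apply, (h α).2 hα, smul_zero]

/-- This is multiplication of `u + i v` by `i`. -/
theorem PairIn.rotate {u v : ι → ℂ} (h : PairIn P u v) : PairIn P (-v) u := fun α => by
  refine ⟨?_, fun hα => ?_⟩
  · rw [Pi.neg_apply, (h α).1]
    linear_combination u α * Complex.I_mul_I
  · rw [Pi.neg_apply, (h α).1, (h α).2 hα, mul_zero, neg_zero]

theorem pairIn_zero : PairIn P (0 : ι → ℂ) 0 := fun α => by simp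

theorem PairIn.eq_zero {u v : ι → ℂ} (h : PairIn P u v) {α : ι} (hα : α ∉ P) :
    u α = 0 ∧ v α = 0 := by
  refine ⟨(h α).2 hα, ?_⟩
  rw [(h α).1, (h α).2 hα, mul_zero]

/-- The conditions are homogeneous in each coordinate separately. Hence the isotropy group, which
acts diagonally, preserves them. -/
theorem pairIn_diagonal_iff {χ : ι → ℂ} (hχ : ∀ α, χ α ≠ 0) {u v u' v' : ι → ℂ}
    (hu : ∀ α, u' α = χ α * u α) (hv : ∀ α, v' α = χ α * v α) :
    PairIn P u' v' ↔ PairIn P u v := by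
  refine forall_congr' fun α => ?_
  rw [hu, hv, mul_left_comm, mul_right_inj' (hχ α), mul_eq_zero, or_iff_right (hχ α)]

/-- The pairs `(u, v)` are determined by the real linear forms vanishing on them. -/
theorem pairIn_of_forall_form {u v : ι → ℂ}
    (h : ∀ f₁ f₂ : (ι → ℂ) →L[ℝ] ℝ, (∀ u' v', PairIn P u' v' → f₁ u' = f₂ v') → f₁ u = f₂ v) :
    PairIn P u v := by
  intro α
  let re : (ι → ℂ) →L[ℝ] ℝ := Complex.reCLM ∘L ContinuousLinearMap.proj (R := ℝ) α
  let im : (ι → ℂ) →L[ℝ] ℝ := Complex.imCLM ∘L ContinuousLinearMap.proj (R := ℝ) α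
  constructor
  · have h1 := h re im fun u' v' h' => by simp [re, im, (h' α).1]
    have h2 := h im (-re) fun u' v' h' => by simp [re, im, (h' α).1]
    apply Complex.ext
    · simp only [im, re, ContinuousLinearMap.coe_comp, Function.comp_apply,
        ContinuousLinearMap.proj_apply, Complex.imCLM_apply, Complex.reCLM_apply,
        neg_apply] at h2
      simp [h2]
    · simp only [im, re, ContinuousLinearMap.coe_comp, Function.comp_apply,
        ContinuousLinearMap.proj_apply, Complex.imCLM_apply, Complex.reCLM_apply] at h1
      simp [h1]
  · intro hα
    have h1 := h re 0 fun u' v' h' => by simp [re, (h' α).2 hα]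
    have h2 := h im 0 fun u' v' h' => by simp [im, (h' α).2 hα]
    exact Complex.ext h1 h2

variable {V : Type*} [AddCommGroup V] [Module ℝ V] [TopologicalSpace V]
  {V' : Type*} [AddCommGroup V'] [Module ℝ V'] [TopologicalSpace V']

/-- The complex subspace `E ⊕ Ann E` of `(V ⊕ V*) ⊗ ℂ`, where `E` consists of the vectors
`x + i y` whose coordinates `(Θ x, Θ y)` lie in the directions `P`. -/
def regularFiber (P : Set ι) (Θ : V ≃L[ℝ] (ι → ℂ)) : Submodule ℂ (ℂ ⊗[ℝ] (V × (V →L[ℝ] ℝ))) where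
  -- The equation on forms is the real part of `(ξ₁ + i ξ₂) (x + i y) = 0`; the imaginary part is,
  -- up to sign, the same equation at `i (x + i y)`.
  carrier := {z | PairIn P (Θ (complexificationRe z).1) (Θ (complexificationIm z).1) ∧
    ∀ x y, PairIn P (Θ x) (Θ y) → (complexificationRe z).2 x = (complexificationIm z).2 y}
  add_mem' := by
    rintro z w ⟨hz1, hz2⟩ ⟨hw1, hw2⟩
    refine ⟨?_, fun x y h => ?_⟩
    · simpa only [map_add, Prod.fst_add] using hz1.add hw1
    · simp only [map_add, Prod.snd_add, add_apply, hz2 x y h, hw2 x y h]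
  zero_mem' := by
    refine ⟨?_, fun x y h => ?_⟩
    · simpa only [map_zero, Prod.fst_zero] using pairIn_zero
    · simp
  smul_mem' := by
    rintro c z ⟨hz1, hz2⟩
    refine ⟨?_, fun x y h => ?_⟩
    · have := (hz1.smul c.re).add (hz1.rotate.smul c.im)
      rw [smul_neg, ← sub_eq_add_neg] at this
      simpa only [complexificationRe_smul, complexificationIm_smul, Prod.fst_add, Prod.fst_sub,
        Prod.smul_fst, map_add, map_sub, map_smul] using this
    · have h1 := hz2 x y h
      have h2 := hz2 (-y) x (by rw [map_neg]; exact h.rotate)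
      rw [map_neg] at h2
      simp only [complexificationRe_smul, complexificationIm_smul, Prod.snd_add, Prod.snd_sub,
        Prod.smul_snd, add_apply, sub_apply,
        smul_apply, smul_eq_mul, h1, ← h2]
      ring

theorem mem_regularFiber {Θ : V ≃L[ℝ] (ι → ℂ)} {z : ℂ ⊗[ℝ] (V × (V →L[ℝ] ℝ))} :
    z ∈ regularFiber P Θ ↔
      PairIn P (Θ (complexificationRe z).1) (Θ (complexificationIm z).1) ∧
      ∀ x y, PairIn P (Θ x) (Θ y) → (complexificationRe z).2 x = (complexificationIm z).2 y :=
  Iff.rfl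

/-- The map `V ⊕ V* → V' ⊕ V'*` induced by an isomorphism. -/
def genTransport (Ψ : V ≃L[ℝ] V') : V × (V →L[ℝ] ℝ) →ₗ[ℝ] V' × (V' →L[ℝ] ℝ) where
  toFun a := (Ψ a.1, a.2.comp (Ψ.symm : V' →L[ℝ] V))
  map_add' a b := by simp
  map_smul' c a := by simp

theorem map_genTransport_regularFiber (Ψ : V ≃L[ℝ] V') (Θ : V ≃L[ℝ] (ι → ℂ)) :
    (regularFiber P Θ).map ((genTransport Ψ).baseChange ℂ) =
      regularFiber P (Ψ.symm.trans Θ) := by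
  apply le_antisymm
  · rintro _ ⟨z, hz, rfl⟩
    rw [SetLike.mem_coe, mem_regularFiber] at hz
    rw [mem_regularFiber, complexificationRe_baseChange, complexificationIm_baseChange]
    refine ⟨?_, fun x y h => ?_⟩
    · simpa [genTransport] using hz.1
    · exact hz.2 _ _ h
  · intro z hz
    rw [mem_regularFiber] at hz
    refine ⟨(genTransport Ψ.symm).baseChange ℂ z, ?_, ?_⟩
    · rw [SetLike.mem_coe, mem_regularFiber, complexificationRe_baseChange,
        complexificationIm_baseChange]
      refine ⟨hz.1, fun x y h => ?_⟩
      refine hz.2 (Ψ x) (Ψ y) ?_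
      simpa using h
    · apply complexification_ext
      · rw [complexificationRe_baseChange, complexificationRe_baseChange]
        ext <;> simp [genTransport]
      · rw [complexificationIm_baseChange, complexificationIm_baseChange]
        ext <;> simp [genTransport]

theorem genTransport_injective (Ψ : V ≃L[ℝ] V') :
    Function.Injective ((genTransport Ψ).baseChange ℂ) := by
  refine Function.LeftInverse.injective (g := (genTransport Ψ.symm).baseChange ℂ) fun z => ?_
  apply complexification_ext
  · rw [complexificationRe_baseChange, complexificationRe_baseChange]
    ext <;> simp [genTransport]
  · rw [complexificationIm_baseChange, complexificationIm_baseChange]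
    ext <;> simp [genTransport]

/-- A vector in `E ∩ Ē` satisfies `v = i u` and `-v = i u`, so it is zero. What remains are the
complex forms annihilating `E` and `Ē`, that is, those factoring through the coordinates outside
`P`: the complexified real dual of a space of real dimension `2 (card ι - card P)`. -/
theorem finrank_regularFiber_inf_conj [Fintype ι] (P : Finset ι) (Θ : V ≃L[ℝ] (ι → ℂ)) :
    Module.finrank ℂ ↥(regularFiber (P : Set ι) Θ ⊓ conjSubmodule (regularFiber (P : Set ι) Θ)) =
      2 * (Fintype.card ι - P.card) := by
  classical
  let κ := {α : ι // α ∉ P}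
  let R : (ι → ℂ) →L[ℝ] (κ → ℂ) :=
    ContinuousLinearMap.pi fun α => ContinuousLinearMap.proj (R := ℝ) α.1
  let S : (κ → ℂ) →L[ℝ] (ι → ℂ) := ContinuousLinearMap.pi fun α =>
    if h : α ∉ P then ContinuousLinearMap.proj (R := ℝ) (φ := fun _ : κ => ℂ) ⟨α, h⟩ else 0
  have hRS : ∀ u, R (S u) = u := fun u => by
    ext ⟨α, hα⟩
    simp [R, S, hα]
  have hSR : ∀ u α, α ∉ P → (u - S (R u)) α = 0 := fun u α hα => by
    simp [R, S, hα]
  obtain ⟨j, hj_apply⟩ : ∃ j : ((κ → ℂ) →L[ℝ] ℝ) →ₗ[ℝ] V × (V →L[ℝ] ℝ),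
      ∀ ξ, j ξ = (0, ξ.comp (R.comp (Θ : V →L[ℝ] (ι → ℂ)))) :=
    ⟨{ toFun := fun ξ => (0, ξ.comp (R.comp (Θ : V →L[ℝ] (ι → ℂ))))
       map_add' := fun a b => by simp
       map_smul' := fun c a => by simp }, fun _ => rfl⟩
  have hj : Function.Injective j := by
    intro a b hab
    ext1 u
    have h1 := congrArg (fun L : V →L[ℝ] ℝ => L (Θ.symm (S u))) (congrArg Prod.snd hab)
    simpa [hj_apply, hRS] using h1
  have hj' : Function.Injective (j.baseChange ℂ) :=
    Module.Flat.lTensor_preserves_injective_linearMap (M := ℂ) j hj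
  have hrange : LinearMap.range (j.baseChange ℂ) =
      regularFiber (P : Set ι) Θ ⊓ conjSubmodule (regularFiber (P : Set ι) Θ) := by
    apply le_antisymm
    · rintro _ ⟨w, rfl⟩
      have hR : ∀ x y, PairIn (P : Set ι) (Θ x) (Θ y) → R (Θ x) = 0 ∧ R (Θ y) = 0 :=
        fun x y h => ⟨funext fun α => (h.eq_zero α.2).1, funext fun α => (h.eq_zero α.2).2⟩
      refine ⟨?_, ?_⟩
      · rw [SetLike.mem_coe, mem_regularFiber, complexificationRe_baseChange,
          complexificationIm_baseChange]
        refine ⟨by simpa [hj_apply] using pairIn_zero, fun x y h => ?_⟩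
        simp [hj_apply, hR x y h]
      · change complexificationConj _ ∈ regularFiber (P : Set ι) Θ
        rw [mem_regularFiber, complexificationRe_conj, complexificationIm_conj,
          complexificationRe_baseChange, complexificationIm_baseChange]
        refine ⟨by simpa [hj_apply] using pairIn_zero, fun x y h => ?_⟩
        simp [hj_apply, hR x y h]
    · rintro z ⟨hz, hz'⟩
      change complexificationConj z ∈ regularFiber (P : Set ι) Θ at hz'
      rw [mem_regularFiber, complexificationRe_conj, complexificationIm_conj] at hz'
      rw [SetLike.mem_coe, mem_regularFiber] at hz
      have hX : ∀ α, Θ (complexificationRe z).1 α = 0 ∧ Θ (complexificationIm z).1 α = 0 := by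
        intro α
        have h1 := (hz.1 α).1
        have h2 := (hz'.1 α).1
        rw [Prod.fst_neg, map_neg, Pi.neg_apply] at h2
        have h3 : Θ (complexificationIm z).1 α = 0 := by linear_combination (1 / 2) * h1 - (1 / 2) * h2
        rw [h3, eq_comm, mul_eq_zero, or_iff_right Complex.I_ne_zero] at h1
        exact ⟨h1, h3⟩
      have hη : ∀ x y, PairIn (P : Set ι) (Θ x) (Θ y) →
          (complexificationRe z).2 x = 0 ∧ (complexificationIm z).2 y = 0 := by
        intro x y h
        have h1 := hz.2 x y h
        have h2 := hz'.2 x y h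
        rw [Prod.snd_neg, neg_apply] at h2
        constructor <;> linarith
      have hsupp : ∀ u : ι → ℂ, (∀ α ∉ P, u α = 0) →
          (complexificationRe z).2 (Θ.symm u) = 0 ∧ (complexificationIm z).2 (Θ.symm u) = 0 := by
        intro u hu
        -- A vector with coordinates supported in `P` is the real part of one element of `E` and the
        -- imaginary part of another, so both forms vanish on it.
        have h1 : PairIn (P : Set ι) (Θ (Θ.symm u)) (Θ (Θ.symm (Complex.I • u))) := by
          rw [Θ.apply_symm_apply, Θ.apply_symm_apply]
          exact fun α => ⟨rfl, hu α⟩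
        have h2 := h1.rotate
        rw [← map_neg] at h2
        exact ⟨(hη _ _ h1).1, (hη _ _ h2).2⟩
      let ξ : (V →L[ℝ] ℝ) → ((κ → ℂ) →L[ℝ] ℝ) := fun η =>
        η.comp ((Θ.symm : (ι → ℂ) →L[ℝ] V).comp S)
      have hξ : ∀ η : V →L[ℝ] ℝ, (∀ u : ι → ℂ, (∀ α ∉ P, u α = 0) → η (Θ.symm u) = 0) →
          (ξ η).comp (R.comp (Θ : V →L[ℝ] (ι → ℂ))) = η := by
        intro η h
        ext x
        have h1 := h (Θ x - S (R (Θ x))) (hSR (Θ x))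
        rw [map_sub, map_sub, Θ.symm_apply_apply, sub_eq_zero] at h1
        exact h1.symm
      refine ⟨complexificationMk (ξ (complexificationRe z).2) (ξ (complexificationIm z).2), ?_⟩
      apply complexification_ext
      · rw [complexificationRe_baseChange, complexificationRe_mk]
        rw [hj_apply]
        refine Prod.ext ?_ (hξ _ fun u hu => (hsupp u hu).1)
        exact (Θ.map_eq_zero_iff.1 (funext fun α => (hX α).1)).symm
      · rw [complexificationIm_baseChange, complexificationIm_mk]
        rw [hj_apply]
        refine Prod.ext ?_ (hξ _ fun u hu => (hsupp u hu).2)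
        exact (Θ.map_eq_zero_iff.1 (funext fun α => (hX α).2)).symm
  rw [← hrange, LinearMap.finrank_range_of_inj hj', Module.finrank_baseChange,
    ← LinearMap.toContinuousLinearMap.finrank_eq, Module.finrank_linearMap, Module.finrank_self,
    mul_one, Module.finrank_pi_fintype]
  simp [Complex.finrank_real_complex, κ, Fintype.card_subtype_compl, mul_comm]

end RegularFiber

/-! ### Maximal isotropy of the fibre -/

section MaximalIsotropic

variable {W : Type*} [NormedAddCommGroup W] [NormedSpace ℝ W]
  {M : Type*} [TopologicalSpace M] [ChartedSpace W M] {ι : Type*} {P : Set ι}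

theorem complexGenPairing_mk (x : M) (a b c d : GenTangentSpace W x) :
    complexGenPairing W x (complexificationMk a b) (complexificationMk c d) =
      ((genPairing W x a c - genPairing W x b d : ℝ) : ℂ) +
        Complex.I * ((genPairing W x a d + genPairing W x b c : ℝ) : ℂ) := by
  simp only [complexGenPairing, complexificationMk, map_add, LinearMap.add_apply,
    LinearMap.BilinForm.baseChange_tmul]
  push_cast
  simp
  ring

theorem genPairing_apply (x : M) (a b : GenTangentSpace W x) :
    genPairing W x a b = (1 / 2 : ℝ) * (a.2 b.1 + b.2 a.1) := rfl

/-- An element orthogonal to `E ⊕ Ann E` already lies in it: orthogonality to `Ann E` puts its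
vector part in `E` by `pairIn_of_forall_form`, and orthogonality to `E` puts its form part in `Ann
E`. -/
theorem maximal_isIsotropic_regularFiber (x : M) (Θ : TangentSpace 𝓘(ℝ, W) x ≃L[ℝ] (ι → ℂ)) :
    Maximal (IsIsotropic W x) (regularFiber P Θ) := by
  constructor
  · intro a ha b hb
    rw [mem_regularFiber] at ha hb
    rw [← complexificationMk_re_im a, ← complexificationMk_re_im b, complexGenPairing_mk]
    simp only [genPairing_apply]
    have h1 := ha.2 _ _ hb.1
    have h2 := hb.2 _ _ ha.1
    have h3 := ha.2 (-(complexificationIm b).1) (complexificationRe b).1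
      (by rw [map_neg]; exact hb.1.rotate)
    have h4 := hb.2 (-(complexificationIm a).1) (complexificationRe a).1
      (by rw [map_neg]; exact ha.1.rotate)
    rw [map_neg] at h3 h4
    rw [h1, h2, ← h3, ← h4]
    push_cast
    ring
  · intro L' hL' hle z hz
    have key : ∀ a b : GenTangentSpace W x, complexificationMk a b ∈ regularFiber P Θ →
        (complexificationRe z).2 a.1 + a.2 (complexificationRe z).1 =
          (complexificationIm z).2 b.1 + b.2 (complexificationIm z).1 := by
      intro a b hab
      have h := hL' z hz _ (hle hab)
      rw [← complexificationMk_re_im z, complexGenPairing_mk] at h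
      have h1 := congrArg Complex.re h
      simp only [Complex.add_re, Complex.ofReal_re, Complex.re_mul_ofReal, Complex.I_re, zero_mul,
        add_zero, Complex.zero_re, genPairing_apply] at h1
      linarith
    rw [mem_regularFiber]
    constructor
    · refine pairIn_of_forall_form fun f₁ f₂ hf => ?_
      have h := key (0, f₁.comp (Θ : TangentSpace 𝓘(ℝ, W) x →L[ℝ] (ι → ℂ)))
        (0, f₂.comp (Θ : TangentSpace 𝓘(ℝ, W) x →L[ℝ] (ι → ℂ))) (by
          rw [mem_regularFiber, complexificationRe_mk, complexificationIm_mk]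
          exact ⟨by simpa using pairIn_zero, fun x y h => hf _ _ h⟩)
      simpa using h
    · intro v w hvw
      have h := key (v, 0) (w, 0) (by
        rw [mem_regularFiber, complexificationRe_mk, complexificationIm_mk]
        exact ⟨hvw, by simp⟩)
      simpa using h

end MaximalIsotropic

/-! ### Smooth one-forms, frames and coframes -/

section SmoothSections

open Set

variable {W : Type*} [NormedAddCommGroup W] [NormedSpace ℝ W]
  {M : Type*} [TopologicalSpace M] [ChartedSpace W M] [IsManifold 𝓘(ℝ, W) ∞ M]

theorem mvfderiv_extChartAt_symmL {x z : M} (hz : z ∈ (chartAt W x).source) (w : W) :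
    mvfderiv 𝓘(ℝ, W) (extChartAt 𝓘(ℝ, W) x) z
      ((trivializationAt W (TangentSpace 𝓘(ℝ, W)) x).symmL ℝ z w) = w := by
  have h1 := TangentBundle.continuousLinearMapAt_trivializationAt (I := 𝓘(ℝ, W)) hz
  have h2 := (trivializationAt W (TangentSpace 𝓘(ℝ, W)) x).continuousLinearMapAt_symmL (R := ℝ)
    (b := z) (by simpa using hz) w
  refine Eq.trans ?_ h2
  exact (congrArg (fun L : TangentSpace 𝓘(ℝ, W) z →L[ℝ] W =>
    L ((trivializationAt W (TangentSpace 𝓘(ℝ, W)) x).symmL ℝ z w)) h1).symm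

theorem inCoordinates_oneForm (η : (y : M) → (TangentSpace 𝓘(ℝ, W) y →L[ℝ] ℝ)) {x z : M}
    (hz : z ∈ (chartAt W x).source) :
    ContinuousLinearMap.inCoordinates W (TangentSpace 𝓘(ℝ, W)) ℝ (Bundle.Trivial M ℝ) x z x z
      (η z) = chartOneForm W x η (extChartAt 𝓘(ℝ, W) x z) := by
  have : IsManifold 𝓘(ℝ, W) 1 M := .of_le (n := ∞) (by simp)
  ext w
  have h1 := oneForm_apply_eq_chartOneForm η (x := x) (y := z) (by simpa using hz)
    ((trivializationAt W (TangentSpace 𝓘(ℝ, W)) x).symmL ℝ z w)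
  rw [mvfderiv_extChartAt_symmL hz] at h1
  refine Eq.trans ?_ h1
  simp [ContinuousLinearMap.inCoordinates]

/-- Links smoothness as a section of the cotangent bundle with the chart expression by which
exterior derivatives are computed. -/
theorem contMDiffAt_oneForm_iff (η : (y : M) → (TangentSpace 𝓘(ℝ, W) y →L[ℝ] ℝ)) (x : M) :
    ContMDiffAt 𝓘(ℝ, W) (𝓘(ℝ, W).prod 𝓘(ℝ, W →L[ℝ] ℝ)) ∞
      (fun y => Bundle.TotalSpace.mk' (W →L[ℝ] ℝ)
        (E := fun y : M => TangentSpace 𝓘(ℝ, W) y →L[ℝ] Bundle.Trivial M ℝ y) y (η y)) x ↔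
    ContMDiffAt 𝓘(ℝ, W) 𝓘(ℝ, W →L[ℝ] ℝ) ∞
      (fun y => chartOneForm W x η (extChartAt 𝓘(ℝ, W) x y)) x := by
  have h := contMDiffAt_hom_bundle (IB := 𝓘(ℝ, W)) (IM := 𝓘(ℝ, W)) (n := ∞) (x₀ := x)
    (fun y => Bundle.TotalSpace.mk' (W →L[ℝ] ℝ)
        (E := fun y : M => TangentSpace 𝓘(ℝ, W) y →L[ℝ] Bundle.Trivial M ℝ y) y (η y))
  refine h.trans ((and_iff_right contMDiffAt_id).trans ?_)
  have h2 : (fun y => ContinuousLinearMap.inCoordinates W (TangentSpace 𝓘(ℝ, W)) ℝ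
      (Bundle.Trivial M ℝ) x y x y (η y)) =ᶠ[𝓝 x]
      fun y => chartOneForm W x η (extChartAt 𝓘(ℝ, W) x y) := by
    filter_upwards [(chartAt W x).open_source.mem_nhds (mem_chart_source W x)] with z hz
    exact inCoordinates_oneForm η hz
  exact h2.contMDiffAt_iff

theorem differentiableAt_chartOneForm {η : (y : M) → (TangentSpace 𝓘(ℝ, W) y →L[ℝ] ℝ)} {x : M}
    (h : ContMDiffAt 𝓘(ℝ, W) (𝓘(ℝ, W).prod 𝓘(ℝ, W →L[ℝ] ℝ)) ∞
      (fun y => Bundle.TotalSpace.mk' (W →L[ℝ] ℝ)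
        (E := fun y : M => TangentSpace 𝓘(ℝ, W) y →L[ℝ] Bundle.Trivial M ℝ y) y (η y)) x) :
    DifferentiableAt ℝ (chartOneForm W x η) (extChartAt 𝓘(ℝ, W) x x) := by
  rw [contMDiffAt_oneForm_iff] at h
  have h1 := (contDiffAt_comp_chart_symm h).differentiableAt (by simp)
  refine h1.congr_of_eventuallyEq ?_
  filter_upwards [(isOpen_extChartAt_target x).mem_nhds (mem_extChartAt_target (I := 𝓘(ℝ, W)) x)]
    with e he
  simp only [Function.comp_apply]
  rw [(extChartAt 𝓘(ℝ, W) x).right_inv he]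

/-- A family of continuous linear maps on a finite-dimensional space is smooth if it is so
pointwise. -/
theorem contMDiffAt_clm_of_apply {E H N V : Type*} [NormedAddCommGroup E] [NormedSpace ℝ E]
    [TopologicalSpace H] {I : ModelWithCorners ℝ E H} [TopologicalSpace N] [ChartedSpace H N]
    [NormedAddCommGroup V] [NormedSpace ℝ V] [FiniteDimensional ℝ V] [FiniteDimensional ℝ W]
    {n : WithTop ℕ∞} {K : N → V →L[ℝ] W} {x : N}
    (h : ∀ v, ContMDiffAt I 𝓘(ℝ, W) n (fun z => K z v) x) :
    ContMDiffAt I 𝓘(ℝ, V →L[ℝ] W) n K x := by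
  let b := Module.finBasis ℝ V
  let A : (Fin (Module.finrank ℝ V) → W) →ₗ[ℝ] (V →L[ℝ] W) :=
    ((b.constr ℝ).trans LinearMap.toContinuousLinearMap).toLinearMap
  have hA : ∀ z, K z = LinearMap.toContinuousLinearMap A (fun j => K z (b j)) := fun z => by
    apply ContinuousLinearMap.coe_injective
    refine b.ext fun j => ?_
    exact (b.constr_basis ℝ (fun j => K z (b j)) j).symm
  have h1 : ContMDiffAt I 𝓘(ℝ, Fin (Module.finrank ℝ V) → W) n (fun z j => K z (b j)) x :=
    contMDiffAt_pi_space.2 fun j => h (b j)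
  have h2 : ContMDiffAt I 𝓘(ℝ, V →L[ℝ] W) n
      (fun z => LinearMap.toContinuousLinearMap A (fun j => K z (b j))) x :=
    (LinearMap.toContinuousLinearMap A).contMDiff.contMDiffAt.comp x h1
  exact h2.congr_of_eventuallyEq (Filter.Eventually.of_forall hA)

/-- A coframe dual to a smooth frame is smooth. -/
theorem contMDiffAt_oneForm_of_frame [FiniteDimensional ℝ W] {V : Type*} [NormedAddCommGroup V]
    [NormedSpace ℝ V] [FiniteDimensional ℝ V]
    {Ψ : (y : M) → TangentSpace 𝓘(ℝ, W) y ≃L[ℝ] V} {x : M}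
    (h : ∀ v : V, ContMDiffAt 𝓘(ℝ, W) (𝓘(ℝ, W).prod 𝓘(ℝ, W)) ∞
      (fun y => Bundle.TotalSpace.mk' W (E := fun y : M => TangentSpace 𝓘(ℝ, W) y) y
        ((Ψ y).symm v)) x) (ζ : V →L[ℝ] ℝ) :
    ContMDiffAt 𝓘(ℝ, W) (𝓘(ℝ, W).prod 𝓘(ℝ, W →L[ℝ] ℝ)) ∞
      (fun y => Bundle.TotalSpace.mk' (W →L[ℝ] ℝ)
        (E := fun y : M => TangentSpace 𝓘(ℝ, W) y →L[ℝ] Bundle.Trivial M ℝ y) y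
        (ζ.comp (Ψ y : TangentSpace 𝓘(ℝ, W) y →L[ℝ] V))) x := by
  have hM : IsManifold 𝓘(ℝ, W) 1 M := .of_le (n := ∞) (by simp)
  have : CompleteSpace V := FiniteDimensional.complete ℝ V
  -- `K y` is the frame in the chart at `x`. The coframe has coefficients `ζ ∘ (K y)⁻¹`, and
  -- inversion is smooth at invertible maps.
  let K : M → V →L[ℝ] W := fun y => (mvfderiv 𝓘(ℝ, W) (extChartAt 𝓘(ℝ, W) x) y).comp
    ((Ψ y).symm : V →L[ℝ] TangentSpace 𝓘(ℝ, W) y)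
  have hinv : ∀ z ∈ (chartAt W x).source, ∃ e : V ≃L[ℝ] W, K z = e := by
    intro z hz
    obtain ⟨e, he⟩ := isInvertible_mfderiv_extChartAt (I := 𝓘(ℝ, W)) (x := x) (y := z)
      (by simpa using hz)
    refine ⟨(Ψ z).symm.trans e, ?_⟩
    ext v
    exact congrArg (fun L => L ((Ψ z).symm v)) he.symm
  have hK : ContMDiffAt 𝓘(ℝ, W) 𝓘(ℝ, V →L[ℝ] W) ∞ K x := by
    refine contMDiffAt_clm_of_apply fun v => ?_
    have h1 := (Bundle.contMDiffAt_totalSpace.1 (h v)).2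
    refine h1.congr_of_eventuallyEq ?_
    filter_upwards [(chartAt W x).open_source.mem_nhds (mem_chart_source W x)] with z hz
    have h2 := TangentBundle.continuousLinearMapAt_trivializationAt (I := 𝓘(ℝ, W)) hz
    have h3 := congrArg (fun L => L ((Ψ z).symm v)) h2
    refine h3.symm.trans ?_
    exact (trivializationAt W (TangentSpace 𝓘(ℝ, W)) x).continuousLinearMapAt_apply_of_mem ℝ
      (by simpa using hz) _
  rw [contMDiffAt_oneForm_iff]
  obtain ⟨e, he⟩ := hinv x (mem_chart_source W x)
  have hKi : ContMDiffAt 𝓘(ℝ, W) 𝓘(ℝ, W →L[ℝ] ℝ) ∞ (fun z => ζ.comp (K z).inverse) x := by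
    have h1 : ContMDiffAt 𝓘(ℝ, W) 𝓘(ℝ, W →L[ℝ] V) ∞ (fun z => (K z).inverse) x := by
      refine ContMDiffAt.comp (I' := 𝓘(ℝ, V →L[ℝ] W)) x (g := ContinuousLinearMap.inverse) ?_ hK
      rw [he]
      exact (contDiffAt_map_inverse e).contMDiffAt
    exact contMDiffAt_const.clm_comp h1
  refine hKi.congr_of_eventuallyEq ?_
  filter_upwards [(chartAt W x).open_source.mem_nhds (mem_chart_source W x)] with z hz
  obtain ⟨e, he⟩ := hinv z hz
  rw [he, ContinuousLinearMap.inverse_equiv]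
  ext w
  have h1 := oneForm_apply_eq_chartOneForm (fun y => ζ.comp (Ψ y : TangentSpace 𝓘(ℝ, W) y →L[ℝ] V))
    (x := x) (y := z) (by simpa using hz) ((Ψ z).symm (e.symm w))
  have h2 : mvfderiv 𝓘(ℝ, W) (extChartAt 𝓘(ℝ, W) x) z ((Ψ z).symm (e.symm w)) = w := by
    have := congrArg (fun L => L (e.symm w)) he
    exact this.trans (e.apply_symm_apply w)
  rw [h2] at h1
  refine h1.symm.trans ?_
  simp

end SmoothSections

/-! ### Exterior derivatives of annihilating complex forms -/

section Involutivity

open VectorField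

variable {E : Type*} [NormedAddCommGroup E] [NormedSpace ℝ E] [CompleteSpace E]
  {H : Type*} [TopologicalSpace H] {I : ModelWithCorners ℝ E H} [I.Boundaryless]
  {N : Type*} [TopologicalSpace N] [ChartedSpace H N] [IsManifold I 2 N]
  {W : Type*} [NormedAddCommGroup W] [NormedSpace ℝ W]
  {M : Type*} [TopologicalSpace M] [ChartedSpace W M] [IsManifold 𝓘(ℝ, W) 2 M]

/-- The exterior derivative of a complex form `η₁ + i η₂` on complex vector fields `X₁ + i X₂` and
`Y₁ + i Y₂` annihilated by it (real part). -/
theorem interiorExtDeriv_pair_mfderiv {η₁ η₂ : (y : M) → (TangentSpace 𝓘(ℝ, W) y →L[ℝ] ℝ)}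
    {f : N → M} {x : N} (hf : ContMDiffAt I 𝓘(ℝ, W) 2 f x)
    (hη₁ : DifferentiableAt ℝ (chartOneForm W (f x) η₁) (extChartAt 𝓘(ℝ, W) (f x) (f x)))
    (hη₂ : DifferentiableAt ℝ (chartOneForm W (f x) η₂) (extChartAt 𝓘(ℝ, W) (f x) (f x)))
    {X₁ X₂ Y₁ Y₂ : (y : N) → TangentSpace I y}
    (hX₁ : MDifferentiableAt I I.tangent (fun y => (X₁ y : TangentBundle I N)) x)
    (hX₂ : MDifferentiableAt I I.tangent (fun y => (X₂ y : TangentBundle I N)) x)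
    (hY₁ : MDifferentiableAt I I.tangent (fun y => (Y₁ y : TangentBundle I N)) x)
    (hY₂ : MDifferentiableAt I I.tangent (fun y => (Y₂ y : TangentBundle I N)) x)
    (hX : ∀ᶠ z in 𝓝 x, η₁ (f z) (mfderiv I 𝓘(ℝ, W) f z (X₁ z)) =
      η₂ (f z) (mfderiv I 𝓘(ℝ, W) f z (X₂ z)))
    (hX' : ∀ᶠ z in 𝓝 x, η₁ (f z) (mfderiv I 𝓘(ℝ, W) f z (X₂ z)) =
      -η₂ (f z) (mfderiv I 𝓘(ℝ, W) f z (X₁ z)))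
    (hY : ∀ᶠ z in 𝓝 x, η₁ (f z) (mfderiv I 𝓘(ℝ, W) f z (Y₁ z)) =
      η₂ (f z) (mfderiv I 𝓘(ℝ, W) f z (Y₂ z)))
    (hY' : ∀ᶠ z in 𝓝 x, η₁ (f z) (mfderiv I 𝓘(ℝ, W) f z (Y₂ z)) =
      -η₂ (f z) (mfderiv I 𝓘(ℝ, W) f z (Y₁ z))) :
    interiorExtDeriv W η₁ (f x) (mfderiv I 𝓘(ℝ, W) f x (X₁ x)) (mfderiv I 𝓘(ℝ, W) f x (Y₁ x)) -
      interiorExtDeriv W η₁ (f x) (mfderiv I 𝓘(ℝ, W) f x (X₂ x)) (mfderiv I 𝓘(ℝ, W) f x (Y₂ x)) -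
      interiorExtDeriv W η₂ (f x) (mfderiv I 𝓘(ℝ, W) f x (X₁ x)) (mfderiv I 𝓘(ℝ, W) f x (Y₂ x)) -
      interiorExtDeriv W η₂ (f x) (mfderiv I 𝓘(ℝ, W) f x (X₂ x)) (mfderiv I 𝓘(ℝ, W) f x (Y₁ x)) =
    η₂ (f x) (mfderiv I 𝓘(ℝ, W) f x (mlieBracket I X₁ Y₂ x)) +
      η₂ (f x) (mfderiv I 𝓘(ℝ, W) f x (mlieBracket I X₂ Y₁ x)) -
      (η₁ (f x) (mfderiv I 𝓘(ℝ, W) f x (mlieBracket I X₁ Y₁ x)) -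
      η₁ (f x) (mfderiv I 𝓘(ℝ, W) f x (mlieBracket I X₂ Y₂ x))) := by
  rw [interiorExtDeriv_mfderiv_apply hf hη₁ hX₁ hY₁, interiorExtDeriv_mfderiv_apply hf hη₁ hX₂ hY₂,
    interiorExtDeriv_mfderiv_apply hf hη₂ hX₁ hY₂, interiorExtDeriv_mfderiv_apply hf hη₂ hX₂ hY₁]
  -- The annihilation identities hold near `x`, so the derivative terms of Cartan's formula cancel
  -- and only brackets remain.
  have h1 := Filter.EventuallyEq.mvfderiv_eq (I := I) hX
  have h2 := Filter.EventuallyEq.mvfderiv_eq (I := I) hX'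
  have h3 := Filter.EventuallyEq.mvfderiv_eq (I := I) hY
  have h4 := Filter.EventuallyEq.mvfderiv_eq (I := I) hY'
  rw [mvfderiv_fun_neg] at h2 h4
  rw [h1, h2, h3, h4]
  simp only [neg_apply]
  ring

/-- The form `η` applied to the bracket of two vector fields. -/
theorem interiorExtDeriv_pair [CompleteSpace W]
    {η₁ η₂ : (y : M) → (TangentSpace 𝓘(ℝ, W) y →L[ℝ] ℝ)} {x : M}
    (hη₁ : DifferentiableAt ℝ (chartOneForm W x η₁) (extChartAt 𝓘(ℝ, W) x x))
    (hη₂ : DifferentiableAt ℝ (chartOneForm W x η₂) (extChartAt 𝓘(ℝ, W) x x))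
    {X₁ X₂ Y₁ Y₂ : (y : M) → TangentSpace 𝓘(ℝ, W) y}
    (hX₁ : MDifferentiableAt 𝓘(ℝ, W) 𝓘(ℝ, W).tangent
      (fun y => (X₁ y : TangentBundle 𝓘(ℝ, W) M)) x)
    (hX₂ : MDifferentiableAt 𝓘(ℝ, W) 𝓘(ℝ, W).tangent
      (fun y => (X₂ y : TangentBundle 𝓘(ℝ, W) M)) x)
    (hY₁ : MDifferentiableAt 𝓘(ℝ, W) 𝓘(ℝ, W).tangent
      (fun y => (Y₁ y : TangentBundle 𝓘(ℝ, W) M)) x)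
    (hY₂ : MDifferentiableAt 𝓘(ℝ, W) 𝓘(ℝ, W).tangent
      (fun y => (Y₂ y : TangentBundle 𝓘(ℝ, W) M)) x)
    (hX : ∀ᶠ z in 𝓝 x, η₁ z (X₁ z) = η₂ z (X₂ z))
    (hX' : ∀ᶠ z in 𝓝 x, η₁ z (X₂ z) = -η₂ z (X₁ z))
    (hY : ∀ᶠ z in 𝓝 x, η₁ z (Y₁ z) = η₂ z (Y₂ z))
    (hY' : ∀ᶠ z in 𝓝 x, η₁ z (Y₂ z) = -η₂ z (Y₁ z)) :
    interiorExtDeriv W η₁ x (X₁ x) (Y₁ x) - interiorExtDeriv W η₁ x (X₂ x) (Y₂ x) -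
      interiorExtDeriv W η₂ x (X₁ x) (Y₂ x) - interiorExtDeriv W η₂ x (X₂ x) (Y₁ x) =
    η₂ x (mlieBracket 𝓘(ℝ, W) X₁ Y₂ x) + η₂ x (mlieBracket 𝓘(ℝ, W) X₂ Y₁ x) -
      (η₁ x (mlieBracket 𝓘(ℝ, W) X₁ Y₁ x) - η₁ x (mlieBracket 𝓘(ℝ, W) X₂ Y₂ x)) := by
  have hid : ∀ (z : M) (v : TangentSpace 𝓘(ℝ, W) z),
      (mfderiv 𝓘(ℝ, W) 𝓘(ℝ, W) (id : M → M) z v : TangentSpace 𝓘(ℝ, W) z) = v := fun z v =>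
    congrArg (fun L : TangentSpace 𝓘(ℝ, W) z →L[ℝ] TangentSpace 𝓘(ℝ, W) z => L v) mfderiv_id
  have key : ∀ (η : (y : M) → (TangentSpace 𝓘(ℝ, W) y →L[ℝ] ℝ)) (z : M)
      (v : TangentSpace 𝓘(ℝ, W) z),
      η (id z) (mfderiv 𝓘(ℝ, W) 𝓘(ℝ, W) (id : M → M) z v) = η z v := fun η z v =>
    congrArg (η z) (hid z v)
  have keyd : ∀ (η : (y : M) → (TangentSpace 𝓘(ℝ, W) y →L[ℝ] ℝ))
      (v w : TangentSpace 𝓘(ℝ, W) x),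
      interiorExtDeriv W η (id x) (mfderiv 𝓘(ℝ, W) 𝓘(ℝ, W) (id : M → M) x v)
        (mfderiv 𝓘(ℝ, W) 𝓘(ℝ, W) (id : M → M) x w) = interiorExtDeriv W η x v w := fun η v w =>
    congrArg₂ (fun a b : TangentSpace 𝓘(ℝ, W) x => interiorExtDeriv W η x a b)
      (hid x v) (hid x w)
  have h := interiorExtDeriv_pair_mfderiv (f := (id : M → M)) (η₁ := η₁) (η₂ := η₂) (x := x)
    contMDiffAt_id hη₁ hη₂ hX₁ hX₂ hY₁ hY₂ (by simpa only [key] using hX)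
    (by simpa only [key] using hX') (by simpa only [key] using hY) (by simpa only [key] using hY')
  rw [keyd, keyd, keyd, keyd, key, key, key, key] at h
  exact h

end Involutivity

/-! ### Dirac structures from adapted frames -/

section DiracOfFrames

open VectorField

variable {W : Type*} [NormedAddCommGroup W] [NormedSpace ℝ W] [FiniteDimensional ℝ W]
  {M : Type*} [TopologicalSpace M] [ChartedSpace W M] [IsManifold 𝓘(ℝ, W) ∞ M]
  {ι : Type*} [Fintype ι] {P : Set ι}

theorem regularFiber_congr {V : Type*} [AddCommGroup V] [Module ℝ V] [TopologicalSpace V]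
    {Θ Θ' : V ≃L[ℝ] (ι → ℂ)}
    (h : ∀ x y, PairIn P (Θ x) (Θ y) ↔ PairIn P (Θ' x) (Θ' y)) :
    regularFiber P Θ = regularFiber P Θ' := by
  ext z
  simp only [mem_regularFiber, h]

/-- Every fibre is the transport of one fixed subspace over `ℂ^ι`; a basis of that subspace, moved
by `Ψ`, is a smooth frame. -/
theorem exists_frame_regularFiber {Ψ : (y : M) → TangentSpace 𝓘(ℝ, W) y ≃L[ℝ] (ι → ℂ)} {V : Set M}
    (h : ∀ y ∈ V, ∀ v, ContMDiffAt 𝓘(ℝ, W) (𝓘(ℝ, W).prod 𝓘(ℝ, W)) ∞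
      (fun y => Bundle.TotalSpace.mk' W (E := fun y : M => TangentSpace 𝓘(ℝ, W) y) y
        ((Ψ y).symm v)) y) (P : Set ι) :
    ∃ (r : ℕ) (s : Fin r → (y : M) → ComplexGenTangentSpace W y),
      (∀ j, IsSmoothComplexSectionOn W (s j) V) ∧
      ∀ y ∈ V, LinearIndependent ℂ (fun j => s j y) ∧
        Submodule.span ℂ (Set.range fun j => s j y) = regularFiber P (Ψ y) := by
  let R := regularFiber P (ContinuousLinearEquiv.refl ℝ (ι → ℂ))
  let b := Module.finBasis ℂ R
  let f : (y : M) → ℂ ⊗[ℝ] ((ι → ℂ) × ((ι → ℂ) →L[ℝ] ℝ)) →ₗ[ℂ] ComplexGenTangentSpace W y :=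
    fun y => (genTransport (Ψ y).symm).baseChange ℂ
  have hsm : ∀ a : (ι → ℂ) × ((ι → ℂ) →L[ℝ] ℝ),
      IsSmoothSectionOn W (fun y => genTransport (Ψ y).symm a) V := fun a =>
    ⟨fun y hy => (h y hy a.1).contMDiffWithinAt,
      fun y hy => (contMDiffAt_oneForm_of_frame (h y hy) a.2).contMDiffWithinAt⟩
  refine ⟨_, fun j y => f y (b j), fun j => ⟨?_, ?_⟩, fun y hy => ⟨?_, ?_⟩⟩
  · simp only [f, complexificationRe_baseChange]
    exact hsm _
  · simp only [f, complexificationIm_baseChange]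
    exact hsm _
  · exact (b.linearIndependent.map' R.subtype R.ker_subtype).map' (f y)
      (LinearMap.ker_eq_bot.2 (genTransport_injective _))
  · have h1 : (Set.range fun j => f y (b j)) = f y '' (R.subtype '' Set.range b) := by
      rw [← Set.range_comp, ← Set.range_comp]
      rfl
    rw [h1, ← Submodule.map_span, ← Submodule.map_span, b.span_eq, Submodule.map_subtype_top]
    exact map_genTransport_regularFiber _ _

-- `Θ` itself need not vary smoothly: `hS` provides smooth local frames that define the same `E`.
-- The conclusion of `hK` is the real part of `dη (x₁ + i x₂, w₁ + i w₂) = 0` for `η = η₁ + i η₂`.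
variable {Θ : (y : M) → TangentSpace 𝓘(ℝ, W) y ≃L[ℝ] (ι → ℂ)}
  (hS : ∀ y₀ : M, ∃ (Ψ : (y : M) → TangentSpace 𝓘(ℝ, W) y ≃L[ℝ] (ι → ℂ)) (V : Set M),
    IsOpen V ∧ y₀ ∈ V ∧ (∀ y ∈ V, ∀ v, ContMDiffAt 𝓘(ℝ, W) (𝓘(ℝ, W).prod 𝓘(ℝ, W)) ∞
      (fun y => Bundle.TotalSpace.mk' W (E := fun y : M => TangentSpace 𝓘(ℝ, W) y) y
        ((Ψ y).symm v)) y) ∧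
    ∀ y ∈ V, ∀ x₁ x₂, PairIn P (Ψ y x₁) (Ψ y x₂) ↔ PairIn P (Θ y x₁) (Θ y x₂))
  (hK : ∀ (y : M) (η₁ η₂ : (z : M) → (TangentSpace 𝓘(ℝ, W) z →L[ℝ] ℝ)),
    DifferentiableAt ℝ (chartOneForm W y η₁) (extChartAt 𝓘(ℝ, W) y y) →
    DifferentiableAt ℝ (chartOneForm W y η₂) (extChartAt 𝓘(ℝ, W) y y) →
    (∀ᶠ z in 𝓝 y, ∀ x₁ x₂, PairIn P (Θ z x₁) (Θ z x₂) → η₁ z x₁ = η₂ z x₂) →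
    ∀ x₁ x₂ w₁ w₂ : TangentSpace 𝓘(ℝ, W) y, PairIn P (Θ y x₁) (Θ y x₂) →
      PairIn P (Θ y w₁) (Θ y w₂) →
      interiorExtDeriv W η₁ y x₁ w₁ - interiorExtDeriv W η₁ y x₂ w₂ -
        interiorExtDeriv W η₂ y x₁ w₂ - interiorExtDeriv W η₂ y x₂ w₁ = 0)

omit [FiniteDimensional ℝ W] [IsManifold 𝓘(ℝ, W) ∞ M] [Fintype ι] in
theorem eq_neg_of_pairIn {y : M} {η₁ η₂ : TangentSpace 𝓘(ℝ, W) y →L[ℝ] ℝ}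
    (h : ∀ x₁ x₂, PairIn P (Θ y x₁) (Θ y x₂) → η₁ x₁ = η₂ x₂) {x₁ x₂ : TangentSpace 𝓘(ℝ, W) y}
    (hx : PairIn P (Θ y x₁) (Θ y x₂)) : η₁ x₂ = -η₂ x₁ := by
  have := h (-x₂) x₁ (by rw [map_neg]; exact hx.rotate)
  rw [map_neg] at this
  rw [← this, neg_neg]

include hS hK in
-- For annihilating forms with constant coefficients in the frame, Cartan's formula turns `dη = 0`
-- on `E` into `η [X, Y] = 0`, and these forms detect membership in `E`.
theorem pairIn_mlieBracket {y : M} {X₁ X₂ Y₁ Y₂ : (y : M) → TangentSpace 𝓘(ℝ, W) y}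
    (hX₁ : MDifferentiableAt 𝓘(ℝ, W) 𝓘(ℝ, W).tangent
      (fun y => (X₁ y : TangentBundle 𝓘(ℝ, W) M)) y)
    (hX₂ : MDifferentiableAt 𝓘(ℝ, W) 𝓘(ℝ, W).tangent
      (fun y => (X₂ y : TangentBundle 𝓘(ℝ, W) M)) y)
    (hY₁ : MDifferentiableAt 𝓘(ℝ, W) 𝓘(ℝ, W).tangent
      (fun y => (Y₁ y : TangentBundle 𝓘(ℝ, W) M)) y)
    (hY₂ : MDifferentiableAt 𝓘(ℝ, W) 𝓘(ℝ, W).tangent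
      (fun y => (Y₂ y : TangentBundle 𝓘(ℝ, W) M)) y)
    (hX : ∀ᶠ z in 𝓝 y, PairIn P (Θ z (X₁ z)) (Θ z (X₂ z)))
    (hY : ∀ᶠ z in 𝓝 y, PairIn P (Θ z (Y₁ z)) (Θ z (Y₂ z))) :
    PairIn P
      (Θ y (mlieBracket 𝓘(ℝ, W) X₁ Y₁ y - mlieBracket 𝓘(ℝ, W) X₂ Y₂ y))
      (Θ y (mlieBracket 𝓘(ℝ, W) X₁ Y₂ y + mlieBracket 𝓘(ℝ, W) X₂ Y₁ y)) := by
  have : CompleteSpace W := FiniteDimensional.complete ℝ W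
  obtain ⟨Ψ, V, hV, hyV, hΨ, hiff⟩ := hS y
  rw [← hiff y hyV]
  refine pairIn_of_forall_form fun f₁ f₂ hf => ?_
  let η : ((ι → ℂ) →L[ℝ] ℝ) → (z : M) → (TangentSpace 𝓘(ℝ, W) z →L[ℝ] ℝ) := fun f z =>
    f.comp (Ψ z : TangentSpace 𝓘(ℝ, W) z →L[ℝ] (ι → ℂ))
  have hη : ∀ f, DifferentiableAt ℝ (chartOneForm W y (η f)) (extChartAt 𝓘(ℝ, W) y y) := fun f =>
    differentiableAt_chartOneForm (contMDiffAt_oneForm_of_frame (hΨ y hyV) f)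
  have hann : ∀ᶠ z in 𝓝 y, ∀ x₁ x₂, PairIn P (Θ z x₁) (Θ z x₂) → η f₁ z x₁ = η f₂ z x₂ := by
    filter_upwards [hV.mem_nhds hyV] with z hz x₁ x₂ hx
    exact hf _ _ ((hiff z hz x₁ x₂).2 hx)
  have h0 := hK y (η f₁) (η f₂) (hη f₁) (hη f₂) hann _ _ _ _ hX.self_of_nhds hY.self_of_nhds
  rw [interiorExtDeriv_pair (hη f₁) (hη f₂) hX₁ hX₂ hY₁ hY₂
    (by filter_upwards [hann, hX] with z hz hx using hz _ _ hx)
    (by filter_upwards [hann, hX] with z hz hx using eq_neg_of_pairIn hz hx)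
    (by filter_upwards [hann, hY] with z hz hx using hz _ _ hx)
    (by filter_upwards [hann, hY] with z hz hx using eq_neg_of_pairIn hz hx)] at h0
  change η f₁ y _ = η f₂ y _
  rw [map_sub, map_add]
  linarith

/-- The fibres `E ⊕ Ann E` form a complex Dirac structure if there are smooth local frames adapted
to `E`, and `d η` vanishes on `E` for the forms `η` annihilating `E`. -/
noncomputable def diracOfFrames : ComplexDiracStructure W M where
  fiber y := regularFiber P (Θ y)
  smooth y₀ := by
    obtain ⟨Ψ, V, hV, hyV, hΨ, hiff⟩ := hS y₀
    obtain ⟨r, s, h1, h2⟩ := exists_frame_regularFiber hΨ P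
    refine ⟨V, hV, hyV, r, s, h1, fun y hy => ⟨(h2 y hy).1, (h2 y hy).2.trans ?_⟩⟩
    exact regularFiber_congr (hiff y hy)
  maximal_isotropic y := maximal_isIsotropic_regularFiber y (Θ y)
  involutive V hV s t hs ht hsf htf y hy := by
    have hVy := hV.mem_nhds hy
    have hmd : ∀ {a : (y : M) → GenTangentSpace W y}, IsSmoothSectionOn W a V →
        MDifferentiableAt 𝓘(ℝ, W) 𝓘(ℝ, W).tangent
          (fun y => ((a y).1 : TangentBundle 𝓘(ℝ, W) M)) y := fun ha =>
      (ha.1.contMDiffAt hVy).mdifferentiableAt (by simp)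
    have hdf : ∀ {a : (y : M) → GenTangentSpace W y}, IsSmoothSectionOn W a V →
        DifferentiableAt ℝ (chartOneForm W y fun z => (a z).2) (extChartAt 𝓘(ℝ, W) y y) :=
      fun ha => differentiableAt_chartOneForm (ha.2.contMDiffAt hVy)
    have hsE : ∀ᶠ z in 𝓝 y, PairIn P (Θ z (complexificationRe (s z)).1)
        (Θ z (complexificationIm (s z)).1) := by
      filter_upwards [hVy] with z hz using (hsf z hz).1
    have htE : ∀ᶠ z in 𝓝 y, PairIn P (Θ z (complexificationRe (t z)).1)
        (Θ z (complexificationIm (t z)).1) := by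
      filter_upwards [hVy] with z hz using (htf z hz).1
    have hsA : ∀ᶠ z in 𝓝 y, ∀ x₁ x₂, PairIn P (Θ z x₁) (Θ z x₂) →
        (complexificationRe (s z)).2 x₁ = (complexificationIm (s z)).2 x₂ := by
      filter_upwards [hVy] with z hz using (hsf z hz).2
    have htA : ∀ᶠ z in 𝓝 y, ∀ x₁ x₂, PairIn P (Θ z x₁) (Θ z x₂) →
        (complexificationRe (t z)).2 x₁ = (complexificationIm (t z)).2 x₂ := by
      filter_upwards [hVy] with z hz using (htf z hz).2
    rw [mem_regularFiber]
    simp only [complexCourantBracket, complexificationRe_mk, complexificationIm_mk]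
    constructor
    · exact pairIn_mlieBracket hS hK (hmd hs.1) (hmd hs.2) (hmd ht.1) (hmd ht.2) hsE htE
    · intro w₁ w₂ hw
      have ks := hK y _ _ (hdf hs.1) (hdf hs.2) hsA _ _ _ _ htE.self_of_nhds hw
      have kt := hK y _ _ (hdf ht.1) (hdf ht.2) htA _ _ _ _ hsE.self_of_nhds hw
      have hfd : ∀ {F G : M → ℝ}, F =ᶠ[𝓝 y] G →
          functionDifferential W F y w₁ = functionDifferential W G y w₁ := fun h =>
        congrArg (fun L => L w₁) (h.mfderiv_eq (I := 𝓘(ℝ, W)) (I' := 𝓘(ℝ, ℝ)))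
      have hfd' : ∀ {F G : M → ℝ}, F =ᶠ[𝓝 y] (fun z => -G z) →
          functionDifferential W F y w₂ = -functionDifferential W G y w₂ := fun {F G} h =>
        (congrArg (fun L : TangentSpace 𝓘(ℝ, W) y →L[ℝ] ℝ => L w₂) (h.mfderiv_eq (I := 𝓘(ℝ, W)) (I' := 𝓘(ℝ, ℝ)))).trans
          (congrArg (fun L : TangentSpace 𝓘(ℝ, W) y →L[ℝ] ℝ => L w₂)
            (mfderiv_neg (I := 𝓘(ℝ, W)) (f := G) (x := y)))
      -- For sections `X + ξ` and `Y + η`, the complex functions `η X` and `ξ Y` vanish near `y`, so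
      -- their differentials drop out. On `E` the form part of the bracket is then `i_X dη - i_Y
      -- dξ`, which `kt` and `ks` kill.
      have h1 : (fun z => (complexificationRe (t z)).2 (complexificationRe (s z)).1) =ᶠ[𝓝 y]
          fun z => (complexificationIm (t z)).2 (complexificationIm (s z)).1 := by
        filter_upwards [htA, hsE] with z hz hx using hz _ _ hx
      have h2 : (fun z => (complexificationRe (s z)).2 (complexificationRe (t z)).1) =ᶠ[𝓝 y]
          fun z => (complexificationIm (s z)).2 (complexificationIm (t z)).1 := by
        filter_upwards [hsA, htE] with z hz hx using hz _ _ hx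
      have h3 : (fun z => (complexificationRe (t z)).2 (complexificationIm (s z)).1) =ᶠ[𝓝 y]
          fun z => -(complexificationIm (t z)).2 (complexificationRe (s z)).1 := by
        filter_upwards [htA, hsE] with z hz hx using eq_neg_of_pairIn hz hx
      have h4 : (fun z => (complexificationRe (s z)).2 (complexificationIm (t z)).1) =ᶠ[𝓝 y]
          fun z => -(complexificationIm (s z)).2 (complexificationRe (t z)).1 := by
        filter_upwards [hsA, htE] with z hz hx using eq_neg_of_pairIn hz hx
      have h5 : (fun z => (complexificationRe (t z)).2 (complexificationIm (s z)).1 -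
          (complexificationIm (s z)).2 (complexificationRe (t z)).1) =ᶠ[𝓝 y]
          fun z => -((complexificationIm (t z)).2 (complexificationRe (s z)).1 -
            (complexificationRe (s z)).2 (complexificationIm (t z)).1) := by
        filter_upwards [h3, h4] with z hz hz'
        rw [hz, hz']
        ring
      have h6 : (fun z => (complexificationRe (t z)).2 (complexificationRe (s z)).1 -
          (complexificationRe (s z)).2 (complexificationRe (t z)).1) =ᶠ[𝓝 y]
          fun z => (complexificationIm (t z)).2 (complexificationIm (s z)).1 -
            (complexificationIm (s z)).2 (complexificationIm (t z)).1 := h1.sub h2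
      simp only [courantBracket, lieDerivOneForm, Prod.snd_sub, Prod.snd_add, sub_apply, add_apply,
        smul_apply, smul_eq_mul]
      rw [hfd h1, hfd h2, hfd h6, hfd' h3, hfd' h4, hfd' h5]
      linarith

end DiracOfFrames

/-! ### The invariant Dirac structure on the homogeneous space -/

section InvariantDirac

open VectorField

variable {E : Type*} [NormedAddCommGroup E] [NormedSpace ℝ E] [CompleteSpace E]
  {W : Type*} [NormedAddCommGroup W] [NormedSpace ℝ W] [FiniteDimensional ℝ W]
  {U : Type*} [TopologicalSpace U] [T2Space U] [ChartedSpace E U] [Group U]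
  [LieGroup 𝓘(ℝ, E) ∞ U]
  {T : Subgroup U} [ChartedSpace W (U ⧸ T)] [IsManifold 𝓘(ℝ, W) ∞ (U ⧸ T)]
  {ι : Type*} [Fintype ι] {θ : GroupLieAlgebra 𝓘(ℝ, E) U →ₗ[ℝ] (ι → ℂ)} {P : Set ι}
  (hπ : Manifold.IsSubmersion 𝓘(ℝ, E) 𝓘(ℝ, W) ∞ (QuotientGroup.mk : U → U ⧸ T))
  (hθ : IsRootCoordinates θ P) (hT : T = integralSubgroup {ξ | θ ξ = 0})
  {C : U → W ≃L[ℝ] (ι → ℂ)}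
  (hC : ∀ g v, C g (projectionDeriv (E := E) (W := W) T g v) = θ v)

local notation "π" => (QuotientGroup.mk : U → U ⧸ T)

include hπ hθ hT hC

/-- Representatives of one coset differ by an element of `T`, which acts on coordinates by an
invertible diagonal matrix. This makes `E` well defined on `U ⧸ T`. -/
theorem pairIn_coordinates_iff {g h : U} (hgh : π g = π h) (x y : W) :
    PairIn P (C g x) (C g y) ↔ PairIn P (C h x) (C h y) := by
  obtain ⟨χ, hχ, hχ'⟩ := exists_projectionDeriv_mul (W := W) hπ hθ hT (QuotientGroup.eq.1 hgh)
  have key : ∀ w α, C h w α = χ α * C g w α := by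
    intro w α
    obtain ⟨v, rfl⟩ := projectionDeriv_surjective (E := E) (W := W) hπ h w
    obtain ⟨v', hv'⟩ := projectionDeriv_surjective (E := E) (W := W) hπ g
      (projectionDeriv (E := E) (W := W) T h v)
    have h1 := hχ' g v v' (by rw [mul_inv_cancel_left]; exact hv'.symm) α
    rw [hC, h1, ← hv', hC]
  exact (pairIn_diagonal_iff hχ (key x) (key y)).symm

omit [T2Space U] [FiniteDimensional ℝ W] [Fintype ι] hT in
-- Along a smooth local section of `π`, the coordinate vector fields are projections of
-- left-invariant fields.
theorem exists_smooth_coordinates (y₀ : U ⧸ T) :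
    ∃ (σ : U ⧸ T → U) (V : Set (U ⧸ T)), IsOpen V ∧ y₀ ∈ V ∧ (∀ y ∈ V, π (σ y) = y) ∧
      ∀ y ∈ V, ∀ v, ContMDiffAt 𝓘(ℝ, W) (𝓘(ℝ, W).prod 𝓘(ℝ, W)) ∞
        (fun y => Bundle.TotalSpace.mk' W (E := fun y : U ⧸ T => TangentSpace 𝓘(ℝ, W) y) y
          ((C (σ y)).symm v)) y := by
  obtain ⟨g, rfl⟩ := QuotientGroup.mk_surjective y₀
  obtain ⟨σ, V, hV, hgV, -, hσ, hsec⟩ := (hπ.isSubmersionAt g).exists_section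
  refine ⟨σ, V, hV, hgV, hsec, fun y hy v => ?_⟩
  obtain ⟨u, rfl⟩ := hθ.surjective v
  have h1 : ContMDiffAt 𝓘(ℝ, W) 𝓘(ℝ, W).tangent ∞ (fun y => tangentMap 𝓘(ℝ, E) 𝓘(ℝ, W) π
      (mulInvariantVectorField u (σ y) : TangentBundle 𝓘(ℝ, E) U)) y :=
    (hπ.contMDiff.contMDiff_tangentMap (m := ∞) (by simp)).contMDiffAt.comp y
      ((contMDiff_infty_mulInvariantVectorField u).contMDiffAt.comp y
        (hσ.contMDiffAt (hV.mem_nhds hy)))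
  refine h1.congr_of_eventuallyEq ?_
  filter_upwards [hV.mem_nhds hy] with z hz
  have h2 : (C (σ z)).symm (θ u) = projectionDeriv (E := E) (W := W) T (σ z) u := by
    rw [ContinuousLinearEquiv.symm_apply_eq, hC]
  have h3 : ∀ (z' : U ⧸ T) (w : W), z' = z →
      (Bundle.TotalSpace.mk' W (E := fun y : U ⧸ T => TangentSpace 𝓘(ℝ, W) y) z w) =
      Bundle.TotalSpace.mk' W (E := fun y : U ⧸ T => TangentSpace 𝓘(ℝ, W) y) z' w := by
    rintro _ w rfl
    rfl
  rw [h2]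
  exact h3 (π (σ z)) _ (hsec z hz)

/-- The vectors at `π g` are lifted to left-invariant fields on `U`. The pullback of `η₁ + i η₂`
annihilates such complex fields near `g`, and also their bracket by `lie_pairIn`, so every term of
Cartan's formula vanishes. -/
theorem interiorExtDeriv_eq_zero_of_pairIn (g : U)
    {η₁ η₂ : (z : U ⧸ T) → (TangentSpace 𝓘(ℝ, W) z →L[ℝ] ℝ)}
    (hη₁ : DifferentiableAt ℝ (chartOneForm W (π g) η₁) (extChartAt 𝓘(ℝ, W) (π g) (π g)))
    (hη₂ : DifferentiableAt ℝ (chartOneForm W (π g) η₂) (extChartAt 𝓘(ℝ, W) (π g) (π g)))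
    (h : ∀ᶠ z in 𝓝 (π g), ∀ (h : U) (x₁ x₂ : W), π h = z → PairIn P (C h x₁) (C h x₂) →
      η₁ z x₁ = η₂ z x₂) {x₁ x₂ w₁ w₂ : W} (hx : PairIn P (C g x₁) (C g x₂))
    (hw : PairIn P (C g w₁) (C g w₂)) :
    interiorExtDeriv W η₁ (π g) x₁ w₁ - interiorExtDeriv W η₁ (π g) x₂ w₂ -
      interiorExtDeriv W η₂ (π g) x₁ w₂ - interiorExtDeriv W η₂ (π g) x₂ w₁ = 0 := by
  obtain ⟨u₁, rfl⟩ := projectionDeriv_surjective (E := E) (W := W) hπ g x₁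
  obtain ⟨u₂, rfl⟩ := projectionDeriv_surjective (E := E) (W := W) hπ g x₂
  obtain ⟨v₁, rfl⟩ := projectionDeriv_surjective (E := E) (W := W) hπ g w₁
  obtain ⟨v₂, rfl⟩ := projectionDeriv_surjective (E := E) (W := W) hπ g w₂
  rw [hC, hC] at hx hw
  have hev : ∀ᶠ z in 𝓝 g, ∀ a b : GroupLieAlgebra 𝓘(ℝ, E) U, PairIn P (θ a) (θ b) →
      η₁ (π z) (projectionDeriv (E := E) (W := W) T z a) =
        η₂ (π z) (projectionDeriv (E := E) (W := W) T z b) := by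
    filter_upwards [hπ.contMDiff.continuous.continuousAt.eventually h] with z hz a b hab
    exact hz z _ _ rfl (by rwa [hC, hC])
  have hneg : ∀ (z : U) (a : GroupLieAlgebra 𝓘(ℝ, E) U),
      η₁ (π z) (projectionDeriv (E := E) (W := W) T z (-a)) =
        -η₁ (π z) (projectionDeriv (E := E) (W := W) T z a) := fun z a => by
    rw [map_neg]
    exact map_neg (η₁ (π z)) _
  have hev' : ∀ᶠ z in 𝓝 g, ∀ a b : GroupLieAlgebra 𝓘(ℝ, E) U, PairIn P (θ a) (θ b) →
      η₁ (π z) (projectionDeriv (E := E) (W := W) T z b) =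
        -η₂ (π z) (projectionDeriv (E := E) (W := W) T z a) := by
    filter_upwards [hev] with z hz a b hab
    have h1 := hz (-b) a (by rw [map_neg]; exact hab.rotate)
    rw [hneg] at h1
    rw [← h1, neg_neg]
  have hmd : ∀ a : GroupLieAlgebra 𝓘(ℝ, E) U, MDifferentiableAt 𝓘(ℝ, E) 𝓘(ℝ, E).tangent
      (fun y => (mulInvariantVectorField a y : TangentBundle 𝓘(ℝ, E) U)) g := fun a =>
    mdifferentiableAt_mulInvariantVectorField a
  have key := interiorExtDeriv_pair_mfderiv
    (hπ.contMDiff.contMDiffAt.of_le (ENat.LEInfty.out (m := 2))) hη₁ hη₂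
    (hmd u₁) (hmd u₂) (hmd v₁) (hmd v₂)
    (by filter_upwards [hev] with z hz using hz u₁ u₂ hx)
    (by filter_upwards [hev'] with z hz using hz u₁ u₂ hx)
    (by filter_upwards [hev] with z hz using hz v₁ v₂ hw)
    (by filter_upwards [hev'] with z hz using hz v₁ v₂ hw)
  refine key.trans ?_
  rw [mlieBracket_mulInvariantVectorField, mlieBracket_mulInvariantVectorField,
    mlieBracket_mulInvariantVectorField, mlieBracket_mulInvariantVectorField]
  have h1 := hev.self_of_nhds _ _ (hθ.lie_pairIn u₁ u₂ v₁ v₂ hx hw)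
  rw [map_sub, map_add] at h1
  have h2 := (map_sub (η₁ (π g)) _ _).symm.trans (h1.trans (map_add (η₂ (π g)) _ _))
  exact sub_eq_zero.2 h2.symm

theorem exists_invariant_dirac :
    ∃ L : ComplexDiracStructure W (U ⧸ T), L.IsInvariant U ∧
      ∀ y, ∃ Θ : TangentSpace 𝓘(ℝ, W) y ≃L[ℝ] (ι → ℂ), L.fiber y = regularFiber P Θ := by
  -- The representative `y.out` depends on `y` without any continuity; only the fibre matters, and
  -- it is independent of the representative.
  let Θ : (y : U ⧸ T) → TangentSpace 𝓘(ℝ, W) y ≃L[ℝ] (ι → ℂ) := fun y => C y.out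
  have hΘ : ∀ (g : U) (x₁ x₂ : W), PairIn P (C (π g).out x₁) (C (π g).out x₂) ↔
      PairIn P (C g x₁) (C g x₂) := fun g =>
    pairIn_coordinates_iff hπ hθ hT hC (QuotientGroup.out_eq' _)
  have hfib : ∀ g : U, regularFiber P (Θ (π g)) =
      regularFiber (V := TangentSpace 𝓘(ℝ, W) (π g)) P (C g) := fun g =>
    regularFiber_congr (hΘ g)
  refine ⟨diracOfFrames (P := P) (Θ := Θ) ?_ ?_, ?_, fun y => ⟨Θ y, rfl⟩⟩
  · intro y₀
    obtain ⟨σ, V, hV, hy, hsec, hsm⟩ := exists_smooth_coordinates hπ hθ hC y₀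
    refine ⟨fun y => C (σ y), V, hV, hy, hsm, fun y hy x₁ x₂ => ?_⟩
    exact pairIn_coordinates_iff hπ hθ hT hC ((hsec y hy).trans (QuotientGroup.out_eq' y).symm) _ _
  · intro y η₁ η₂ hη₁ hη₂ hann x₁ x₂ w₁ w₂ hx hw
    obtain ⟨g, rfl⟩ := QuotientGroup.mk_surjective y
    refine interiorExtDeriv_eq_zero_of_pairIn hπ hθ hT hC g hη₁ hη₂ ?_ ((hΘ g _ _).1 hx)
      ((hΘ g _ _).1 hw)
    filter_upwards [hann] with z hz h x₁ x₂ hhz hx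
    subst hhz
    exact hz x₁ x₂ ((hΘ h _ _).2 hx)
  · intro g x
    obtain ⟨h, rfl⟩ := QuotientGroup.mk_surjective x
    -- By left invariance, translation by `g` is the identity in the coordinates `C h` and `C (g *
    -- h)`.
    let Ψ : TangentSpace 𝓘(ℝ, W) (π h) ≃L[ℝ] TangentSpace 𝓘(ℝ, W) (g • π h) :=
      (C h).trans (C (g * h)).symm
    have hd : mfderiv 𝓘(ℝ, W) 𝓘(ℝ, W) (fun y : U ⧸ T => g • y) (π h) = Ψ := by
      ext w
      obtain ⟨v, rfl⟩ := projectionDeriv_surjective (E := E) (W := W) hπ h w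
      refine (mfderiv_smul_mfderiv_mk hπ g h v).trans ?_
      change projectionDeriv (E := E) (W := W) T (g * h) v =
        (C (g * h)).symm (C h (projectionDeriv (E := E) (W := W) T h v))
      rw [hC, eq_comm, ContinuousLinearEquiv.symm_apply_eq, hC]
    have hl : genTangentLift W (fun y : U ⧸ T => g • y) (π h) = genTransport Ψ := by
      refine LinearMap.ext fun a => ?_
      refine Prod.ext (congrArg (fun L => L a.1) hd) ?_
      change a.2.comp (mfderiv 𝓘(ℝ, W) 𝓘(ℝ, W) (fun y : U ⧸ T => g • y) (π h)).inverse = _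
      rw [hd, ContinuousLinearMap.inverse_equiv]
      rfl
    change (regularFiber P (Θ (π h))).map
      ((genTangentLift W (fun y : U ⧸ T => g • y) (π h)).baseChange ℂ) =
      regularFiber P (Θ (π (g * h)))
    rw [hl, hfib, hfib]
    refine (map_genTransport_regularFiber Ψ _).trans (regularFiber_congr fun x y => ?_)
    have h1 : ∀ x : W, C h ((C h).symm (C (g * h) x)) = C (g * h) x := fun x =>
      (C h).apply_symm_apply _
    change PairIn P (C h ((C h).symm (C (g * h) x))) (C h ((C h).symm (C (g * h) y))) ↔ _
    exact iff_of_eq (congrArg₂ (PairIn P) (h1 x) (h1 y))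

end InvariantDirac

theorem mainTheorem2
    -- a complex semisimple Lie algebra, a Cartan subalgebra, a simple root system, a Weyl basis
    {𝔤 : Type*} [LieRing 𝔤] [LieAlgebra ℂ 𝔤] [FiniteDimensional ℂ 𝔤]
    [LieAlgebra.IsSemisimple ℂ 𝔤]
    (𝔥 : LieSubalgebra ℂ 𝔤) [𝔥.IsCartanSubalgebra]
    (Δ : (LieAlgebra.IsKilling.rootSystem 𝔥).Base) (B : WeylBasis 𝔥)
    -- a connected Lie group `U` whose Lie algebra is the compact real form of `𝔤`
    {n : ℕ} {U : Type*} [TopologicalSpace U] [T2Space U] [ConnectedSpace U]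
    [ChartedSpace (EuclideanSpace ℝ (Fin n)) U] [Group U] [LieGroup (𝓡 n) ∞ U]
    (φ : GroupLieAlgebra (𝓡 n) U ≃ₗ[ℝ] B.compactRealForm Δ)
    (hφ : ∀ ξ η : GroupLieAlgebra (𝓡 n) U, (φ ⁅ξ, η⁆ : 𝔤) = ⁅(φ ξ : 𝔤), (φ η : 𝔤)⁆)
    -- the maximal torus `T`, and the maximal flag manifold `U ⧸ T` with its smooth structure,
    -- the one for which the projection is a smooth submersion
    (T : Subgroup U) (hT : T = integralSubgroup {ξ | (φ ξ : 𝔤) ∈ B.torusAlgebra Δ})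
    {d : ℕ} [ChartedSpace (EuclideanSpace ℝ (Fin d)) (U ⧸ T)] [IsManifold (𝓡 d) ∞ (U ⧸ T)]
    (hπ : Manifold.IsSubmersion (𝓡 n) (𝓡 d) ∞ (QuotientGroup.mk : U → U ⧸ T))
    (k : ℕ) (hk : k ≤ Nat.card {α : 𝔥.root // Δ.IsPos α}) :
    ∃ L : ComplexDiracStructure (EuclideanSpace ℝ (Fin d)) (U ⧸ T),
      L.IsInvariant U ∧ ∀ x : U ⧸ T, L.realIndex x = 2 * k := by
  classical
  -- The index is twice the number of positive roots left out of `P`, so `k` of them are left out.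
  obtain ⟨P, hP, hθ⟩ := B.exists_isRootCoordinates (Δ := Δ) φ hφ
    (m := Nat.card {α : 𝔥.root // Δ.IsPos α} - k) (Nat.sub_le _ _)
  have hT' : T = integralSubgroup {ξ | (B.rootCoordinates Δ ∘ₗ φ.toLinearMap) ξ = 0} := by
    rw [hT]
    congr 1
    ext ξ
    exact (B.rootCoordinates_eq_zero_iff (φ ξ)).symm
  obtain ⟨C, hC⟩ := exists_coordinates hπ hθ hT'
  obtain ⟨L, hL, hfib⟩ := exists_invariant_dirac hπ hθ hT' hC
  refine ⟨L, hL, fun x => ?_⟩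
  obtain ⟨Θ, hΘ⟩ := hfib x
  rw [ComplexDiracStructure.realIndex, hΘ, finrank_regularFiber_inf_conj, hP,
    Nat.card_eq_fintype_card]
  rw [Nat.card_eq_fintype_card] at hk
  omega
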